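/- **Theorem (Variation theorem for reduced problems).** Let $M$ be a smooth manifold of dimension $n+1$ with a volume form $\omega$, so that around every point there are coordinates $(x^\mu)$ with $\omega=dx^1\wedge\dots\wedge dx^{n+1}$; $M$ is oriented by $\omega$. Let $G$ be a real Lie group of dimension $N$ with Lie algebra $\mathfrak g$ (bracket of left-invariant vector fields), $(b_A)$ a basis of $\mathfrak g$, $e_A$ the corresponding left-invariant vector fields on $G$ and $\lambda^A$ the dual (Maurer–Cartan) $1$-forms. Let $\pi:E\to M$ be a smooth principal $G$-bundle (right action) and $J^1E$ its bundle of $1$-jets of sections. A natural local system consists of coordinates $(x^\mu)$ on $M$ as above, a local trivialisation of $E$ over their domain, and a chart $(y^A)$ of $G$. It gives coordinates $(x^\mu,y^A,\xi^A_\mu)$ on $J^1E$: the $1$-jet at $x$ of a section $\sigma$, which reads $x\mapsto g(x)\in G$ in the trivialisation, has $y^A=y^A(g(x))$ and $\xi^A_\mu=\lambda^A(\partial g/\partial x^\mu)$. Write $\xi_\mu=\xi^A_\mu b_A$, $T^B_A=dy^B(e_A)$, $d^nx_\mu=\partial_{x^\mu}\lrcorner\,\omega$; sums over repeated indices are understood.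 Let $l\in C^\infty(J^1E)$ and let $\ell=l(x^\mu,y^A,\xi^A_\mu)\,\omega$ be the corresponding reduced Lagrangian form. In a natural local system put $$\Theta_\ell=\frac{\partial l}{\partial \xi^A_\mu}\,\lambda^A\wedge d^nx_\mu-\Big(\frac{\partial l}{\partial \xi^A_\mu}\,\xi^A_\mu-l\Big)\omega,\qquad \Omega_\ell=-d\Theta_\ell .$$ Let $\mathcal U\subset M$ be open, $\sigma$ a smooth section of $E$ over $\mathcal U$, and $j^1\sigma$ its holonomic lift. The following are equivalent: 1. $\sigma$ is a stationary point of $\mathcal A=\int_{\mathcal U}(j^1\sigma)^*\ell$: for every compact $K\subset\mathcal U$ and every smooth one-parameter family of sections $(\sigma_\varepsilon)_{\varepsilon\in\mathbb R}$ over $\mathcal U$ with $\sigma_0=\sigma$ and $\sigma_\varepsilon=\sigma$ on $\mathcal U\setminus K$, the derivative $\frac{d}{d\varepsilon}\big|_{\varepsilon=0}\int_K(j^1\sigma_\varepsilon)^*\ell$ exists and is $0$. 2. The Euler–Poincaré equations hold in every natural local system: for $A=1,\dots,N$, along $j^1\sigma$, $$\frac{\partial}{\partial x^\mu}\Big(\frac{\partial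 l}{\partial \xi^A_\mu}\Big|_{j^1\sigma}\Big)-\Big(\mathrm{ad}^*_{\xi_\mu}\frac{\partial l}{\partial \xi_\mu}\Big)_A\Big|_{j^1\sigma}-T^B_A\frac{\partial l}{\partial y^B}\Big|_{j^1\sigma}=0,$$ where $\langle \mathrm{ad}^*_{\xi}\,p,\beta\rangle=\langle p,[\xi,\beta]\rangle$ for $p\in\mathfrak g^*$ and $\xi,\beta\in\mathfrak g$. 3. $(j^1\sigma)^*(W\lrcorner\,\Omega_\ell)=0$ over $\mathcal U$ for every smooth vector field $W$ on $J^1E$. Here it is equivalent to let $W$ range over all smooth vector fields on domains of natural local systems of $J^1E$, or only over the smooth vector fields on $J^1E$ with compact support in the domain of one natural local system. -/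

import Mathlib

open scoped Manifold ContDiff
open MeasureTheory Set

namespace ReducedFieldTheory

noncomputable section

/-! ### Exterior algebra on a normed space -/

/-- The wedge product `α ∧ β` of a `1`-form and a `k`-form:
`(α ∧ β) (v₀, …, v_k) = ∑ i, (-1)^i α(v_i) β(v₀, …, v̂_i, …, v_k)`. -/
def wedge {V : Type*} [NormedAddCommGroup V] [NormedSpace ℝ V] {k : ℕ}
    (α : V →L[ℝ] ℝ) (β : V [⋀^Fin k]→L[ℝ] ℝ) : V [⋀^Fin (k + 1)]→L[ℝ] ℝ :=
  ContinuousAlternatingMap.alternatizeUncurryFin (α.smulRight β)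

/-- The form `dx¹ ∧ … ∧ dx^m` on `ℝ^m`. -/
def coordVolume (m : ℕ) :
    EuclideanSpace ℝ (Fin m) [⋀^Fin m]→L[ℝ] ℝ where
  toMultilinearMap := ((EuclideanSpace.basisFun (Fin m) ℝ).toBasis.det).toMultilinearMap
  cont := by
    change Continuous fun v : Fin m → EuclideanSpace ℝ (Fin m) =>
      (EuclideanSpace.basisFun (Fin m) ℝ).toBasis.det v
    simp only [Module.Basis.det_apply]
    refine Continuous.matrix_det (continuous_matrix fun i j => ?_)
    simp only [Module.Basis.toMatrix_apply, OrthonormalBasis.coe_toBasis_repr_apply,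
      EuclideanSpace.basisFun_repr]
    fun_prop
  map_eq_zero_of_eq' := fun v i j h hij =>
    ((EuclideanSpace.basisFun (Fin m) ℝ).toBasis.det).map_eq_zero_of_eq v h hij

/-! ### The base: a manifold with a volume form -/

section Base

variable {n : ℕ} {M : Type*} [TopologicalSpace M]
  [ChartedSpace (EuclideanSpace ℝ (Fin (n + 1))) M]

/-- A smooth chart `(x^μ)` of `M` in which `ω = dx¹ ∧ … ∧ dx^{n+1}`. -/
structure IsUnimodularChart
    (vol : ∀ x : M, TangentSpace (𝓡 (n + 1)) x [⋀^Fin (n + 1)]→L[ℝ] ℝ)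
    (φ : OpenPartialHomeomorph M (EuclideanSpace ℝ (Fin (n + 1)))) : Prop where
  mem_maximalAtlas : φ ∈ IsManifold.maximalAtlas (𝓡 (n + 1)) ∞ M
  form_eq : ∀ x ∈ φ.source, ∀ v : Fin (n + 1) → TangentSpace (𝓡 (n + 1)) x,
    vol x v = coordVolume (n + 1) fun i => mfderiv (𝓡 (n + 1)) (𝓡 (n + 1)) φ x (v i)

/-- `ω` is a volume form: around every point there are coordinates with
`ω = dx¹ ∧ … ∧ dx^{n+1}`. The orientation of `M` is the one given by `ω`. -/
def IsVolumeForm (vol : ∀ x : M, TangentSpace (𝓡 (n + 1)) x [⋀^Fin (n + 1)]→L[ℝ] ℝ) : Prop :=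
  ∀ x : M, ∃ φ, IsUnimodularChart vol φ ∧ x ∈ φ.source

/-- The measure of the volume form, so that `∫ f ω = ∫ f d(volumeMeasure ω)`. In each chart with
`ω = dx¹ ∧ … ∧ dx^{n+1}` it is Lebesgue measure; these local measures agree on overlaps and
their supremum is the measure obtained by glueing them. -/
def volumeMeasure [MeasurableSpace M]
    (vol : ∀ x : M, TangentSpace (𝓡 (n + 1)) x [⋀^Fin (n + 1)]→L[ℝ] ℝ) : Measure M :=
  ⨆ φ : {φ : OpenPartialHomeomorph M (EuclideanSpace ℝ (Fin (n + 1))) // IsUnimodularChart vol φ},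
    (volume.restrict φ.1.target).map φ.1.symm

end Base

/-! ### Principal bundles, sections and their `1`-jets -/

section Bundle

variable {n N : ℕ}
  {M : Type*} [TopologicalSpace M] [ChartedSpace (EuclideanSpace ℝ (Fin (n + 1))) M]
  {G : Type*} [TopologicalSpace G] [ChartedSpace (EuclideanSpace ℝ (Fin N)) G] [Group G]
  {FE : Type*} [NormedAddCommGroup FE] [NormedSpace ℝ FE] {HE : Type*} [TopologicalSpace HE]
  {IE : ModelWithCorners ℝ FE HE} {E : Type*} [TopologicalSpace E] [ChartedSpace HE E]

/-- A smooth local trivialisation over the open set `U`, for a projection `proj : E → M` and a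
right action `act : E → G → E`. It is given by a smooth local section `sec` on `U`, such that
`(x, g) ↦ sec x · g` is a diffeomorphism from `U × G` onto `proj⁻¹ U`, with smooth inverse
`p ↦ (proj p, fib p)`. -/
structure LocalTriv (n N : ℕ)
    [ChartedSpace (EuclideanSpace ℝ (Fin (n + 1))) M] [ChartedSpace (EuclideanSpace ℝ (Fin N)) G]
    (IE : ModelWithCorners ℝ FE HE) (proj : E → M) (act : E → G → E) where
  U : Set M
  sec : M → E
  fib : E → G
  isOpen_U : IsOpen U
  contMDiffOn_sec : ContMDiffOn (𝓡 (n + 1)) IE ∞ sec U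
  contMDiffOn_fib : ContMDiffOn IE (𝓡 N) ∞ fib (proj ⁻¹' U)
  proj_sec : ∀ x ∈ U, proj (sec x) = x
  fib_act_sec : ∀ x ∈ U, ∀ g : G, fib (act (sec x) g) = g
  act_sec_fib : ∀ p, proj p ∈ U → act (sec (proj p)) (fib p) = p

/-- A smooth principal `G`-bundle structure (right action) on the manifold `E` over `M`. -/
structure PrincipalBundle (n N : ℕ) (M : Type*) [TopologicalSpace M]
    [ChartedSpace (EuclideanSpace ℝ (Fin (n + 1))) M]
    (G : Type*) [TopologicalSpace G] [ChartedSpace (EuclideanSpace ℝ (Fin N)) G] [Group G]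
    (IE : ModelWithCorners ℝ FE HE) (E : Type*) [TopologicalSpace E] [ChartedSpace HE E] where
  proj : E → M
  act : E → G → E
  act_one : ∀ p, act p 1 = p
  act_mul : ∀ p g h, act p (g * h) = act (act p g) h
  proj_act : ∀ p g, proj (act p g) = proj p
  contMDiff_proj : ContMDiff IE (𝓡 (n + 1)) ∞ proj
  contMDiff_act : ContMDiff (IE.prod (𝓡 N)) IE ∞ fun q : E × G => act q.1 q.2
  locally_trivial : ∀ x : M, ∃ τ : LocalTriv n N IE proj act, x ∈ τ.U

/-- A `1`-jet of maps `M → E`: a source, a target, and a linear map between tangent spaces. -/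
structure OneJet (n : ℕ) (M : Type*) [TopologicalSpace M]
    [ChartedSpace (EuclideanSpace ℝ (Fin (n + 1))) M]
    (IE : ModelWithCorners ℝ FE HE) (E : Type*) [TopologicalSpace E] [ChartedSpace HE E] where
  base : M
  pt : E
  lin : TangentSpace (𝓡 (n + 1)) base →L[ℝ] TangentSpace IE pt

/-- The `1`-jet `j¹σ(x) = T_x σ`. -/
def jet (IE : ModelWithCorners ℝ FE HE) (σ : M → E) (x : M) : OneJet n M IE E :=
  ⟨x, σ x, mfderiv (𝓡 (n + 1)) IE σ x⟩

/-- `σ` is a smooth section of the bundle over the set `U`. -/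
structure PrincipalBundle.IsSectionOn (P : PrincipalBundle n N M G IE E)
    (U : Set M) (σ : M → E) : Prop where
  smooth : ContMDiffOn (𝓡 (n + 1)) IE ∞ σ U
  proj_eq : ∀ x ∈ U, P.proj (σ x) = x

/-- The `1`-jet bundle `J¹E`: the set of `1`-jets of local sections. -/
def PrincipalBundle.jetBundle (P : PrincipalBundle n N M G IE E) : Set (OneJet n M IE E) :=
  {j | ∃ (U : Set M) (σ : M → E), IsOpen U ∧ j.base ∈ U ∧ P.IsSectionOn U σ ∧ jet IE σ j.base = j}

open Classical in
/-- The value of `l : J¹E → ℝ` at a jet of maps `M → E` (zero off `J¹E`). -/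
def PrincipalBundle.eval (P : PrincipalBundle n N M G IE E) (l : P.jetBundle → ℝ)
    (j : OneJet n M IE E) : ℝ :=
  if h : j ∈ P.jetBundle then l ⟨j, h⟩ else 0

/-! ### Left-invariant frame, and coordinates on `J¹E` -/

/-- The Maurer-Cartan form `λ^A` in the basis `b` of the Lie algebra: `λ_g(v) = T L_{g⁻¹} v`. -/
def maurerCartan (b : Module.Basis (Fin N) ℝ (GroupLieAlgebra (𝓡 N) G)) (A : Fin N) (g : G)
    (v : TangentSpace (𝓡 N) g) : ℝ :=
  b.repr (show GroupLieAlgebra (𝓡 N) G from mfderiv (𝓡 N) (𝓡 N) (fun h : G => g⁻¹ * h) g v) A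

/-- The matrix `T^B_A = dy^B(e_A)` of the left-invariant frame `e_A(g) = T_1 L_g b_A`, in the chart
`ψ = (y^B)` of `G` at the point with coordinates `y`. -/
def frameMatrix (b : Module.Basis (Fin N) ℝ (GroupLieAlgebra (𝓡 N) G))
    (ψ : OpenPartialHomeomorph G (EuclideanSpace ℝ (Fin N))) (y : EuclideanSpace ℝ (Fin N))
    (B A : Fin N) : ℝ :=
  (show EuclideanSpace ℝ (Fin N) from
    mfderiv (𝓡 N) (𝓡 N) ψ (ψ.symm y) (mulInvariantVectorField (b A) (ψ.symm y))) B

/-- The coordinate space of `J¹E`, with points `(x^μ, y^A, ξ^A_μ)`; the third component is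
`μ ↦ (A ↦ ξ^A_μ)`. -/
abbrev JetCoord (n N : ℕ) : Type :=
  EuclideanSpace ℝ (Fin (n + 1)) × EuclideanSpace ℝ (Fin N) × (Fin (n + 1) → Fin N → ℝ)

/-- The coordinate vector `∂/∂x^μ`. -/
def vecX (n N : ℕ) (μ : Fin (n + 1)) : JetCoord n N := (EuclideanSpace.single μ 1, 0, 0)

/-- The coordinate vector `∂/∂y^B`. -/
def vecY (n : ℕ) {N : ℕ} (B : Fin N) : JetCoord n N := (0, EuclideanSpace.single B 1, 0)

/-- The coordinate vector `∂/∂ξ^A_μ`. -/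
def vecXi {n N : ℕ} (μ : Fin (n + 1)) (A : Fin N) : JetCoord n N :=
  (0, 0, Pi.single μ (Pi.single A 1))

/-- A natural local system of coordinates: a chart `φ = (x^μ)` of `M` with
`ω = dx¹ ∧ … ∧ dx^{n+1}`, a local trivialisation of `E` over its domain, and a chart `ψ = (y^A)`
of `G`. -/
structure LocalSystem (P : PrincipalBundle n N M G IE E)
    (vol : ∀ x : M, TangentSpace (𝓡 (n + 1)) x [⋀^Fin (n + 1)]→L[ℝ] ℝ) where
  φ : OpenPartialHomeomorph M (EuclideanSpace ℝ (Fin (n + 1)))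
  ψ : OpenPartialHomeomorph G (EuclideanSpace ℝ (Fin N))
  triv : LocalTriv n N IE P.proj P.act
  unimodular : IsUnimodularChart vol φ
  mem_maximalAtlas : ψ ∈ IsManifold.maximalAtlas (𝓡 N) ∞ G
  source_subset : φ.source ⊆ triv.U

namespace LocalSystem

variable {P : PrincipalBundle n N M G IE E}
  {vol : ∀ x : M, TangentSpace (𝓡 (n + 1)) x [⋀^Fin (n + 1)]→L[ℝ] ℝ}
  (κ : LocalSystem P vol) (b : Module.Basis (Fin N) ℝ (GroupLieAlgebra (𝓡 N) G))

/-- The open set of `(x, y, ξ)` that are coordinates of a point of `J¹E`. -/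
def domain : Set (JetCoord n N) := κ.φ.target ×ˢ (κ.ψ.target ×ˢ univ)

/-- The jet with coordinates `(x, y, ξ)`. It is represented by the local section whose expression
in coordinates is `x' ↦ y^B + T^B_A(y) ξ^A_μ (x'^μ - x^μ)`; at `x` that section passes through `y`
and its derivative along `∂/∂x^μ` is `ξ^A_μ e_A`. -/
def toJet (z : JetCoord n N) : OneJet n M IE E :=
  jet IE (fun m => P.act (κ.triv.sec m) (κ.ψ.symm (z.2.1 + WithLp.toLp 2 fun B =>
    ∑ A, ∑ μ, frameMatrix b κ.ψ z.2.1 B A * z.2.2 μ A * (κ.φ m μ - z.1 μ)))) (κ.φ.symm z.1)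

/-- The coordinate expression `l(x^μ, y^A, ξ^A_μ)` of a function on `J¹E`. -/
def expr (l : P.jetBundle → ℝ) (z : JetCoord n N) : ℝ := P.eval l (κ.toJet b z)

/-- The `G`-valued expression `x ↦ g(x)` of a section in the trivialisation. -/
def fibre (σ : M → E) (x : EuclideanSpace ℝ (Fin (n + 1))) : G := κ.triv.fib (σ (κ.φ.symm x))

/-- The coordinate expression of `j¹σ`: `x ↦ (x, y(x), ξ(x))` with `ξ^A_μ = λ^A(∂g/∂x^μ)`. -/
def jetSection (σ : M → E) (x : EuclideanSpace ℝ (Fin (n + 1))) : JetCoord n N :=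
  (x, κ.ψ (κ.fibre σ x), fun μ A => maurerCartan b A (κ.fibre σ x)
    (mfderiv (𝓡 (n + 1)) (𝓡 N) (κ.fibre σ) x (EuclideanSpace.single μ (1 : ℝ))))

/-- The coordinates `x` of the points of `U` where `σ` is described by the local system. -/
def sectionDomain (U : Set M) (σ : M → E) : Set (EuclideanSpace ℝ (Fin (n + 1))) :=
  {x | x ∈ κ.φ.target ∧ κ.φ.symm x ∈ U ∧ κ.fibre σ x ∈ κ.ψ.source}

end LocalSystem

/-- `l` is a smooth function on `J¹E`: it is smooth in every natural local system. -/
def IsSmoothLagrangian (P : PrincipalBundle n N M G IE E)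
    (vol : ∀ x : M, TangentSpace (𝓡 (n + 1)) x [⋀^Fin (n + 1)]→L[ℝ] ℝ)
    (b : Module.Basis (Fin N) ℝ (GroupLieAlgebra (𝓡 N) G)) (l : P.jetBundle → ℝ) : Prop :=
  ∀ κ : LocalSystem P vol, ContDiffOn ℝ ∞ (κ.expr b l) κ.domain

/-! ### Stationary sections -/

/-- A smooth one-parameter family `σ_ε` of sections over `U` with `σ₀ = σ`, which agrees with `σ`
off the set `K`. -/
structure IsVariation (P : PrincipalBundle n N M G IE E) (U K : Set M) (σ : M → E)
    (σε : ℝ → M → E) : Prop where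
  smooth : ContMDiffOn (𝓘(ℝ, ℝ).prod (𝓡 (n + 1))) IE ∞ (fun q : ℝ × M => σε q.1 q.2) (univ ×ˢ U)
  proj_eq : ∀ ε, ∀ x ∈ U, P.proj (σε ε x) = x
  eq_zero : ∀ x ∈ U, σε 0 x = σ x
  eq_off : ∀ ε, ∀ x ∈ U \ K, σε ε x = σ x

/-- `σ` is a stationary point of `∫_U (j¹σ)^* ℓ`, with `ℓ = l ω`: the first variation of the action
vanishes for all variations with compact support `K ⊆ U`. As the variation does not change the
section off `K`, the action is taken over `K`, where it is finite. -/
def IsStationary [MeasurableSpace M] (P : PrincipalBundle n N M G IE E)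
    (vol : ∀ x : M, TangentSpace (𝓡 (n + 1)) x [⋀^Fin (n + 1)]→L[ℝ] ℝ)
    (l : P.jetBundle → ℝ) (U : Set M) (σ : M → E) : Prop :=
  ∀ K : Set M, IsCompact K → K ⊆ U → ∀ σε : ℝ → M → E, IsVariation P U K σ σε →
    HasDerivAt (fun ε : ℝ => ∫ x in K, P.eval l (jet IE (σε ε) x) ∂volumeMeasure vol) 0 0

/-! ### Euler-Poincaré equations -/

/-- Component `A` of the left-hand side of the Euler-Poincaré equations along the section `σ`:
`∂_μ (∂l/∂ξ^A_μ) - (ad^*_{ξ_μ} ∂l/∂ξ_μ)_A - T^B_A ∂l/∂y^B`, where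
`⟨ad^*_ξ π, β⟩ = ⟨π, [ξ, β]⟩`. -/
def eulerPoincare {P : PrincipalBundle n N M G IE E}
    {vol : ∀ x : M, TangentSpace (𝓡 (n + 1)) x [⋀^Fin (n + 1)]→L[ℝ] ℝ} (κ : LocalSystem P vol)
    (b : Module.Basis (Fin N) ℝ (GroupLieAlgebra (𝓡 N) G)) (l : P.jetBundle → ℝ) (σ : M → E)
    (x : EuclideanSpace ℝ (Fin (n + 1))) (A : Fin N) : ℝ :=
  (∑ μ, fderiv ℝ (fun x' => fderiv ℝ (κ.expr b l) (κ.jetSection b σ x') (vecXi μ A)) x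
      (EuclideanSpace.single μ 1))
    - (∑ μ, ∑ C, fderiv ℝ (κ.expr b l) (κ.jetSection b σ x) (vecXi μ C) *
        b.repr ⁅∑ B, (κ.jetSection b σ x).2.2 μ B • b B, b A⁆ C)
    - ∑ B, frameMatrix b κ.ψ (κ.jetSection b σ x).2.1 B A *
        fderiv ℝ (κ.expr b l) (κ.jetSection b σ x) (vecY n B)

/-- The Euler-Poincaré equations hold along `σ` over `U` in every natural local system. -/
def SatisfiesEulerPoincare (P : PrincipalBundle n N M G IE E)
    (vol : ∀ x : M, TangentSpace (𝓡 (n + 1)) x [⋀^Fin (n + 1)]→L[ℝ] ℝ)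
    (b : Module.Basis (Fin N) ℝ (GroupLieAlgebra (𝓡 N) G)) (l : P.jetBundle → ℝ)
    (U : Set M) (σ : M → E) : Prop :=
  ∀ κ : LocalSystem P vol, ∀ x ∈ κ.sectionDomain U σ, ∀ A, eulerPoincare κ b l σ x A = 0

/-! ### The reduced Poincaré-Cartan forms -/

/-- The volume form `ω = dx¹ ∧ … ∧ dx^{n+1}`, on the coordinate space of `J¹E`. -/
def volForm (n N : ℕ) : JetCoord n N [⋀^Fin (n + 1)]→L[ℝ] ℝ :=
  (coordVolume (n + 1)).compContinuousLinearMap (ContinuousLinearMap.fst ℝ _ _)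

/-- The `n`-form `dⁿx_μ = ∂/∂x^μ ⌟ ω`. -/
def dnx (n N : ℕ) (μ : Fin (n + 1)) : JetCoord n N [⋀^Fin n]→L[ℝ] ℝ :=
  (volForm n N).curryLeft (vecX n N μ)

/-- The Maurer-Cartan `1`-form `λ^A` on the coordinate space of `J¹E`, in the chart `ψ` of `G`. -/
def lambda (n : ℕ) (b : Module.Basis (Fin N) ℝ (GroupLieAlgebra (𝓡 N) G))
    (ψ : OpenPartialHomeomorph G (EuclideanSpace ℝ (Fin N))) (A : Fin N) (z : JetCoord n N) :
    JetCoord n N →L[ℝ] ℝ :=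
  ∑ B, maurerCartan b A (ψ.symm z.2.1)
      (mfderiv (𝓡 N) (𝓡 N) ψ.symm z.2.1 (EuclideanSpace.single B (1 : ℝ))) •
    ((EuclideanSpace.proj B).comp
      ((ContinuousLinearMap.fst ℝ _ _).comp (ContinuousLinearMap.snd ℝ _ _)))

section Forms

variable {P : PrincipalBundle n N M G IE E}
  {vol : ∀ x : M, TangentSpace (𝓡 (n + 1)) x [⋀^Fin (n + 1)]→L[ℝ] ℝ} (κ : LocalSystem P vol)
  (b : Module.Basis (Fin N) ℝ (GroupLieAlgebra (𝓡 N) G)) (l : P.jetBundle → ℝ)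

/-- The reduced Poincaré-Cartan `(n+1)`-form
`Θ = ∂l/∂ξ^A_μ λ^A ∧ dⁿx_μ - (∂l/∂ξ^A_μ ξ^A_μ - l) ω`. -/
def theta (z : JetCoord n N) : JetCoord n N [⋀^Fin (n + 1)]→L[ℝ] ℝ :=
  (∑ μ, ∑ A, fderiv ℝ (κ.expr b l) z (vecXi μ A) • wedge (lambda n b κ.ψ A z) (dnx n N μ))
    - ((∑ μ, ∑ A, fderiv ℝ (κ.expr b l) z (vecXi μ A) * z.2.2 μ A) - κ.expr b l z) • volForm n N

/-- The reduced pre-multisymplectic `(n+2)`-form `Ω = -dΘ`. -/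
def omega (z : JetCoord n N) : JetCoord n N [⋀^Fin (n + 2)]→L[ℝ] ℝ :=
  -extDeriv (theta κ b l) z

/-- The pull-back `(j¹σ)^*(W ⌟ Ω)` at the point with coordinates `x`. -/
def pullbackContraction (σ : M → E) (W : JetCoord n N → JetCoord n N)
    (x : EuclideanSpace ℝ (Fin (n + 1))) :
    EuclideanSpace ℝ (Fin (n + 1)) [⋀^Fin (n + 1)]→L[ℝ] ℝ :=
  ((omega κ b l (κ.jetSection b σ x)).curryLeft
    (W (κ.jetSection b σ x))).compContinuousLinearMap (fderiv ℝ (κ.jetSection b σ) x)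

end Forms

/-- `(j¹σ)^*(W ⌟ Ω) = 0` over `U` for every smooth vector field `W` on the part of `J¹E` that a
natural local system describes, whichever the local system. -/
def PullbackVanishes (P : PrincipalBundle n N M G IE E)
    (vol : ∀ x : M, TangentSpace (𝓡 (n + 1)) x [⋀^Fin (n + 1)]→L[ℝ] ℝ)
    (b : Module.Basis (Fin N) ℝ (GroupLieAlgebra (𝓡 N) G)) (l : P.jetBundle → ℝ)
    (U : Set M) (σ : M → E) : Prop :=
  ∀ κ : LocalSystem P vol, ∀ W : JetCoord n N → JetCoord n N, ContDiffOn ℝ ∞ W κ.domain →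
    ∀ x ∈ κ.sectionDomain U σ, pullbackContraction κ b l σ W x = 0

/-- `(j¹σ)^*(W ⌟ Ω) = 0` over `U` for every smooth vector field `W` on `J¹E` whose support is a
compact subset of the domain of a natural local system. Extended by zero, such a `W` is a
vector field on the whole of `J¹E`. -/
def PullbackVanishesCompact (P : PrincipalBundle n N M G IE E)
    (vol : ∀ x : M, TangentSpace (𝓡 (n + 1)) x [⋀^Fin (n + 1)]→L[ℝ] ℝ)
    (b : Module.Basis (Fin N) ℝ (GroupLieAlgebra (𝓡 N) G)) (l : P.jetBundle → ℝ)
    (U : Set M) (σ : M → E) : Prop :=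
  ∀ κ : LocalSystem P vol, ∀ W : JetCoord n N → JetCoord n N, ContDiff ℝ ∞ W →
    HasCompactSupport W → tsupport W ⊆ κ.domain →
    ∀ x ∈ κ.sectionDomain U σ, pullbackContraction κ b l σ W x = 0

end Bundle

end

end ReducedFieldTheory

/-! In a natural local system a section is a map `x ↦ y(x)`, with velocities `ξ_μ = λ(∂_μ y)`. Write
`p^μ_A = ∂l/∂ξ^A_μ` and `EP_A` for the Euler-Poincaré expression. Stationarity and the pull-back
condition both reduce to `EP = 0` through the Maurer-Cartan equation (`maurerCartan_equation`).

First variation. For a family `y(ε, x)` put `η = λ(∂_ε y)`. The derivatives `∂_ε ξ_μ` and `∂_μ η`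
share the term with the mixed second derivative of `y`, so they differ by `dλ(∂_ε y, ∂_μ y)`, and
Maurer-Cartan turns this into `∂_ε ξ_μ = ∂_μ η + [ξ_μ, η]`. Hence `δl = ∂_μ(p^μ_A η^A) - η^A EP_A`
(`fderiv_lagrangian`).

Pull-back. The same equation, used inside `dΘ`, gives `dΘ(w, ∂_1 j¹σ, …, ∂_{n+1} j¹σ) = -λ(w)^A
EP_A` for vertical `w`; the `∂/∂ξ` components of `w` cancel because `j¹σ` is holonomic
(`extDeriv_poincareCartan_cons`). The part of `W` tangent to `j¹σ` contributes nothing, since it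
repeats an argument. A form of top degree is determined by its value on one frame, so the pull-back
condition is `λ(W_vert)^A EP_A = 0`; a bump function times `e_A` isolates `EP_A`, and compactly
supported fields suffice.

Stationary implies Euler-Poincaré. Right translation `σ · c(ε f)`, with `c` a curve of velocity
`b_A` at `1`, has `η = f b_A` in every trivialisation (`LocalSystem.variationField_translate`).
Stationarity then says that `EP_A` integrates to zero against every test function, and the
fundamental lemma of the calculus of variations applies.

Euler-Poincaré implies stationary. If the variation is supported in one local system, the divergence
integrates to zero. In general the variation is cut up by a partition of unity, replacing `ε` by `ε
ρ_i(m)`: this multiplies `η` by `ρ_i` and needs no linear structure on the fibres. The pieces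
recover the first variation because it is linear in `η`.

These computations apply to the action on `M` because transition maps of unimodular charts have
Jacobian `1`, so `volumeMeasure` is Lebesgue measure in each such chart
(`volumeMeasure_restrict_source`). -/

namespace ReducedFieldTheory

noncomputable section

/-! ### Derivatives of charts -/

section Charts

variable {F : Type*} [NormedAddCommGroup F] [NormedSpace ℝ F]
  {M : Type*} [TopologicalSpace M] [ChartedSpace F M]
  {ψ : OpenPartialHomeomorph M F}

theorem contMDiffAt_chart (hψ : ψ ∈ IsManifold.maximalAtlas 𝓘(ℝ, F) ∞ M) {g : M}
    (hg : g ∈ ψ.source) : ContMDiffAt 𝓘(ℝ, F) 𝓘(ℝ, F) ∞ ψ g :=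
  (contMDiffOn_of_mem_maximalAtlas hψ).contMDiffAt (ψ.open_source.mem_nhds hg)

theorem contMDiffAt_chart_symm (hψ : ψ ∈ IsManifold.maximalAtlas 𝓘(ℝ, F) ∞ M) {y : F}
    (hy : y ∈ ψ.target) : ContMDiffAt 𝓘(ℝ, F) 𝓘(ℝ, F) ∞ ψ.symm y :=
  (contMDiffOn_symm_of_mem_maximalAtlas hψ).contMDiffAt (ψ.open_target.mem_nhds hy)

theorem mfderiv_chart_comp_symm (hψ : ψ ∈ IsManifold.maximalAtlas 𝓘(ℝ, F) ∞ M) {y : F}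
    (hy : y ∈ ψ.target) :
    (mfderiv 𝓘(ℝ, F) 𝓘(ℝ, F) ψ (ψ.symm y)).comp (mfderiv 𝓘(ℝ, F) 𝓘(ℝ, F) ψ.symm y) =
      ContinuousLinearMap.id ℝ (TangentSpace 𝓘(ℝ, F) y) := by
  have h1 := (contMDiffAt_chart hψ (ψ.map_target hy)).mdifferentiableAt (by simp)
  have h2 := (contMDiffAt_chart_symm hψ hy).mdifferentiableAt (by simp)
  rw [← mfderiv_comp y h1 h2]
  have h : (ψ ∘ ψ.symm) =ᶠ[nhds y] id := by
    filter_upwards [ψ.open_target.mem_nhds hy] with z hz using ψ.right_inv hz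
  rw [h.mfderiv_eq]
  exact mfderiv_id

theorem mfderiv_symm_comp_chart (hψ : ψ ∈ IsManifold.maximalAtlas 𝓘(ℝ, F) ∞ M) {y : F}
    (hy : y ∈ ψ.target) :
    (mfderiv 𝓘(ℝ, F) 𝓘(ℝ, F) ψ.symm y).comp (mfderiv 𝓘(ℝ, F) 𝓘(ℝ, F) ψ (ψ.symm y)) =
      ContinuousLinearMap.id ℝ (TangentSpace 𝓘(ℝ, F) (ψ.symm y)) := by
  have h1 := (contMDiffAt_chart hψ (ψ.map_target hy)).mdifferentiableAt (by simp)
  have h2 := (contMDiffAt_chart_symm hψ hy).mdifferentiableAt (by simp)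
  have h := mfderiv_comp (ψ.symm y) (f := ψ) (g := ψ.symm) (I' := 𝓘(ℝ, F))
    (by rwa [ψ.right_inv hy]) h1
  rw [ψ.right_inv hy] at h
  rw [← h]
  have h : (ψ.symm ∘ ψ) =ᶠ[nhds (ψ.symm y)] id := by
    filter_upwards [ψ.open_source.mem_nhds (ψ.map_target hy)] with z hz using ψ.left_inv hz
  rw [h.mfderiv_eq]
  exact mfderiv_id

theorem mfderiv_chart_symm_apply (hψ : ψ ∈ IsManifold.maximalAtlas 𝓘(ℝ, F) ∞ M) {y : F}
    (hy : y ∈ ψ.target) (w : TangentSpace 𝓘(ℝ, F) y) :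
    mfderiv 𝓘(ℝ, F) 𝓘(ℝ, F) ψ (ψ.symm y) (mfderiv 𝓘(ℝ, F) 𝓘(ℝ, F) ψ.symm y w) = w :=
  congrArg (fun f => f w) (mfderiv_chart_comp_symm hψ hy)

theorem mfderiv_symm_chart_apply (hψ : ψ ∈ IsManifold.maximalAtlas 𝓘(ℝ, F) ∞ M) {y : F}
    (hy : y ∈ ψ.target) (w : TangentSpace 𝓘(ℝ, F) (ψ.symm y)) :
    mfderiv 𝓘(ℝ, F) 𝓘(ℝ, F) ψ.symm y (mfderiv 𝓘(ℝ, F) 𝓘(ℝ, F) ψ (ψ.symm y) w) = w :=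
  congrArg (fun f => f w) (mfderiv_symm_comp_chart hψ hy)

theorem inverse_mfderiv_chart_symm (hψ : ψ ∈ IsManifold.maximalAtlas 𝓘(ℝ, F) ∞ M) {y : F}
    (hy : y ∈ ψ.target) :
    (mfderiv 𝓘(ℝ, F) 𝓘(ℝ, F) ψ.symm y).inverse = mfderiv 𝓘(ℝ, F) 𝓘(ℝ, F) ψ (ψ.symm y) :=
  ContinuousLinearMap.inverse_eq (mfderiv_symm_comp_chart hψ hy) (mfderiv_chart_comp_symm hψ hy)

theorem isInvertible_mfderiv_chart_symm (hψ : ψ ∈ IsManifold.maximalAtlas 𝓘(ℝ, F) ∞ M)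
    {y : F} (hy : y ∈ ψ.target) : (mfderiv 𝓘(ℝ, F) 𝓘(ℝ, F) ψ.symm y).IsInvertible :=
  ContinuousLinearMap.IsInvertible.of_inverse (mfderiv_symm_comp_chart hψ hy)
    (mfderiv_chart_comp_symm hψ hy)

end Charts

/-! ### The left-invariant frame in a chart of the group -/

section Frame

variable {N : ℕ} {G : Type*} [TopologicalSpace G] [ChartedSpace (EuclideanSpace ℝ (Fin N)) G]
  [Group G]
  (b : Module.Basis (Fin N) ℝ (GroupLieAlgebra (𝓡 N) G))
  (ψ : OpenPartialHomeomorph G (EuclideanSpace ℝ (Fin N)))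

/-- The coordinate expression of the left-invariant vector field of `v`. -/
def frame (v : GroupLieAlgebra (𝓡 N) G) (y : EuclideanSpace ℝ (Fin N)) :
    EuclideanSpace ℝ (Fin N) :=
  mfderiv (𝓡 N) (𝓡 N) ψ (ψ.symm y) (mulInvariantVectorField v (ψ.symm y))

theorem frameMatrix_eq (y : EuclideanSpace ℝ (Fin N)) (B A : Fin N) :
    frameMatrix b ψ y B A = frame ψ (b A) y B := rfl

/-- The coordinate expression of the Maurer-Cartan form, with components in the basis `b`. -/
def coframe (y : EuclideanSpace ℝ (Fin N)) : EuclideanSpace ℝ (Fin N) →L[ℝ] (Fin N → ℝ) :=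
  ContinuousLinearMap.pi fun A => ∑ B, maurerCartan b A (ψ.symm y)
      (mfderiv (𝓡 N) (𝓡 N) ψ.symm y (EuclideanSpace.single B (1 : ℝ))) • EuclideanSpace.proj B

theorem lambda_apply (n : ℕ) (A : Fin N) (z v : JetCoord n N) :
    lambda n b ψ A z v = coframe b ψ z.2.1 v.2.1 A := by
  simp [lambda, coframe]

/-- The Maurer-Cartan form as a linear map. -/
def maurerCartanLin (A : Fin N) (g : G) : TangentSpace (𝓡 N) g →ₗ[ℝ] ℝ :=
  (b.coord A).comp (mfderiv (𝓡 N) (𝓡 N) (fun h : G => g⁻¹ * h) g).toLinearMap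

/-- The body of `coframe` lists values on the coordinate basis, to match `lambda`. Linearity of
`maurerCartan` and of the derivative of `ψ.symm` extends the formula to all vectors. -/
theorem coframe_apply (y w : EuclideanSpace ℝ (Fin N)) (A : Fin N) :
    coframe b ψ y w A =
      maurerCartan b A (ψ.symm y) (mfderiv (𝓡 N) (𝓡 N) ψ.symm y w) := by
  have hw : w = ∑ B, w B • EuclideanSpace.single B (1 : ℝ) := by
    simpa using ((EuclideanSpace.basisFun (Fin N) ℝ).sum_repr w).symm
  have h : ∀ u : EuclideanSpace ℝ (Fin N), maurerCartan b A (ψ.symm y)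
      (mfderiv (𝓡 N) (𝓡 N) ψ.symm y u) = ((maurerCartanLin b A (ψ.symm y)).comp
        (mfderiv (𝓡 N) (𝓡 N) ψ.symm y).toLinearMap : EuclideanSpace ℝ (Fin N) →ₗ[ℝ] ℝ) u :=
    fun u => rfl
  rw [h]
  conv_rhs => rw [hw]
  rw [map_sum]
  simp only [coframe, ContinuousLinearMap.pi_apply, sum_apply, smul_apply, smul_eq_mul]
  refine Finset.sum_congr rfl fun B _ => ?_
  rw [LinearMap.map_smul, ← h, smul_eq_mul, mul_comm]
  rfl

/-- The left-invariant frame as a linear map. -/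
def frameMap (ψ : OpenPartialHomeomorph G (EuclideanSpace ℝ (Fin N)))
    (y : EuclideanSpace ℝ (Fin N)) : (Fin N → ℝ) →L[ℝ] EuclideanSpace ℝ (Fin N) :=
  ∑ A, (ContinuousLinearMap.proj A).smulRight (frame ψ (b A) y)

theorem mulInvariantVectorField_sum (c : Fin N → ℝ) (g : G) :
    mulInvariantVectorField (∑ A, c A • b A) g =
      ∑ A, c A • mulInvariantVectorField (I := 𝓡 N) (b A) g := by
  refine (map_sum (mfderiv (𝓡 N) (𝓡 N) (g * ·) (1 : G)) _ _).trans ?_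
  exact Finset.sum_congr rfl fun A _ =>
    ContinuousLinearMap.map_smul (mfderiv (𝓡 N) (𝓡 N) (g * ·) (1 : G)) _ _

theorem frameMap_apply (y : EuclideanSpace ℝ (Fin N)) (c : Fin N → ℝ) :
    frameMap b ψ y c = ∑ A, c A • frame ψ (b A) y := by
  simp [frameMap]

variable {ψ}

theorem frame_sum (y : EuclideanSpace ℝ (Fin N)) (c : Fin N → ℝ) :
    frame ψ (∑ A, c A • b A) y = frameMap b ψ y c := by
  rw [frameMap_apply, frame, mulInvariantVectorField_sum]
  refine (map_sum (mfderiv (𝓡 N) (𝓡 N) ψ (ψ.symm y)) _ _).trans ?_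
  exact Finset.sum_congr rfl fun A _ =>
    ContinuousLinearMap.map_smul (mfderiv (𝓡 N) (𝓡 N) ψ (ψ.symm y)) _ _

/-- Seeing the frame as a pull-back gives access to the regularity of pulled-back fields and to
their compatibility with brackets. -/
theorem frame_eq_mpullback (hψ : ψ ∈ IsManifold.maximalAtlas (𝓡 N) ∞ G)
    {y : EuclideanSpace ℝ (Fin N)} (hy : y ∈ ψ.target) (v : GroupLieAlgebra (𝓡 N) G) :
    VectorField.mpullback (𝓡 N) (𝓡 N) ψ.symm (mulInvariantVectorField v) y = frame ψ v y := by
  rw [VectorField.mpullback_apply, inverse_mfderiv_chart_symm hψ hy]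
  rfl

variable [LieGroup (𝓡 N) ∞ G]

theorem maurerCartan_mulInvariantVectorField (A : Fin N) (g : G)
    (v : GroupLieAlgebra (𝓡 N) G) :
    maurerCartan b A g (mulInvariantVectorField v g) = b.repr v A := by
  have h : mfderiv (𝓡 N) (𝓡 N) ((fun h : G => g⁻¹ * h) ∘ (fun h : G => g * h)) (1 : G) =
      ContinuousLinearMap.id _ _ := by
    have : (fun h : G => g⁻¹ * h) ∘ (fun h : G => g * h) = id := by ext x; simp
    rw [this, id_eq, mfderiv_id]
  rw [mfderiv_comp (I' := 𝓡 N) _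
    ((contMDiff_mul_left (I := 𝓡 N) (n := ∞)).contMDiffAt.mdifferentiableAt (by simp))
    ((contMDiff_mul_left (I := 𝓡 N) (n := ∞)).contMDiffAt.mdifferentiableAt (by simp))] at h
  -- The chain rule puts the outer derivative at `g * 1`; it has to be moved to `g`, which is not
  -- the same base point definitionally.
  have h1 : ∀ (k : G) (_ : g = k) (w : EuclideanSpace ℝ (Fin N)),
      (mfderiv (𝓡 N) (𝓡 N) (fun h : G => g⁻¹ * h) g : EuclideanSpace ℝ (Fin N) → _) w =
        (mfderiv (𝓡 N) (𝓡 N) (fun h : G => g⁻¹ * h) k : EuclideanSpace ℝ (Fin N) → _) w := by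
    rintro k rfl w
    rfl
  exact congrArg (fun w : GroupLieAlgebra (𝓡 N) G => b.repr w A)
    ((h1 (g * 1) (mul_one g).symm _).trans (congrArg (fun f => f v) h))

theorem coframe_frame (hψ : ψ ∈ IsManifold.maximalAtlas (𝓡 N) ∞ G)
    {y : EuclideanSpace ℝ (Fin N)} (hy : y ∈ ψ.target)
    (v : GroupLieAlgebra (𝓡 N) G) : coframe b ψ y (frame ψ v y) = b.repr v := by
  ext A
  rw [coframe_apply, frame, mfderiv_symm_chart_apply hψ hy, maurerCartan_mulInvariantVectorField]

theorem coframe_frameMap (hψ : ψ ∈ IsManifold.maximalAtlas (𝓡 N) ∞ G)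
    {y : EuclideanSpace ℝ (Fin N)} (hy : y ∈ ψ.target) (c : Fin N → ℝ) :
    coframe b ψ y (frameMap b ψ y c) = c := by
  rw [frameMap_apply, map_sum]
  ext A
  simp [coframe_frame b hψ hy, Finsupp.single_apply]

/-- Both spaces have dimension `N`, so the one-sided inverse of `coframe_frameMap` is two-sided:
`frameMap` is injective, hence surjective. -/
theorem frameMap_coframe (hψ : ψ ∈ IsManifold.maximalAtlas (𝓡 N) ∞ G)
    {y : EuclideanSpace ℝ (Fin N)} (hy : y ∈ ψ.target) (w : EuclideanSpace ℝ (Fin N)) :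
    frameMap b ψ y (coframe b ψ y w) = w := by
  have hinj : Function.Injective (frameMap b ψ y) :=
    Function.LeftInverse.injective (coframe_frameMap b hψ hy)
  have hsurj : Function.Surjective (frameMap b ψ y).toLinearMap :=
    (LinearMap.injective_iff_surjective_of_finrank_eq_finrank (by simp)).1 hinj
  obtain ⟨c, rfl⟩ := hsurj w
  exact congrArg _ (coframe_frameMap b hψ hy c)

theorem contDiffAt_frame (hψ : ψ ∈ IsManifold.maximalAtlas (𝓡 N) ∞ G)
    {y : EuclideanSpace ℝ (Fin N)} (hy : y ∈ ψ.target) (v : GroupLieAlgebra (𝓡 N) G) :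
    ContDiffAt ℝ 2 (frame ψ v) y := by
  have : LieGroup (𝓡 N) (minSmoothness ℝ 3) G := LieGroup.of_le (n := ∞)
    (by rw [minSmoothness_of_isRCLikeNormedField]; exact WithTop.coe_le_coe.2 le_top)
  have h1 := (contMDiff_mulInvariantVectorField (I := 𝓡 N) v).contMDiffAt (x := ψ.symm y)
  have h2 := h1.mpullback_vectorField_preimage (contMDiffAt_chart_symm hψ hy)
    (isInvertible_mfderiv_chart_symm hψ hy)
    (by rw [minSmoothness_of_isRCLikeNormedField]; exact WithTop.coe_le_coe.2 le_top)
  have h3 := contMDiffAt_vectorSpace_iff_contDiffAt.1 h2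
  rw [minSmoothness_of_isRCLikeNormedField] at h3
  refine h3.congr_of_eventuallyEq ?_
  filter_upwards [ψ.open_target.mem_nhds hy] with z hz
  exact (frame_eq_mpullback hψ hz v).symm

/-- Pull-back by the chart commutes with brackets of vector fields, and the bracket of two
left-invariant fields is the left-invariant field of the Lie algebra bracket. -/
theorem lieBracket_frame (hψ : ψ ∈ IsManifold.maximalAtlas (𝓡 N) ∞ G)
    {y : EuclideanSpace ℝ (Fin N)} (hy : y ∈ ψ.target) (v w : GroupLieAlgebra (𝓡 N) G) :
    VectorField.lieBracket ℝ (frame ψ v) (frame ψ w) y = frame ψ ⁅v, w⁆ y := by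
  have : LieGroup (𝓡 N) (minSmoothness ℝ 3) G := LieGroup.of_le (n := ∞)
    (by rw [minSmoothness_of_isRCLikeNormedField]; exact WithTop.coe_le_coe.2 le_top)
  have h := VectorField.mpullback_mlieBracket (I := 𝓡 N) (I' := 𝓡 N) (f := ψ.symm) (x₀ := y)
    (mdifferentiableAt_mulInvariantVectorField v) (mdifferentiableAt_mulInvariantVectorField w)
    (contMDiffAt_chart_symm hψ hy)
    (by rw [minSmoothness_of_isRCLikeNormedField]; exact WithTop.coe_le_coe.2 le_top)
  rw [← mulInvariantVector_mlieBracket, ← GroupLieAlgebra.bracket_def,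
    frame_eq_mpullback hψ hy] at h
  rw [h, ← VectorField.mlieBracketWithin_univ, VectorField.mlieBracketWithin_eq_lieBracketWithin]
  erw [VectorField.lieBracketWithin_univ]
  apply Filter.EventuallyEq.lieBracket_vectorField_eq
  · filter_upwards [ψ.open_target.mem_nhds hy] with z hz
    exact (frame_eq_mpullback hψ hz v).symm
  · filter_upwards [ψ.open_target.mem_nhds hy] with z hz
    exact (frame_eq_mpullback hψ hz w).symm

theorem contDiffAt_frameMap (hψ : ψ ∈ IsManifold.maximalAtlas (𝓡 N) ∞ G)
    {y : EuclideanSpace ℝ (Fin N)} (hy : y ∈ ψ.target) : ContDiffAt ℝ 2 (frameMap b ψ) y := by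
  unfold frameMap
  refine ContDiffAt.sum fun A _ => ?_
  exact ((ContinuousLinearMap.smulRightL ℝ (Fin N → ℝ) (EuclideanSpace ℝ (Fin N))
    (ContinuousLinearMap.proj A)).contDiff.contDiffAt).comp y (contDiffAt_frame hψ hy (b A))

theorem coframe_eq_inverse (hψ : ψ ∈ IsManifold.maximalAtlas (𝓡 N) ∞ G)
    {y : EuclideanSpace ℝ (Fin N)} (hy : y ∈ ψ.target) :
    coframe b ψ y = (frameMap b ψ y).inverse :=
  (ContinuousLinearMap.inverse_eq (by ext1 w; exact frameMap_coframe b hψ hy w)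
    (by ext1 c; exact coframe_frameMap b hψ hy c)).symm

/-- Regularity is inherited from the frame by inversion of linear maps, which is smooth at
invertible ones. This avoids studying how `T L_{g⁻¹}` depends on `g`. -/
theorem contDiffAt_coframe (hψ : ψ ∈ IsManifold.maximalAtlas (𝓡 N) ∞ G)
    {y : EuclideanSpace ℝ (Fin N)} (hy : y ∈ ψ.target) : ContDiffAt ℝ 2 (coframe b ψ) y := by
  let e : (Fin N → ℝ) ≃L[ℝ] EuclideanSpace ℝ (Fin N) :=
    ContinuousLinearEquiv.equivOfInverse (frameMap b ψ y) (coframe b ψ y)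
      (coframe_frameMap b hψ hy) (frameMap_coframe b hψ hy)
  have h : ContDiffAt ℝ 2 (fun z => (frameMap b ψ z).inverse) y :=
    ContDiffAt.comp (g := ContinuousLinearMap.inverse) y (contDiffAt_map_inverse (n := 2) e)
      (contDiffAt_frameMap b hψ hy)
  refine h.congr_of_eventuallyEq ?_
  filter_upwards [ψ.open_target.mem_nhds hy] with z hz using coframe_eq_inverse b hψ hz

/-- The Maurer-Cartan equation `dλ + ½ [λ ∧ λ] = 0`, for the components `c`, `d` in the frame. -/
theorem maurerCartan_equation_frame (hψ : ψ ∈ IsManifold.maximalAtlas (𝓡 N) ∞ G)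
    {y : EuclideanSpace ℝ (Fin N)} (hy : y ∈ ψ.target) (v w : GroupLieAlgebra (𝓡 N) G) :
    fderiv ℝ (coframe b ψ) y (frame ψ v y) (frame ψ w y) -
      fderiv ℝ (coframe b ψ) y (frame ψ w y) (frame ψ v y) = -⇑(b.repr ⁅v, w⁆) := by
  have hc : DifferentiableAt ℝ (coframe b ψ) y :=
    (contDiffAt_coframe b hψ hy).differentiableAt (by simp)
  have hf : ∀ u, DifferentiableAt ℝ (frame ψ u) y := fun u =>
    (contDiffAt_frame hψ hy u).differentiableAt (by simp)
  -- Differentiating the constant function `λ(e_u) = u` along `e_{u'}` trades a derivative of `λ`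
  -- for one of the frame. Antisymmetrising then produces `-λ([e_v, e_w])`.
  have key : ∀ u u' : GroupLieAlgebra (𝓡 N) G,
      fderiv ℝ (coframe b ψ) y (frame ψ u' y) (frame ψ u y) =
        -coframe b ψ y (fderiv ℝ (frame ψ u) y (frame ψ u' y)) := by
    intro u u'
    have h1 := hc.hasFDerivAt.clm_apply (hf u).hasFDerivAt
    have h2 : HasFDerivAt (fun z => coframe b ψ z (frame ψ u z))
        (0 : EuclideanSpace ℝ (Fin N) →L[ℝ] (Fin N → ℝ)) y := by
      refine (hasFDerivAt_const (⇑(b.repr u) : Fin N → ℝ) y).congr_of_eventuallyEq ?_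
      filter_upwards [ψ.open_target.mem_nhds hy] with z hz using coframe_frame b hψ hz u
    have h3 := congrArg (fun f => f (frame ψ u' y)) (h1.unique h2)
    simp only [add_apply, ContinuousLinearMap.comp_apply, ContinuousLinearMap.flip_apply,
      zero_apply] at h3
    rw [eq_neg_iff_add_eq_zero, add_comm]
    exact h3
  rw [key, key, ← coframe_frame b hψ hy, ← lieBracket_frame hψ hy, VectorField.lieBracket_eq]
  rw [map_sub]
  abel

/-- The Maurer-Cartan equation `dλ + ½ [λ ∧ λ] = 0`. -/
theorem maurerCartan_equation (hψ : ψ ∈ IsManifold.maximalAtlas (𝓡 N) ∞ G)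
    {y : EuclideanSpace ℝ (Fin N)} (hy : y ∈ ψ.target) (v w : EuclideanSpace ℝ (Fin N)) :
    fderiv ℝ (coframe b ψ) y v w - fderiv ℝ (coframe b ψ) y w v =
      -⇑(b.repr ⁅∑ A, coframe b ψ y v A • b A, ∑ A, coframe b ψ y w A • b A⁆) := by
  -- At the point `y` every vector is the value of a left-invariant field, and the identity involves
  -- only values at `y`.
  have h : ∀ u, frame ψ (∑ A, coframe b ψ y u A • b A) y = u := fun u => by
    rw [frame_sum, frameMap_coframe b hψ hy]
  rw [← maurerCartan_equation_frame b hψ hy, h, h]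

end Frame

end

end ReducedFieldTheory

namespace ReducedFieldTheory

noncomputable section

/-! ### Jets and Euler-Poincaré equations in coordinates -/

section Coordinates

variable {n N : ℕ} {G : Type*} [TopologicalSpace G] [ChartedSpace (EuclideanSpace ℝ (Fin N)) G]
  [Group G]
  (b : Module.Basis (Fin N) ℝ (GroupLieAlgebra (𝓡 N) G))
  (ψ : OpenPartialHomeomorph G (EuclideanSpace ℝ (Fin N)))

/-- The coordinates `(x, y, ξ)` of the jet of `x ↦ y(x)`. -/
def coordJet (y : EuclideanSpace ℝ (Fin (n + 1)) → EuclideanSpace ℝ (Fin N))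
    (x : EuclideanSpace ℝ (Fin (n + 1))) : JetCoord n N :=
  (x, y x, fun μ => coframe b ψ (y x) (fderiv ℝ y x (EuclideanSpace.single μ 1)))

/-- The derivative of the Lagrangian along the group directions at fixed velocities:
`(ad^*_{ξ_μ} ∂l/∂ξ_μ)_A + T^B_A ∂l/∂y^B`. -/
def force (L : JetCoord n N → ℝ) (z : JetCoord n N) (A : Fin N) : ℝ :=
  (∑ μ, ∑ C, fderiv ℝ L z (vecXi μ C) * b.repr ⁅∑ B, z.2.2 μ B • b B, b A⁆ C)
    + ∑ B, frameMatrix b ψ z.2.1 B A * fderiv ℝ L z (vecY n B)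

/-- The left-hand side of the Euler-Poincaré equations along the section `x ↦ y(x)`. -/
def coordEulerPoincare (L : JetCoord n N → ℝ)
    (y : EuclideanSpace ℝ (Fin (n + 1)) → EuclideanSpace ℝ (Fin N))
    (x : EuclideanSpace ℝ (Fin (n + 1))) (A : Fin N) : ℝ :=
  (∑ μ, fderiv ℝ (fun x' => fderiv ℝ L (coordJet b ψ y x') (vecXi μ A)) x
      (EuclideanSpace.single μ 1)) - force b ψ L (coordJet b ψ y x) A

theorem clm_apply_euclideanSpace {k : ℕ} {F : Type*} [NormedAddCommGroup F] [NormedSpace ℝ F]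
    (f : EuclideanSpace ℝ (Fin k) →L[ℝ] F) (w : EuclideanSpace ℝ (Fin k)) :
    f w = ∑ B, w B • f (EuclideanSpace.single B 1) := by
  have hw : w = ∑ B, w B • EuclideanSpace.single B (1 : ℝ) := by
    simpa using ((EuclideanSpace.basisFun (Fin k) ℝ).sum_repr w).symm
  conv_lhs => rw [hw]
  simp

theorem clm_apply_jetCoord (f : JetCoord n N →L[ℝ] ℝ) (w : EuclideanSpace ℝ (Fin N))
    (ζ : Fin (n + 1) → Fin N → ℝ) :
    f (0, w, ζ) = (∑ B, w B * f (vecY n B)) + ∑ μ, ∑ A, ζ μ A * f (vecXi μ A) := by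
  let f₁ := f.comp ((ContinuousLinearMap.inr ℝ (EuclideanSpace ℝ (Fin (n + 1))) _).comp
    (ContinuousLinearMap.inl ℝ (EuclideanSpace ℝ (Fin N)) (Fin (n + 1) → Fin N → ℝ)))
  let f₂ := f.comp ((ContinuousLinearMap.inr ℝ (EuclideanSpace ℝ (Fin (n + 1))) _).comp
    (ContinuousLinearMap.inr ℝ (EuclideanSpace ℝ (Fin N)) (Fin (n + 1) → Fin N → ℝ)))
  have h : f (0, w, ζ) = f₁ w + f₂ ζ := by
    simp only [f₁, f₂, ContinuousLinearMap.comp_apply, ContinuousLinearMap.inr_apply,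
      ContinuousLinearMap.inl_apply, ← map_add]
    simp
  have hζ : ζ = ∑ μ, ∑ A, ζ μ A • (Pi.single μ (Pi.single A 1) : Fin (n + 1) → Fin N → ℝ) := by
    ext μ A
    simp [Finset.sum_apply, Pi.single_apply, apply_ite, ite_apply]
  rw [h, clm_apply_euclideanSpace f₁]
  congr 1
  conv_lhs => rw [hζ]
  simp only [map_sum, map_smul]
  rfl

theorem repr_bracket_swap (v w : GroupLieAlgebra (𝓡 N) G) :
    b.repr ⁅v, w⁆ = -b.repr ⁅w, v⁆ := by
  rw [← map_neg, GroupLieAlgebra.bracket_def, VectorField.mlieBracket_swap_apply]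
  rfl

variable [LieGroup (𝓡 N) ∞ G]

theorem repr_bracket_sum (v : GroupLieAlgebra (𝓡 N) G) (c : Fin N → ℝ) (C : Fin N) :
    b.repr ⁅v, ∑ A, c A • b A⁆ C = ∑ A, c A * b.repr ⁅v, b A⁆ C := by
  have : LieGroup (𝓡 N) (minSmoothness ℝ 3) G := LieGroup.of_le (n := ∞)
    (by rw [minSmoothness_of_isRCLikeNormedField]; exact WithTop.coe_le_coe.2 le_top)
  let f : GroupLieAlgebra (𝓡 N) G →ₗ[ℝ] ℝ := (b.coord C).comp
    (LieModule.toEnd ℝ (GroupLieAlgebra (𝓡 N) G) (GroupLieAlgebra (𝓡 N) G) v)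
  have hf : ∀ w, f w = b.repr ⁅v, w⁆ C := fun w => rfl
  rw [← hf, map_sum]
  exact Finset.sum_congr rfl fun A _ => by rw [LinearMap.map_smul, hf, smul_eq_mul]

variable {ψ}

/-- The pairing of the force with a vertical vector `w`, by the Maurer-Cartan equation. -/
theorem sum_coframe_mul_force (hψ : ψ ∈ IsManifold.maximalAtlas (𝓡 N) ∞ G)
    {L : JetCoord n N → ℝ} {z : JetCoord n N} (hz : z.2.1 ∈ ψ.target)
    (u : Fin (n + 1) → EuclideanSpace ℝ (Fin N))
    (hu : ∀ μ, z.2.2 μ = coframe b ψ z.2.1 (u μ)) (w : EuclideanSpace ℝ (Fin N)) :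
    ∑ A, coframe b ψ z.2.1 w A * force b ψ L z A =
      (∑ μ, ∑ A, fderiv ℝ L z (vecXi μ A) *
        (fderiv ℝ (coframe b ψ) z.2.1 w (u μ) A - fderiv ℝ (coframe b ψ) z.2.1 (u μ) w A)) +
      ∑ B, w B * fderiv ℝ L z (vecY n B) := by
  -- With `η = λ(w)` and `ξ_μ = λ(u_μ)`, the Maurer-Cartan equation gives `dλ(w, u_μ) = -[η, ξ_μ] =
  -- [ξ_μ, η]`.
  have h1 : ∀ μ A, fderiv ℝ (coframe b ψ) z.2.1 w (u μ) A -
      fderiv ℝ (coframe b ψ) z.2.1 (u μ) w A =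
      ∑ C, coframe b ψ z.2.1 w C * b.repr ⁅∑ B, z.2.2 μ B • b B, b C⁆ A := by
    intro μ A
    have := congrFun (maurerCartan_equation b hψ hz w (u μ)) A
    rw [repr_bracket_swap] at this
    simp only [Pi.sub_apply, Pi.neg_apply, Finsupp.coe_neg, neg_neg] at this
    rw [this, repr_bracket_sum, hu]
  have h2 : ∀ B, w B = ∑ A, coframe b ψ z.2.1 w A * frameMatrix b ψ z.2.1 B A := by
    intro B
    conv_lhs => rw [← frameMap_coframe b hψ hz w, frameMap_apply]
    simp [frameMatrix_eq]
  simp only [force, mul_add, Finset.sum_add_distrib]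
  congr 1
  · simp only [h1, Finset.mul_sum]
    rw [Finset.sum_comm]
    refine Finset.sum_congr rfl fun μ _ => ?_
    rw [Finset.sum_comm]
    exact Finset.sum_congr rfl fun C _ => Finset.sum_congr rfl fun A _ => by ring
  · conv_rhs => enter [2, B]; rw [h2 B]
    simp only [Finset.mul_sum, Finset.sum_mul]
    rw [Finset.sum_comm]
    exact Finset.sum_congr rfl fun B _ => Finset.sum_congr rfl fun A _ => by ring

end Coordinates

end

end ReducedFieldTheory

namespace ReducedFieldTheory

noncomputable section

/-! ### The first variation in coordinates -/

/-- With `c = λ` this product rule covers both `ξ_μ = λ(∂_μ y)` and `η = λ(∂_ε y)`. Only its first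
term is not symmetric in the two directions. -/
theorem fderiv_clm_comp_apply_fderiv {E F F' : Type*} [NormedAddCommGroup E] [NormedSpace ℝ E]
    [NormedAddCommGroup F] [NormedSpace ℝ F] [NormedAddCommGroup F'] [NormedSpace ℝ F']
    {c : F → F →L[ℝ] F'} {y : E → F} {q : E} (hc : DifferentiableAt ℝ c (y q))
    (hy : DifferentiableAt ℝ y q) (hy' : DifferentiableAt ℝ (fderiv ℝ y) q) (v w : E) :
    fderiv ℝ (fun q' => c (y q') (fderiv ℝ y q' v)) q w =
      fderiv ℝ c (y q) (fderiv ℝ y q w) (fderiv ℝ y q v) +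
        c (y q) (fderiv ℝ (fderiv ℝ y) q w v) := by
  have h1 : fderiv ℝ (fun q' => c (y q')) q = (fderiv ℝ c (y q)).comp (fderiv ℝ y q) :=
    fderiv_comp q hc hy
  have h2 : fderiv ℝ (fun q' => fderiv ℝ y q' v) q = (fderiv ℝ (fderiv ℝ y) q).flip v := by
    rw [fderiv_clm_apply hy' (differentiableAt_const v)]
    simp
  rw [fderiv_clm_apply (c := fun q' => c (y q')) (hc.comp q hy)
    (hy'.clm_apply (differentiableAt_const v)), h1, h2]
  simp [add_comm]

section FirstVariation

variable {n N : ℕ} {G : Type*} [TopologicalSpace G] [ChartedSpace (EuclideanSpace ℝ (Fin N)) G]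
  [Group G]
  (b : Module.Basis (Fin N) ℝ (GroupLieAlgebra (𝓡 N) G))
  (ψ : OpenPartialHomeomorph G (EuclideanSpace ℝ (Fin N)))
  (y : ℝ × EuclideanSpace ℝ (Fin (n + 1)) → EuclideanSpace ℝ (Fin N))

/-- The coordinates of the jets of a one-parameter family `(ε, x) ↦ y(ε, x)`. -/
def familyJet (q : ℝ × EuclideanSpace ℝ (Fin (n + 1))) : JetCoord n N :=
  (q.2, y q, fun μ => coframe b ψ (y q) (fderiv ℝ y q (0, EuclideanSpace.single μ 1)))

/-- The components `η^A` of the variation in the left-invariant frame. -/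
def variationField (x : EuclideanSpace ℝ (Fin (n + 1))) : Fin N → ℝ :=
  coframe b ψ (y (0, x)) (fderiv ℝ y (0, x) (1, 0))

variable {y}

theorem fderiv_slice {F : Type*} [NormedAddCommGroup F] [NormedSpace ℝ F]
    {y : ℝ × EuclideanSpace ℝ (Fin (n + 1)) → F} {ε : ℝ} {x : EuclideanSpace ℝ (Fin (n + 1))}
    (hy : DifferentiableAt ℝ y (ε, x)) (v : EuclideanSpace ℝ (Fin (n + 1))) :
    fderiv ℝ (fun x' => y (ε, x')) x v = fderiv ℝ y (ε, x) (0, v) := by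
  have h : HasFDerivAt (fun x' => y (ε, x')) _ x :=
    hy.hasFDerivAt.comp x (hasFDerivAt_prodMk_right ε x)
  rw [h.fderiv]
  rfl

theorem coordJet_slice {ε : ℝ} {x : EuclideanSpace ℝ (Fin (n + 1))}
    (hy : DifferentiableAt ℝ y (ε, x)) :
    coordJet b ψ (fun x' => y (ε, x')) x = familyJet b ψ y (ε, x) := by
  simp only [coordJet, familyJet, fderiv_slice hy]

theorem eventually_differentiableAt {q : ℝ × EuclideanSpace ℝ (Fin (n + 1))}
    (hy : ContDiffAt ℝ 3 y q) : ∀ᶠ q' in nhds q, DifferentiableAt ℝ y q' :=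
  (hy.eventually (by simp)).mono fun _ h => h.differentiableAt (by simp)

theorem eventually_coordJet_slice {ε : ℝ} {x : EuclideanSpace ℝ (Fin (n + 1))}
    (hy : ContDiffAt ℝ 3 y (ε, x)) :
    ∀ᶠ x' in nhds x, coordJet b ψ (fun x => y (ε, x)) x' = familyJet b ψ y (ε, x') := by
  have h : Filter.Tendsto (fun x' => (ε, x')) (nhds x) (nhds (ε, x)) :=
    (Continuous.prodMk_right ε).tendsto x
  exact (h.eventually (eventually_differentiableAt hy)).mono fun x' hx' =>
    coordJet_slice b ψ hx'

theorem contDiffAt_fderiv_apply {q : ℝ × EuclideanSpace ℝ (Fin (n + 1))}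
    (hy : ContDiffAt ℝ 3 y q) (v : ℝ × EuclideanSpace ℝ (Fin (n + 1))) :
    ContDiffAt ℝ 2 (fun q' => fderiv ℝ y q' v) q :=
  (hy.fderiv_right (m := 2) (by norm_num)).clm_apply contDiffAt_const

variable [LieGroup (𝓡 N) ∞ G] {ψ}

theorem contDiffAt_coframe_fderiv (hψ : ψ ∈ IsManifold.maximalAtlas (𝓡 N) ∞ G)
    {q : ℝ × EuclideanSpace ℝ (Fin (n + 1))}
    (hy : ContDiffAt ℝ 3 y q) (hq : y q ∈ ψ.target) (v : ℝ × EuclideanSpace ℝ (Fin (n + 1))) :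
    ContDiffAt ℝ 2 (fun q' => coframe b ψ (y q') (fderiv ℝ y q' v)) q :=
  (ContDiffAt.comp (g := coframe b ψ) q (contDiffAt_coframe b hψ hq)
    (hy.of_le (by norm_num))).clm_apply (contDiffAt_fderiv_apply hy v)

theorem fderiv_coframe_fderiv (hψ : ψ ∈ IsManifold.maximalAtlas (𝓡 N) ∞ G)
    {q : ℝ × EuclideanSpace ℝ (Fin (n + 1))}
    (hy : ContDiffAt ℝ 3 y q) (hq : y q ∈ ψ.target) (v w : ℝ × EuclideanSpace ℝ (Fin (n + 1))) :
    fderiv ℝ (fun q' => coframe b ψ (y q') (fderiv ℝ y q' v)) q w =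
      fderiv ℝ (coframe b ψ) (y q) (fderiv ℝ y q w) (fderiv ℝ y q v) +
        coframe b ψ (y q) (fderiv ℝ (fderiv ℝ y) q w v) := by
  rw [fderiv_clm_comp_apply_fderiv
    ((contDiffAt_coframe b hψ hq).differentiableAt (by simp)) (hy.differentiableAt (by simp))
    ((hy.fderiv_right (m := 2) (by norm_num)).differentiableAt (by simp))]

theorem contDiffAt_familyJet (hψ : ψ ∈ IsManifold.maximalAtlas (𝓡 N) ∞ G)
    {q : ℝ × EuclideanSpace ℝ (Fin (n + 1))}
    (hy : ContDiffAt ℝ 3 y q) (hq : y q ∈ ψ.target) : ContDiffAt ℝ 2 (familyJet b ψ y) q :=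
  contDiffAt_snd.prodMk ((hy.of_le (by norm_num)).prodMk
    (contDiffAt_pi.2 fun _ => contDiffAt_coframe_fderiv b hψ hy hq _))

theorem fderiv_familyJet (hψ : ψ ∈ IsManifold.maximalAtlas (𝓡 N) ∞ G)
    {q : ℝ × EuclideanSpace ℝ (Fin (n + 1))}
    (hy : ContDiffAt ℝ 3 y q) (hq : y q ∈ ψ.target) (w : ℝ × EuclideanSpace ℝ (Fin (n + 1))) :
    fderiv ℝ (familyJet b ψ y) q w = (w.2, fderiv ℝ y q w, fun μ =>
      fderiv ℝ (coframe b ψ) (y q) (fderiv ℝ y q w)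
        (fderiv ℝ y q (0, EuclideanSpace.single μ 1)) +
        coframe b ψ (y q) (fderiv ℝ (fderiv ℝ y) q w (0, EuclideanSpace.single μ 1))) := by
  have h : HasFDerivAt (familyJet b ψ y) _ q :=
    (hasFDerivAt_snd (𝕜 := ℝ) (p := q)).prodMk
      ((hy.differentiableAt (by simp)).hasFDerivAt.prodMk (hasFDerivAt_pi.2 fun μ =>
        ((contDiffAt_coframe_fderiv b hψ hy hq (0, EuclideanSpace.single μ 1)).differentiableAt
          (by simp)).hasFDerivAt))
  rw [h.fderiv]
  refine Prod.ext rfl (Prod.ext rfl (funext fun μ => ?_))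
  exact fderiv_coframe_fderiv b hψ hy hq _ w

theorem contDiffAt_momentum {L : JetCoord n N → ℝ} {z : JetCoord n N} (hL : ContDiffAt ℝ 2 L z)
    (v : JetCoord n N) : ContDiffAt ℝ 1 (fun z' => fderiv ℝ L z' v) z :=
  (hL.fderiv_right (m := 1) (by norm_num)).clm_apply contDiffAt_const

theorem contDiffAt_coordJet_slice (hψ : ψ ∈ IsManifold.maximalAtlas (𝓡 N) ∞ G)
    {ε : ℝ} {x : EuclideanSpace ℝ (Fin (n + 1))} (hy : ContDiffAt ℝ 3 y (ε, x))
    (hx : y (ε, x) ∈ ψ.target) : ContDiffAt ℝ 2 (coordJet b ψ (fun x => y (ε, x))) x :=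
  ((contDiffAt_familyJet b hψ hy hx).comp x
    (contDiffAt_const.prodMk contDiffAt_id)).congr_of_eventuallyEq
      (eventually_coordJet_slice b ψ hy)

theorem contDiffAt_momentum_slice (hψ : ψ ∈ IsManifold.maximalAtlas (𝓡 N) ∞ G)
    {ε : ℝ} {x : EuclideanSpace ℝ (Fin (n + 1))} (hy : ContDiffAt ℝ 3 y (ε, x))
    (hx : y (ε, x) ∈ ψ.target) {L : JetCoord n N → ℝ}
    (hL : ContDiffAt ℝ 2 L (familyJet b ψ y (ε, x))) (v : JetCoord n N) :
    ContDiffAt ℝ 1 (fun x' => fderiv ℝ L (coordJet b ψ (fun x => y (ε, x)) x') v) x := by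
  refine ContDiffAt.comp (g := fun z => fderiv ℝ L z v) x ?_
    ((contDiffAt_coordJet_slice b hψ hy hx).of_le (by norm_num))
  rw [coordJet_slice b ψ (hy.differentiableAt (by simp))]
  exact contDiffAt_momentum hL v

theorem contDiffAt_variationField (hψ : ψ ∈ IsManifold.maximalAtlas (𝓡 N) ∞ G)
    {x : EuclideanSpace ℝ (Fin (n + 1))} (hy : ContDiffAt ℝ 3 y (0, x))
    (hx : y (0, x) ∈ ψ.target) : ContDiffAt ℝ 2 (variationField b ψ y) x :=
  (contDiffAt_coframe_fderiv b hψ hy hx (1, 0)).comp x (contDiffAt_const.prodMk contDiffAt_id)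

/-- Symmetry of second derivatives puts `∂_μ η` in a form that has its last term in common with `∂_ε
ξ_μ` in `fderiv_familyJet`; what is left of the difference is `dλ(∂_ε y, ∂_μ y)`. -/
theorem fderiv_variationField (hψ : ψ ∈ IsManifold.maximalAtlas (𝓡 N) ∞ G)
    {x : EuclideanSpace ℝ (Fin (n + 1))} (hy : ContDiffAt ℝ 3 y (0, x))
    (hx : y (0, x) ∈ ψ.target) (v : EuclideanSpace ℝ (Fin (n + 1))) :
    fderiv ℝ (variationField b ψ y) x v =
      fderiv ℝ (coframe b ψ) (y (0, x)) (fderiv ℝ y (0, x) (0, v)) (fderiv ℝ y (0, x) (1, 0)) +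
        coframe b ψ (y (0, x)) (fderiv ℝ (fderiv ℝ y) (0, x) (1, 0) (0, v)) := by
  have h : fderiv ℝ (variationField b ψ y) x v = _ := fderiv_slice (ε := 0) (x := x)
    (y := fun q' => coframe b ψ (y q') (fderiv ℝ y q' (1, 0)))
    ((contDiffAt_coframe_fderiv b hψ hy hx (1, 0)).differentiableAt (by simp)) v
  have hsymm : fderiv ℝ (fderiv ℝ y) (0, x) (1, 0) (0, v) =
      fderiv ℝ (fderiv ℝ y) (0, x) (0, v) (1, 0) :=
    (hy.isSymmSndFDerivAt (by rw [minSmoothness_of_isRCLikeNormedField]; norm_num)).eq _ _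
  rw [h, fderiv_coframe_fderiv b hψ hy hx, hsymm]

theorem fderiv_sum_mul {E : Type*} [NormedAddCommGroup E] [NormedSpace ℝ E] {ι : Type*}
    [Fintype ι] {p : ι → E → ℝ} {η : E → ι → ℝ} {x : E} (hp : ∀ A, DifferentiableAt ℝ (p A) x)
    (hη : DifferentiableAt ℝ η x) (v : E) :
    fderiv ℝ (fun x' => ∑ A, p A x' * η x' A) x v =
      ∑ A, (fderiv ℝ (p A) x v * η x A + p A x * fderiv ℝ η x v A) := by
  have hη' : ∀ A, HasFDerivAt (fun x' => η x' A) _ x :=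
    fun A => hasFDerivAt_pi'.1 hη.hasFDerivAt A
  rw [fderiv_fun_sum fun A _ => (hp A).fun_mul (hη' A).differentiableAt, sum_apply]
  refine Finset.sum_congr rfl fun A _ => ?_
  rw [fderiv_fun_mul (hp A) (hη' A).differentiableAt, (hη' A).fderiv]
  simp only [add_apply, smul_apply, smul_eq_mul, ContinuousLinearMap.comp_apply,
    ContinuousLinearMap.proj_apply]
  ring

theorem hasDerivAt_familyJet (hψ : ψ ∈ IsManifold.maximalAtlas (𝓡 N) ∞ G)
    {ε : ℝ} {x : EuclideanSpace ℝ (Fin (n + 1))} (hy : ContDiffAt ℝ 3 y (ε, x))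
    (hx : y (ε, x) ∈ ψ.target) {L : JetCoord n N → ℝ}
    (hL : ContDiffAt ℝ 2 L (familyJet b ψ y (ε, x))) :
    HasDerivAt (fun ε => L (familyJet b ψ y (ε, x)))
      (fderiv ℝ L (familyJet b ψ y (ε, x)) (fderiv ℝ (familyJet b ψ y) (ε, x) (1, 0))) ε := by
  have hline : HasDerivAt (fun ε : ℝ => (ε, x)) ((1 : ℝ), (0 : EuclideanSpace ℝ (Fin (n + 1)))) ε :=
    (hasDerivAt_id ε).prodMk (hasDerivAt_const ε x)
  have hS : HasDerivAt (fun ε => familyJet b ψ y (ε, x))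
      (fderiv ℝ (familyJet b ψ y) (ε, x) (1, 0)) ε :=
    HasFDerivAt.comp_hasDerivAt (l := familyJet b ψ y) ε
      ((contDiffAt_familyJet b hψ hy hx).differentiableAt (by simp)).hasFDerivAt hline
  exact HasFDerivAt.comp_hasDerivAt (l := L) ε (hL.differentiableAt (by simp)).hasFDerivAt hS

/-- The algebra of the first variation. Here `P = p^μ_A`, `dP = ∂_μ p^μ_A`, `C₁ + D = ∂_ε ξ_μ`, `C₂
+ D = ∂_μ η` with `D` the mixed derivative, `F` is the force and `S` the term `w^B ∂l/∂y^B` for `w =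
∂_ε y`. The hypothesis is `sum_coframe_mul_force`. -/
theorem sum_variation_eq {ι κ : Type*} [Fintype ι] [Fintype κ] {P dP C₁ C₂ D : κ → ι → ℝ}
    {η F : ι → ℝ} {S : ℝ}
    (h : ∑ A, η A * F A = (∑ μ, ∑ A, P μ A * (C₁ μ A - C₂ μ A)) + S) :
    S + ∑ μ, ∑ A, (C₁ μ A + D μ A) * P μ A =
      (∑ μ, ∑ A, (dP μ A * η A + P μ A * (C₂ μ A + D μ A))) -
        ∑ A, η A * ((∑ μ, dP μ A) - F A) := by
  have h1 : ∑ A, η A * ((∑ μ, dP μ A) - F A) = (∑ μ, ∑ A, dP μ A * η A) - ∑ A, η A * F A := by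
    rw [Finset.sum_comm, ← Finset.sum_sub_distrib]
    refine Finset.sum_congr rfl fun A _ => ?_
    rw [mul_sub, Finset.mul_sum]
    simp only [mul_comm]
  rw [h1, h]
  have h2 : ∑ μ, ∑ A, (C₁ μ A + D μ A) * P μ A =
      (∑ μ, ∑ A, P μ A * (C₁ μ A - C₂ μ A)) + ∑ μ, ∑ A, P μ A * (C₂ μ A + D μ A) := by
    simp only [← Finset.sum_add_distrib]
    exact Finset.sum_congr rfl fun μ _ => Finset.sum_congr rfl fun A _ => by ring
  rw [h2]
  simp only [Finset.sum_add_distrib]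
  ring

/-- The first variation of the Lagrangian: a divergence minus the pairing of the variation with
the Euler-Poincaré expression. -/
theorem fderiv_lagrangian (hψ : ψ ∈ IsManifold.maximalAtlas (𝓡 N) ∞ G)
    {x : EuclideanSpace ℝ (Fin (n + 1))} (hy : ContDiffAt ℝ 3 y (0, x))
    (hx : y (0, x) ∈ ψ.target) {L : JetCoord n N → ℝ}
    (hL : ContDiffAt ℝ 2 L (familyJet b ψ y (0, x))) :
    fderiv ℝ L (familyJet b ψ y (0, x)) (fderiv ℝ (familyJet b ψ y) (0, x) (1, 0)) =
      (∑ μ, fderiv ℝ (fun x' => ∑ A,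
          fderiv ℝ L (coordJet b ψ (fun x => y (0, x)) x') (vecXi μ A) *
            variationField b ψ y x' A) x (EuclideanSpace.single μ 1)) -
        ∑ A, variationField b ψ y x A * coordEulerPoincare b ψ L (fun x => y (0, x)) x A := by
  have hslice := coordJet_slice b ψ (hy.differentiableAt (by simp))
  have hprod := fun μ : Fin (n + 1) => fderiv_sum_mul
    (fun A => (contDiffAt_momentum_slice b hψ hy hx hL (vecXi μ A)).differentiableAt (by simp))
    ((contDiffAt_variationField b hψ hy hx).differentiableAt (by simp))
    (EuclideanSpace.single μ 1)
  -- The velocities of the jet are `λ(∂_μ y)` by definition, so the compatibility hypothesis is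
  -- `rfl`.
  have hforce := sum_coframe_mul_force b hψ (L := L) (z := familyJet b ψ y (0, x)) hx
    (fun μ => fderiv ℝ y (0, x) (0, EuclideanSpace.single μ 1)) (fun μ => rfl)
    (fderiv ℝ y (0, x) (1, 0))
  have h1 : (familyJet b ψ y (0, x)).2.1 = y (0, x) := rfl
  rw [h1] at hforce
  rw [fderiv_familyJet b hψ hy hx, clm_apply_jetCoord]
  simp only [hprod, fderiv_variationField b hψ hy hx, coordEulerPoincare, hslice]
  generalize familyJet b ψ y (0, x) = z at hforce ⊢
  exact sum_variation_eq hforce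

end FirstVariation

end

end ReducedFieldTheory

namespace ReducedFieldTheory

noncomputable section

/-! ### Evaluation of the Poincaré-Cartan form -/

section Exterior

variable {n N : ℕ}

theorem coordVolume_apply_single (m : ℕ) :
    coordVolume m (fun i => EuclideanSpace.single i 1) = 1 := by
  have h := (EuclideanSpace.basisFun (Fin m) ℝ).toBasis.det_self
  have h2 : (⇑(EuclideanSpace.basisFun (Fin m) ℝ).toBasis) =
      fun i => EuclideanSpace.single i (1 : ℝ) := by
    ext i
    simp
  rw [h2] at h
  exact h

theorem volForm_apply (u : Fin (n + 1) → JetCoord n N) :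
    volForm n N u = coordVolume (n + 1) fun i => (u i).1 := rfl

theorem volForm_eq_one {u : Fin (n + 1) → JetCoord n N}
    (hu : ∀ i, (u i).1 = EuclideanSpace.single i 1) : volForm n N u = 1 := by
  rw [volForm_apply]
  simp only [hu]
  exact coordVolume_apply_single _

theorem volForm_eq_zero {u : Fin (n + 1) → JetCoord n N} (i : Fin (n + 1)) (hu : (u i).1 = 0) :
    volForm n N u = 0 := by
  rw [volForm_apply]
  exact (coordVolume (n + 1)).map_coord_zero i hu

theorem dnx_apply (μ : Fin (n + 1)) (u : Fin n → JetCoord n N) :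
    dnx n N μ u = volForm n N (Matrix.vecCons (vecX n N μ) u) := rfl

theorem dnx_eq_zero {μ : Fin (n + 1)} {u : Fin n → JetCoord n N} (i : Fin n)
    (hu : (u i).1 = 0) : dnx n N μ u = 0 := by
  rw [dnx_apply]
  exact volForm_eq_zero i.succ (by simpa using hu)

/-- Moving `∂/∂x^μ` from the front into the vacant slot `i` costs `(-1)^i`. The result is the
coordinate frame with its `i`-th vector replaced by the `μ`-th: the frame itself if `i = μ`, a tuple
with a repetition otherwise. -/
theorem neg_one_pow_mul_dnx_removeNth {u : Fin (n + 1) → JetCoord n N}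
    (hu : ∀ i, (u i).1 = EuclideanSpace.single i 1) (i μ : Fin (n + 1)) :
    (-1) ^ (i : ℕ) * dnx n N μ (i.removeNth u) = if i = μ then 1 else 0 := by
  rw [dnx_apply, volForm_apply]
  have h := (coordVolume (n + 1)).neg_one_pow_smul_map_insertNth i (EuclideanSpace.single μ 1)
    (i.removeNth fun j => EuclideanSpace.single j 1)
  have h1 : (fun j => (Matrix.vecCons (vecX n N μ) (i.removeNth u) j).1) =
      Matrix.vecCons (EuclideanSpace.single μ (1 : ℝ))
        (i.removeNth fun j => EuclideanSpace.single j 1) := by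
    funext j
    refine Fin.cases ?_ (fun j => ?_) j
    · simp [vecX]
    · simp [Fin.removeNth, hu]
  rw [zsmul_eq_mul] at h
  push_cast at h
  rw [h1, ← h, ← mul_assoc, ← pow_add, Even.neg_one_pow ⟨_, rfl⟩, one_mul]
  split_ifs with him
  · subst him
    have h2 := Fin.insertNth_self_removeNth i
      (fun j : Fin (n + 1) => EuclideanSpace.single j (1 : ℝ))
    rw [h2]
    exact coordVolume_apply_single _
  · refine (coordVolume (n + 1)).map_eq_zero_of_eq _ (i := i) (j := μ) ?_ him
    obtain ⟨k, rfl⟩ := Fin.exists_succAbove_eq (Ne.symm him)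
    simp [Fin.removeNth]

theorem wedge_apply {V : Type*} [NormedAddCommGroup V] [NormedSpace ℝ V] {k : ℕ}
    (α : V →L[ℝ] ℝ) (β : V [⋀^Fin k]→L[ℝ] ℝ) (v : Fin (k + 1) → V) :
    wedge α β v = ∑ i : Fin (k + 1), (-1) ^ (i : ℕ) * (α (v i) * β (i.removeNth v)) := by
  simp [wedge, ContinuousAlternatingMap.alternatizeUncurryFin_apply]

theorem wedge_dnx_apply {u : Fin (n + 1) → JetCoord n N}
    (hu : ∀ i, (u i).1 = EuclideanSpace.single i 1) (α : JetCoord n N →L[ℝ] ℝ)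
    (μ : Fin (n + 1)) : wedge α (dnx n N μ) u = α (u μ) := by
  rw [wedge_apply, Finset.sum_eq_single μ]
  · rw [mul_left_comm, neg_one_pow_mul_dnx_removeNth hu]
    simp
  · intro i _ hi
    rw [mul_left_comm, neg_one_pow_mul_dnx_removeNth hu]
    simp [hi]
  · simp

/-- Since `dⁿx_μ` kills vertical vectors, only the term of the wedge in which `α` takes `w`
survives. The remaining tuple is that of `neg_one_pow_mul_dnx_removeNth`. -/
theorem wedge_dnx_cons_apply {u : Fin (n + 1) → JetCoord n N}
    (hu : ∀ i, (u i).1 = EuclideanSpace.single i 1) (α : JetCoord n N →L[ℝ] ℝ)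
    {w : JetCoord n N} (hw : w.1 = 0) (i μ : Fin (n + 1)) :
    (-1) ^ (i : ℕ) * wedge α (dnx n N μ) (i.succ.removeNth (Fin.cons w u : Fin (n + 2) → _)) =
      if i = μ then α w else 0 := by
  have h : i.succ.removeNth (Fin.cons w u : Fin (n + 2) → JetCoord n N) =
      (Fin.cons w (i.removeNth u) : Fin (n + 1) → JetCoord n N) := by
    funext j
    refine Fin.cases ?_ (fun j => ?_) j
    · simp [Fin.removeNth]
    · simp [Fin.removeNth]
  rw [h, wedge_apply, Finset.sum_eq_single 0]
  · simp only [Fin.val_zero, pow_zero, one_mul, Fin.cons_zero]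
    rw [mul_left_comm]
    have h2 : (0 : Fin (n + 1)).removeNth (Fin.cons w (i.removeNth u) : Fin (n + 1) → _) =
        i.removeNth u := by
      funext j
      simp [Fin.removeNth]
    rw [h2, neg_one_pow_mul_dnx_removeNth hu]
    simp
  · intro j _ hj
    obtain ⟨k, rfl⟩ := Fin.exists_succ_eq.2 hj
    -- For `n = 0` there is no slot other than `0`. Otherwise `w` remains in slot `0` after a later
    -- vector is removed.
    rcases n with _ | n
    · exact k.elim0
    · rw [dnx_eq_zero 0 (by simpa [Fin.removeNth] using hw)]
      simp
  · simp

end Exterior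

/-! ### The Poincaré-Cartan form on frames, and its differentiability. -/

section PoincareCartan

variable {n N : ℕ} {G : Type*} [TopologicalSpace G] [ChartedSpace (EuclideanSpace ℝ (Fin N)) G]
  [Group G]
  (b : Module.Basis (Fin N) ℝ (GroupLieAlgebra (𝓡 N) G))
  (ψ : OpenPartialHomeomorph G (EuclideanSpace ℝ (Fin N)))

/-- The Poincaré-Cartan form of a Lagrangian on the coordinate space of `J¹E`. -/
def poincareCartan (L : JetCoord n N → ℝ) (z : JetCoord n N) :
    JetCoord n N [⋀^Fin (n + 1)]→L[ℝ] ℝ :=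
  (∑ μ, ∑ A, fderiv ℝ L z (vecXi μ A) • wedge (lambda n b ψ A z) (dnx n N μ))
    - ((∑ μ, ∑ A, fderiv ℝ L z (vecXi μ A) * z.2.2 μ A) - L z) • volForm n N

theorem poincareCartan_apply (L : JetCoord n N → ℝ) (z : JetCoord n N)
    (u : Fin (n + 1) → JetCoord n N) :
    poincareCartan b ψ L z u =
      (∑ μ, ∑ A, fderiv ℝ L z (vecXi μ A) * wedge (lambda n b ψ A z) (dnx n N μ) u)
        - ((∑ μ, ∑ A, fderiv ℝ L z (vecXi μ A) * z.2.2 μ A) - L z) * volForm n N u := by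
  simp [poincareCartan, ContinuousAlternatingMap.sum_apply]

/-- `Θ` on a tuple of vectors that project to the coordinate frame. -/
theorem poincareCartan_apply_horizontal (L : JetCoord n N → ℝ) (z : JetCoord n N)
    {u : Fin (n + 1) → JetCoord n N} (hu : ∀ i, (u i).1 = EuclideanSpace.single i 1) :
    poincareCartan b ψ L z u =
      (∑ μ, ∑ A, fderiv ℝ L z (vecXi μ A) * (coframe b ψ z.2.1 (u μ).2.1 A - z.2.2 μ A))
        + L z := by
  rw [poincareCartan_apply, volForm_eq_one hu]
  simp only [wedge_dnx_apply hu, lambda_apply, mul_sub, Finset.sum_sub_distrib]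
  ring

/-- `Θ` on the tuples with one vertical vector `w`. -/
theorem poincareCartan_apply_cons (L : JetCoord n N → ℝ) (z : JetCoord n N)
    {u : Fin (n + 1) → JetCoord n N} (hu : ∀ i, (u i).1 = EuclideanSpace.single i 1)
    {w : JetCoord n N} (hw : w.1 = 0) (i : Fin (n + 1)) :
    (-1) ^ (i : ℕ) * poincareCartan b ψ L z (i.succ.removeNth (Fin.cons w u : Fin (n + 2) → _)) =
      ∑ A, fderiv ℝ L z (vecXi i A) * coframe b ψ z.2.1 w.2.1 A := by
  rw [poincareCartan_apply, volForm_eq_zero 0 (by simpa [Fin.removeNth] using hw)]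
  simp only [mul_zero, sub_zero, Finset.mul_sum]
  rw [Finset.sum_eq_single i]
  · refine Finset.sum_congr rfl fun A _ => ?_
    rw [mul_left_comm, wedge_dnx_cons_apply hu _ hw, if_pos rfl, lambda_apply]
  · intro μ _ hμ
    refine Finset.sum_eq_zero fun A _ => ?_
    rw [mul_left_comm, wedge_dnx_cons_apply hu _ hw, if_neg hμ.symm, mul_zero]
  · simp

variable [LieGroup (𝓡 N) ∞ G] {ψ}

theorem differentiableAt_lambda (hψ : ψ ∈ IsManifold.maximalAtlas (𝓡 N) ∞ G) {z : JetCoord n N}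
    (hz : z.2.1 ∈ ψ.target) (A : Fin N) : DifferentiableAt ℝ (lambda n b ψ A) z := by
  have h : lambda n b ψ A = fun z : JetCoord n N => ((ContinuousLinearMap.proj A).comp
      ((coframe b ψ z.2.1).comp ((ContinuousLinearMap.fst ℝ _ _).comp
        (ContinuousLinearMap.snd ℝ _ _)))) := by
    funext z
    refine ContinuousLinearMap.ext fun v => ?_
    exact lambda_apply b ψ n A z v
  have h2 : DifferentiableAt ℝ (fun z : JetCoord n N => coframe b ψ z.2.1) z :=
    DifferentiableAt.comp (g := coframe b ψ) z
      ((contDiffAt_coframe b hψ hz).differentiableAt (by simp))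
      (differentiableAt_snd.fst)
  rw [h]
  exact (differentiableAt_const _).clm_comp (h2.clm_comp (differentiableAt_const _))

theorem differentiableAt_poincareCartan (hψ : ψ ∈ IsManifold.maximalAtlas (𝓡 N) ∞ G)
    {L : JetCoord n N → ℝ} {z : JetCoord n N} (hz : z.2.1 ∈ ψ.target)
    (hL : ContDiffAt ℝ 2 L z) : DifferentiableAt ℝ (poincareCartan b ψ L) z := by
  have hp : ∀ v, DifferentiableAt ℝ (fun z' => fderiv ℝ L z' v) z := fun v =>
    (contDiffAt_momentum hL v).differentiableAt (by simp)
  have hw : ∀ (A : Fin N) (μ : Fin (n + 1)),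
      DifferentiableAt ℝ (fun z' => wedge (lambda n b ψ A z') (dnx n N μ)) z := fun A μ => by
    -- For a fixed second factor the wedge product is continuous and linear in the `1`-form.
    let T : (JetCoord n N →L[ℝ] ℝ) →L[ℝ] (JetCoord n N [⋀^Fin (n + 1)]→L[ℝ] ℝ) :=
      (ContinuousAlternatingMap.alternatizeUncurryFinCLM ℝ (JetCoord n N) ℝ).comp
        ((ContinuousLinearMap.smulRightL ℝ (JetCoord n N) _).flip (dnx n N μ))
    exact T.differentiableAt.comp z (differentiableAt_lambda b hψ hz A)
  have hξ : ∀ (A : Fin N) (μ : Fin (n + 1)),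
      DifferentiableAt ℝ (fun z' : JetCoord n N => z'.2.2 μ A) z := fun A μ => by fun_prop
  unfold poincareCartan
  refine DifferentiableAt.sub (DifferentiableAt.fun_sum fun μ _ => DifferentiableAt.fun_sum
    fun A _ => (hp _).smul (hw A μ)) (DifferentiableAt.smul_const (DifferentiableAt.sub
      (DifferentiableAt.fun_sum fun μ _ => DifferentiableAt.fun_sum fun A _ =>
        (hp _).fun_mul (hξ A μ)) (hL.differentiableAt (by simp))) _)

end PoincareCartan

end

end ReducedFieldTheory

namespace ReducedFieldTheory

noncomputable section

/-! ### The pull-back of the pre-multisymplectic form -/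

section Pullback

variable {n N : ℕ} {G : Type*} [TopologicalSpace G] [ChartedSpace (EuclideanSpace ℝ (Fin N)) G]
  [Group G] [LieGroup (𝓡 N) ∞ G]
  (b : Module.Basis (Fin N) ℝ (GroupLieAlgebra (𝓡 N) G))
  {ψ : OpenPartialHomeomorph G (EuclideanSpace ℝ (Fin N))}
  {y : EuclideanSpace ℝ (Fin (n + 1)) → EuclideanSpace ℝ (Fin N)}
  {x : EuclideanSpace ℝ (Fin (n + 1))}

theorem contDiffAt_coordJet (hψ : ψ ∈ IsManifold.maximalAtlas (𝓡 N) ∞ G)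
    (hy : ContDiffAt ℝ 3 y x) (hx : y x ∈ ψ.target) :
    ContDiffAt ℝ 2 (coordJet b ψ y) x :=
  contDiffAt_coordJet_slice b (y := fun q => y q.2) (ε := 0) hψ
    (ContDiffAt.comp (g := y) _ hy contDiffAt_snd) hx

theorem fderiv_coordJet_fst (hψ : ψ ∈ IsManifold.maximalAtlas (𝓡 N) ∞ G)
    (hy : ContDiffAt ℝ 3 y x) (hx : y x ∈ ψ.target) (v : EuclideanSpace ℝ (Fin (n + 1))) :
    (fderiv ℝ (coordJet b ψ y) x v).1 = v := by
  have h := ((contDiffAt_coordJet b hψ hy hx).differentiableAt (by simp)).hasFDerivAt.fst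
  exact congrArg (fun f => f v) (h.unique (hasFDerivAt_id x))

theorem fderiv_coordJet_snd_fst (hψ : ψ ∈ IsManifold.maximalAtlas (𝓡 N) ∞ G)
    (hy : ContDiffAt ℝ 3 y x) (hx : y x ∈ ψ.target) (v : EuclideanSpace ℝ (Fin (n + 1))) :
    (fderiv ℝ (coordJet b ψ y) x v).2.1 = fderiv ℝ y x v := by
  have h := ((contDiffAt_coordJet b hψ hy hx).differentiableAt (by simp)).hasFDerivAt.snd.fst
  exact congrArg (fun f => f v) (h.unique (hy.differentiableAt (by simp)).hasFDerivAt)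

theorem differentiableAt_coframe_apply (hψ : ψ ∈ IsManifold.maximalAtlas (𝓡 N) ∞ G)
    {z : JetCoord n N} (hz : z.2.1 ∈ ψ.target) (u : EuclideanSpace ℝ (Fin N)) :
    DifferentiableAt ℝ (fun z : JetCoord n N => coframe b ψ z.2.1 u) z :=
  (DifferentiableAt.comp (g := coframe b ψ) z
    ((contDiffAt_coframe b hψ hz).differentiableAt (by simp)) (differentiableAt_snd.fst)).clm_apply
      (differentiableAt_const u)

theorem fderiv_coframe_apply (hψ : ψ ∈ IsManifold.maximalAtlas (𝓡 N) ∞ G)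
    {z : JetCoord n N} (hz : z.2.1 ∈ ψ.target) (u : EuclideanSpace ℝ (Fin N))
    (v : JetCoord n N) :
    fderiv ℝ (fun z : JetCoord n N => coframe b ψ z.2.1 u) z v =
      fderiv ℝ (coframe b ψ) z.2.1 v.2.1 u := by
  have hc : DifferentiableAt ℝ (coframe b ψ) z.2.1 :=
    (contDiffAt_coframe b hψ hz).differentiableAt (by simp)
  have h1 : HasFDerivAt (fun z : JetCoord n N => z.2.1) ((ContinuousLinearMap.fst ℝ _ _).comp
      (ContinuousLinearMap.snd ℝ _ _)) z := hasFDerivAt_snd.fst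
  have h2 : HasFDerivAt (fun z : JetCoord n N => coframe b ψ z.2.1)
      ((fderiv ℝ (coframe b ψ) z.2.1).comp ((ContinuousLinearMap.fst ℝ _ _).comp
        (ContinuousLinearMap.snd ℝ _ _))) z :=
    HasFDerivAt.comp (g := coframe b ψ) z hc.hasFDerivAt h1
  rw [(h2.clm_apply (hasFDerivAt_const u z)).fderiv]
  simp

/-- The counterpart of `sum_variation_eq` for `dΘ`. The arbitrary `∂/∂ξ` component `ζ` enters once
through `-∂l/∂ξ · ξ` and once through `dl`, with opposite signs, and cancels. -/
theorem sum_pullback_eq {ι κ : Type*} [Fintype ι] [Fintype κ] {P dP C₁ C₂ ζ : κ → ι → ℝ}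
    {η F : ι → ℝ} {S : ℝ}
    (h : ∑ A, η A * F A = (∑ μ, ∑ A, P μ A * (C₁ μ A - C₂ μ A)) + S) :
    ((∑ μ, ∑ A, P μ A * (C₁ μ A - ζ μ A)) + (S + ∑ μ, ∑ A, ζ μ A * P μ A)) +
      ∑ μ, -∑ A, (dP μ A * η A + P μ A * C₂ μ A) =
      -∑ A, η A * ((∑ μ, dP μ A) - F A) := by
  have h1 : ∑ A, η A * ((∑ μ, dP μ A) - F A) = (∑ μ, ∑ A, dP μ A * η A) - ∑ A, η A * F A := by
    rw [Finset.sum_comm, ← Finset.sum_sub_distrib]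
    refine Finset.sum_congr rfl fun A _ => ?_
    rw [mul_sub, Finset.mul_sum]
    simp only [mul_comm]
  have h2 : (∑ μ, ∑ A, P μ A * (C₁ μ A - ζ μ A)) + ∑ μ, ∑ A, ζ μ A * P μ A =
      (∑ μ, ∑ A, P μ A * (C₁ μ A - C₂ μ A)) + ∑ μ, ∑ A, P μ A * C₂ μ A := by
    simp only [← Finset.sum_add_distrib]
    exact Finset.sum_congr rfl fun μ _ => Finset.sum_congr rfl fun A _ => by ring
  rw [h1, h, Finset.sum_neg_distrib]
  simp only [Finset.sum_add_distrib]
  linarith [h2]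

/-- `dΘ` on a vertical vector and the coordinate frame of a holonomic section. -/
theorem extDeriv_poincareCartan_cons (hψ : ψ ∈ IsManifold.maximalAtlas (𝓡 N) ∞ G)
    (hy : ContDiffAt ℝ 3 y x) (hx : y x ∈ ψ.target) {L : JetCoord n N → ℝ}
    (hL : ContDiffAt ℝ 2 L (coordJet b ψ y x)) (w : EuclideanSpace ℝ (Fin N))
    (ζ : Fin (n + 1) → Fin N → ℝ) :
    extDeriv (poincareCartan b ψ L) (coordJet b ψ y x)
      (Fin.cons ((0, w, ζ) : JetCoord n N)
        fun μ => fderiv ℝ (coordJet b ψ y) x (EuclideanSpace.single μ 1)) =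
      -∑ A, coframe b ψ (y x) w A * coordEulerPoincare b ψ L y x A := by
  set X : Fin (n + 1) → JetCoord n N :=
    fun μ => fderiv ℝ (coordJet b ψ y) x (EuclideanSpace.single μ 1) with hX
  have hX1 : ∀ μ, (X μ).1 = EuclideanSpace.single μ 1 := fun μ =>
    fderiv_coordJet_fst b hψ hy hx _
  have hX2 : ∀ μ, (X μ).2.1 = fderiv ℝ y x (EuclideanSpace.single μ 1) := fun μ =>
    fderiv_coordJet_snd_fst b hψ hy hx _
  have hz1 : (coordJet b ψ y x).2.1 = y x := rfl
  have hz2 : ∀ μ, (coordJet b ψ y x).2.2 μ = coframe b ψ (y x) (X μ).2.1 := fun μ => by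
    rw [hX2]
    rfl
  have hJ : DifferentiableAt ℝ (coordJet b ψ y) x :=
    (contDiffAt_coordJet b hψ hy hx).differentiableAt (by simp)
  have hp : ∀ μ A, DifferentiableAt ℝ (fun z => fderiv ℝ L z (vecXi μ A)) (coordJet b ψ y x) :=
    fun μ A => (contDiffAt_momentum hL _).differentiableAt (by simp)
  have hpX : ∀ μ A, fderiv ℝ (fun z => fderiv ℝ L z (vecXi μ A)) (coordJet b ψ y x) (X μ) =
      fderiv ℝ (fun x' => fderiv ℝ L (coordJet b ψ y x') (vecXi μ A)) x
        (EuclideanSpace.single μ 1) := fun μ A => by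
    have h : fderiv ℝ (fun x' => fderiv ℝ L (coordJet b ψ y x') (vecXi μ A)) x = _ :=
      fderiv_comp (g := fun z => fderiv ℝ L z (vecXi μ A)) x (hp μ A) hJ
    rw [h]
    rfl
  have hzero : (0 : Fin (n + 2)).removeNth
      (Fin.cons (0, w, ζ) X : Fin (n + 2) → JetCoord n N) = X := by
    funext j
    simp [Fin.removeNth]
  -- The vectors `X μ` are frozen at the base point, so `dΘ` is an alternating sum of derivatives of
  -- `Θ` on constant vectors, without bracket terms.
  rw [extDeriv_apply (differentiableAt_poincareCartan b hψ hx hL), Fin.sum_univ_succ, hzero]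
  simp only [Fin.cons_zero, Fin.cons_succ, Fin.val_zero, pow_zero, one_smul, Fin.val_succ]
  have h0 : fderiv ℝ (fun z => poincareCartan b ψ L z X) (coordJet b ψ y x) (0, w, ζ) =
      (∑ μ, ∑ A, fderiv ℝ L (coordJet b ψ y x) (vecXi μ A) *
        (fderiv ℝ (coframe b ψ) (y x) w (X μ).2.1 A - ζ μ A)) +
      ((∑ B, w B * fderiv ℝ L (coordJet b ψ y x) (vecY n B)) +
        ∑ μ, ∑ A, ζ μ A * fderiv ℝ L (coordJet b ψ y x) (vecXi μ A)) := by
    have hc : ∀ μ, DifferentiableAt ℝ (fun z : JetCoord n N =>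
        coframe b ψ z.2.1 (X μ).2.1 - z.2.2 μ) (coordJet b ψ y x) := fun μ =>
      (differentiableAt_coframe_apply b hψ hx _).fun_sub (by fun_prop)
    have hc' : ∀ μ, fderiv ℝ (fun z : JetCoord n N =>
        coframe b ψ z.2.1 (X μ).2.1 - z.2.2 μ) (coordJet b ψ y x) (0, w, ζ) =
        fderiv ℝ (coframe b ψ) (y x) w (X μ).2.1 - ζ μ := fun μ => by
      have hs : HasFDerivAt (fun z : JetCoord n N => z.2.2 μ)
          ((ContinuousLinearMap.proj μ).comp ((ContinuousLinearMap.snd ℝ _ _).comp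
            (ContinuousLinearMap.snd ℝ _ _))) (coordJet b ψ y x) :=
        hasFDerivAt_pi'.1 (hasFDerivAt_snd.snd) μ
      rw [fderiv_fun_sub (differentiableAt_coframe_apply b hψ hx _) hs.differentiableAt,
        sub_apply, fderiv_coframe_apply b hψ hx, hs.fderiv]
      rfl
    have hsum : ∀ μ, DifferentiableAt ℝ (fun z : JetCoord n N => ∑ A,
        fderiv ℝ L z (vecXi μ A) * (coframe b ψ z.2.1 (X μ).2.1 - z.2.2 μ) A)
        (coordJet b ψ y x) := fun μ => DifferentiableAt.fun_sum fun A _ =>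
      (hp μ A).fun_mul (differentiableAt_pi.1 (hc μ) A)
    have hf : (fun z => poincareCartan b ψ L z X) = fun z => (∑ μ, ∑ A,
        fderiv ℝ L z (vecXi μ A) * (coframe b ψ z.2.1 (X μ).2.1 - z.2.2 μ) A) + L z := by
      funext z
      exact poincareCartan_apply_horizontal b ψ L z hX1
    rw [hf, fderiv_fun_add (DifferentiableAt.fun_sum fun μ _ => hsum μ)
      (hL.differentiableAt (by simp)), add_apply,
      fderiv_fun_sum fun μ _ => hsum μ, sum_apply, clm_apply_jetCoord (fderiv ℝ L _)]
    congr 1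
    refine Finset.sum_congr rfl fun μ _ => ?_
    -- Holonomy: the factor `λ(X_μ) - ξ_μ` vanishes at the jet itself, so derivatives of the momenta
    -- along the vertical vector drop out.
    rw [fderiv_sum_mul (hp μ) (hc μ), hc' μ, hz1, hz2]
    simp
  have hi : ∀ i : Fin (n + 1), (-1 : ℤ) ^ ((i : ℕ) + 1) • fderiv ℝ (fun z =>
      poincareCartan b ψ L z (i.succ.removeNth (Fin.cons (0, w, ζ) X : Fin (n + 2) → _)))
        (coordJet b ψ y x) (X i) =
      -∑ A, (fderiv ℝ (fun x' => fderiv ℝ L (coordJet b ψ y x') (vecXi i A)) x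
        (EuclideanSpace.single i 1) * coframe b ψ (y x) w A +
        fderiv ℝ L (coordJet b ψ y x) (vecXi i A) *
          fderiv ℝ (coframe b ψ) (y x) (X i).2.1 w A) := by
    intro i
    rw [← Int.cast_smul_eq_zsmul ℝ]
    push_cast
    -- The sign `(-1)^i` extracted here combines with the `(-1)^(i+1)` of the exterior derivative to
    -- `-1`, whatever `i`.
    have hf : (fun z => poincareCartan b ψ L z
        (i.succ.removeNth (Fin.cons (0, w, ζ) X : Fin (n + 2) → _))) =
        fun z => (-1 : ℝ) ^ (i : ℕ) * ∑ A, fderiv ℝ L z (vecXi i A) * coframe b ψ z.2.1 w A := by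
      funext z
      rw [← poincareCartan_apply_cons b ψ L z hX1 (w := (0, w, ζ)) rfl i, ← mul_assoc, ← pow_add,
        Even.neg_one_pow ⟨_, rfl⟩, one_mul]
    have hd : DifferentiableAt ℝ (fun z : JetCoord n N => ∑ A, fderiv ℝ L z (vecXi i A) *
        coframe b ψ z.2.1 w A) (coordJet b ψ y x) := DifferentiableAt.fun_sum fun A _ =>
      (hp i A).fun_mul (differentiableAt_pi.1 (differentiableAt_coframe_apply b hψ hx w) A)
    rw [hf, fderiv_const_mul hd, smul_apply, smul_smul, pow_succ, mul_neg_one, neg_mul, ← pow_add,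
      Even.neg_one_pow ⟨_, rfl⟩, neg_smul, one_smul,
      fderiv_sum_mul (hp i) (differentiableAt_coframe_apply b hψ hx w),
      fderiv_coframe_apply b hψ hx]
    simp only [hpX, hz1]
  rw [h0, Finset.sum_congr rfl fun i _ => hi i]
  exact sum_pullback_eq (sum_coframe_mul_force b hψ (L := L) (z := coordJet b ψ y x) hx
    (fun μ => (X μ).2.1) hz2 w)

/-- An alternating form vanishes on repeated arguments. This is what permits replacing `W` by its
vertical part relative to the section. -/
theorem curryLeft_sub_sum_apply {V : Type*} [NormedAddCommGroup V] [NormedSpace ℝ V] {k : ℕ}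
    (f : V [⋀^Fin (k + 1)]→L[ℝ] ℝ) (w : V) (c : Fin k → ℝ) (u : Fin k → V) :
    f.curryLeft (w - ∑ i, c i • u i) u = f.curryLeft w u := by
  have h : ∀ i, f.curryLeft (u i) u = 0 := fun i =>
    f.map_eq_zero_of_eq (Matrix.vecCons (u i) u) (i := 0) (j := i.succ) (by simp)
      (Fin.succ_ne_zero i).symm
  rw [← ContinuousAlternatingMap.curryLeftLI_apply (𝕜 := ℝ), map_sub, map_sum]
  simp [ContinuousAlternatingMap.sum_apply, h]

/-- `(j¹σ)^*(W ⌟ Ω)` on the coordinate frame: the pairing of the vertical part of `W` with the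
Euler-Poincaré expression. -/
theorem curryLeft_neg_extDeriv_apply (hψ : ψ ∈ IsManifold.maximalAtlas (𝓡 N) ∞ G)
    (hy : ContDiffAt ℝ 3 y x) (hx : y x ∈ ψ.target) {L : JetCoord n N → ℝ}
    (hL : ContDiffAt ℝ 2 L (coordJet b ψ y x)) (W : JetCoord n N) :
    (-extDeriv (poincareCartan b ψ L) (coordJet b ψ y x)).curryLeft W
      (fun μ => fderiv ℝ (coordJet b ψ y) x (EuclideanSpace.single μ 1)) =
      ∑ A, coframe b ψ (y x) (W.2.1 - fderiv ℝ y x W.1) A *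
        coordEulerPoincare b ψ L y x A := by
  have hW : ∑ μ, W.1 μ • fderiv ℝ (coordJet b ψ y) x (EuclideanSpace.single μ 1) =
      fderiv ℝ (coordJet b ψ y) x W.1 := (clm_apply_euclideanSpace _ _).symm
  -- Subtracting the tangent vector of `j¹σ` with the same projection to `x` leaves a vertical
  -- vector.
  have hV : W - fderiv ℝ (coordJet b ψ y) x W.1 = (0, W.2.1 - fderiv ℝ y x W.1,
      W.2.2 - (fderiv ℝ (coordJet b ψ y) x W.1).2.2) := by
    refine Prod.ext ?_ (Prod.ext ?_ rfl)
    · simp [fderiv_coordJet_fst b hψ hy hx]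
    · simp [fderiv_coordJet_snd_fst b hψ hy hx]
  rw [← curryLeft_sub_sum_apply _ W (fun μ => W.1 μ), hW, hV,
    ContinuousAlternatingMap.curryLeft_apply_apply, ContinuousAlternatingMap.neg_apply]
  exact neg_eq_iff_eq_neg.2 (extDeriv_poincareCartan_cons b hψ hy hx hL _ _)

end Pullback

end

end ReducedFieldTheory

namespace ReducedFieldTheory

noncomputable section

/-! ### The measure of the volume form -/

section VolumeMeasure

variable {n : ℕ} {M : Type*} [TopologicalSpace M]
  [ChartedSpace (EuclideanSpace ℝ (Fin (n + 1))) M]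
  {vol : ∀ x : M, TangentSpace (𝓡 (n + 1)) x [⋀^Fin (n + 1)]→L[ℝ] ℝ}
  {φ φ' : OpenPartialHomeomorph M (EuclideanSpace ℝ (Fin (n + 1)))}

theorem coordVolume_map {m : ℕ} (f : EuclideanSpace ℝ (Fin m) →L[ℝ] EuclideanSpace ℝ (Fin m)) :
    coordVolume m (fun i => f (EuclideanSpace.single i 1)) = f.det := by
  have h := (EuclideanSpace.basisFun (Fin m) ℝ).toBasis.det_comp f.toLinearMap
    (EuclideanSpace.basisFun (Fin m) ℝ).toBasis
  rw [Module.Basis.det_self, mul_one] at h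
  refine Eq.trans ?_ h
  change (EuclideanSpace.basisFun (Fin m) ℝ).toBasis.det _ = _
  congr 1
  ext i
  simp

theorem differentiableAt_transition (hφ : IsUnimodularChart vol φ) (hφ' : IsUnimodularChart vol φ')
    {z : EuclideanSpace ℝ (Fin (n + 1))} (hz : z ∈ φ'.target) (hz' : φ'.symm z ∈ φ.source) :
    DifferentiableAt ℝ (fun z => φ (φ'.symm z)) z :=
  ((contMDiffAt_chart hφ.mem_maximalAtlas hz').comp z
    (contMDiffAt_chart_symm hφ'.mem_maximalAtlas hz)).contDiffAt.differentiableAt (by simp)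

/-- Both charts express the same `vol`; evaluating it on the coordinate frame of `φ'` gives `1` in
one chart and the Jacobian in the other. -/
theorem det_fderiv_transition (hφ : IsUnimodularChart vol φ) (hφ' : IsUnimodularChart vol φ')
    {z : EuclideanSpace ℝ (Fin (n + 1))} (hz : z ∈ φ'.target) (hz' : φ'.symm z ∈ φ.source) :
    (fderiv ℝ (fun z => φ (φ'.symm z)) z).det = 1 := by
  have h1 := mfderiv_comp z
    ((contMDiffAt_chart hφ.mem_maximalAtlas hz').mdifferentiableAt (by simp))
    ((contMDiffAt_chart_symm hφ'.mem_maximalAtlas hz).mdifferentiableAt (by simp))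
  rw [mfderiv_eq_fderiv] at h1
  have h2 := (hφ.form_eq _ hz' fun i => mfderiv (𝓡 (n + 1)) (𝓡 (n + 1)) φ'.symm z
    (EuclideanSpace.single i (1 : ℝ))).symm.trans (hφ'.form_eq _ (φ'.map_target hz) _)
  have h3 : (fun i => mfderiv (𝓡 (n + 1)) (𝓡 (n + 1)) φ' (φ'.symm z)
      (mfderiv (𝓡 (n + 1)) (𝓡 (n + 1)) φ'.symm z (EuclideanSpace.single i (1 : ℝ)))) =
      fun i => EuclideanSpace.single i (1 : ℝ) :=
    funext fun i => mfderiv_chart_symm_apply hφ'.mem_maximalAtlas hz _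
  rw [← coordVolume_map]
  refine Eq.trans ?_ ((h2.trans (congrArg _ h3)).trans (coordVolume_apply_single _))
  refine congrArg _ (funext fun i => ?_)
  exact congrArg (fun f => f (EuclideanSpace.single i (1 : ℝ))) h1

/-- The measures of two unimodular charts agree on the overlap. -/
theorem chartMeasure_restrict_le [MeasurableSpace M] [BorelSpace M]
    (hφ : IsUnimodularChart vol φ) (hφ' : IsUnimodularChart vol φ') :
    ((volume.restrict φ'.target).map φ'.symm).restrict φ.source ≤
      (volume.restrict φ.target).map φ.symm := by
  have haem : ∀ χ : OpenPartialHomeomorph M (EuclideanSpace ℝ (Fin (n + 1))),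
      AEMeasurable χ.symm (volume.restrict χ.target) := fun χ =>
    χ.continuousOn_symm.aemeasurable χ.open_target.measurableSet
  refine Measure.le_iff.2 fun A hA => ?_
  rw [Measure.restrict_apply hA,
    Measure.map_apply_of_aemeasurable (haem φ') (hA.inter φ.open_source.measurableSet),
    Measure.map_apply_of_aemeasurable (haem φ) hA,
    Measure.restrict_apply' φ'.open_target.measurableSet,
    Measure.restrict_apply' φ.open_target.measurableSet]
  set S := φ'.symm ⁻¹' (A ∩ φ.source) ∩ φ'.target with hS
  -- `φ'.symm` is continuous only on the target, so measurability is established on that subtype and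
  -- then transported.
  have hSm : MeasurableSet S := by
    have h := φ'.open_target.measurableSet.subtype_image
      (φ'.continuousOn_symm.domRestrict.measurable (hA.inter φ.open_source.measurableSet))
    convert h using 1
    ext z
    simp only [hS, mem_inter_iff, mem_preimage, mem_image, Subtype.exists, domRestrict_apply]
    grind
  have hinj : InjOn (fun z => φ (φ'.symm z)) S := by
    intro z hz w hw h
    exact φ'.symm.injOn hz.2 hw.2 (φ.injOn hz.1.2 hw.1.2 h)
  have h := lintegral_abs_det_fderiv_eq_addHaar_image volume hSm
    (f' := fun z => fderiv ℝ (fun z => φ (φ'.symm z)) z)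
    (fun z hz => (differentiableAt_transition hφ hφ' hz.2 hz.1.2).hasFDerivAt.hasFDerivWithinAt)
    hinj
  have h1 : ∫⁻ z in S, ENNReal.ofReal |(fderiv ℝ (fun z => φ (φ'.symm z)) z).det| =
      volume S := by
    rw [setLIntegral_congr_fun hSm (g := fun _ => 1) fun z hz => by
      simp [det_fderiv_transition hφ hφ' hz.2 hz.1.2]]
    simp
  rw [← h1, h]
  refine measure_mono ?_
  rintro _ ⟨z, hz, rfl⟩
  exact ⟨by simpa [φ.left_inv hz.1.2] using hz.1.1, φ.map_source hz.1.2⟩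

/-- In a unimodular chart the measure of the volume form is Lebesgue measure. -/
theorem volumeMeasure_restrict_source [MeasurableSpace M] [BorelSpace M]
    (hφ : IsUnimodularChart vol φ) :
    (volumeMeasure vol).restrict φ.source = (volume.restrict φ.target).map φ.symm := by
  have hs := φ.open_source.measurableSet
  have haem : AEMeasurable φ.symm (volume.restrict φ.target) :=
    φ.continuousOn_symm.aemeasurable φ.open_target.measurableSet
  have hself : ((volume.restrict φ.target).map φ.symm).restrict φ.source =
      (volume.restrict φ.target).map φ.symm := by
    refine Measure.restrict_eq_self_of_ae_mem ?_
    rw [ae_map_iff haem (p := fun x => x ∈ φ.source) hs,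
      ae_restrict_iff' φ.open_target.measurableSet]
    exact Filter.Eventually.of_forall fun z hz => φ.map_target hz
  refine le_antisymm ?_ ?_
  -- Every chart measure splits into its part on `φ.source`, controlled by
  -- `chartMeasure_restrict_le`, and its part outside, bounded crudely by `⊤`. Restriction to
  -- `φ.source` erases the latter, so the supremum is never computed.
  · have hle : volumeMeasure vol ≤
        (volume.restrict φ.target).map φ.symm + (⊤ : Measure M).restrict φ.sourceᶜ := by
      refine iSup_le fun χ => ?_
      rw [← Measure.restrict_add_restrict_compl (μ := (volume.restrict χ.1.target).map χ.1.symm) hs]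
      exact add_le_add (chartMeasure_restrict_le hφ χ.2) (Measure.restrict_mono subset_rfl le_top)
    refine (Measure.restrict_mono subset_rfl hle).trans ?_
    rw [Measure.restrict_add, Measure.restrict_restrict hs, hself]
    simp
  · rw [← hself]
    exact Measure.restrict_mono subset_rfl
      (le_iSup (fun χ : {φ : OpenPartialHomeomorph M (EuclideanSpace ℝ (Fin (n + 1))) //
        IsUnimodularChart vol φ} => (volume.restrict χ.1.target).map χ.1.symm) ⟨φ, hφ⟩)

/-- Local finiteness is enough: in a unimodular chart, the points lying over a ball have measure at
most the Lebesgue measure of the ball. -/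
theorem isFiniteMeasureOnCompacts_volumeMeasure [MeasurableSpace M] [BorelSpace M]
    (hvol : IsVolumeForm vol) : IsFiniteMeasureOnCompacts (volumeMeasure vol) := by
  have : IsLocallyFiniteMeasure (volumeMeasure vol) := by
    refine ⟨fun x => ?_⟩
    obtain ⟨φ, hφ, hx⟩ := hvol x
    obtain ⟨r, hr, hball⟩ := Metric.isOpen_iff.1 φ.open_target (φ x) (φ.map_source hx)
    refine ⟨φ.source ∩ φ ⁻¹' Metric.ball (φ x) r, ?_, ?_⟩
    · exact (φ.isOpen_inter_preimage Metric.isOpen_ball).mem_nhds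
        ⟨hx, Metric.mem_ball_self hr⟩
    · have hm : MeasurableSet (φ.source ∩ φ ⁻¹' Metric.ball (φ x) r) :=
        (φ.isOpen_inter_preimage Metric.isOpen_ball).measurableSet
      have h : volumeMeasure vol (φ.source ∩ φ ⁻¹' Metric.ball (φ x) r) =
          (volumeMeasure vol).restrict φ.source (φ.source ∩ φ ⁻¹' Metric.ball (φ x) r) := by
        rw [Measure.restrict_apply hm, inter_eq_self_of_subset_left inter_subset_left]
      rw [h, volumeMeasure_restrict_source hφ, Measure.map_apply_of_aemeasurable
        (φ.continuousOn_symm.aemeasurable φ.open_target.measurableSet) hm,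
        Measure.restrict_apply' φ.open_target.measurableSet]
      refine (measure_mono (t := Metric.ball (φ x) r) ?_).trans_lt measure_ball_lt_top
      rintro z ⟨⟨_, hz⟩, hzt⟩
      simpa [φ.right_inv hzt] using hz
  infer_instance

end VolumeMeasure

end

end ReducedFieldTheory

namespace ReducedFieldTheory

noncomputable section

/-! ### Jets of sections in a natural local system -/

section Jets

variable {n N : ℕ}
  {M : Type*} [TopologicalSpace M] [ChartedSpace (EuclideanSpace ℝ (Fin (n + 1))) M]
  {G : Type*} [TopologicalSpace G] [ChartedSpace (EuclideanSpace ℝ (Fin N)) G] [Group G]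
  {FE : Type*} [NormedAddCommGroup FE] [NormedSpace ℝ FE] {HE : Type*} [TopologicalSpace HE]
  {IE : ModelWithCorners ℝ FE HE} {E : Type*} [TopologicalSpace E] [ChartedSpace HE E]
  {P : PrincipalBundle n N M G IE E}
  {vol : ∀ x : M, TangentSpace (𝓡 (n + 1)) x [⋀^Fin (n + 1)]→L[ℝ] ℝ}

/-- The linear part of a jet has a type that depends on its target point. Comparing derivatives as
maps of model spaces avoids casts. -/
theorem jet_congr {σ σ' : M → E} {x : M} (h : σ x = σ' x)
    (h' : (mfderiv (𝓡 (n + 1)) IE σ x : EuclideanSpace ℝ (Fin (n + 1)) →L[ℝ] FE) =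
      mfderiv (𝓡 (n + 1)) IE σ' x) :
    (jet IE σ x : OneJet n M IE E) = jet IE σ' x := by
  have key : ∀ (p q : E) (A A' : EuclideanSpace ℝ (Fin (n + 1)) →L[ℝ] FE), p = q → A = A' →
      (⟨x, p, A⟩ : OneJet n M IE E) = ⟨x, q, A'⟩ := by
    rintro p _ A _ rfl rfl
    rfl
  exact key _ _ _ _ h h'

theorem jet_eq_of_eventuallyEq {σ σ' : M → E} {x : M} (h : σ =ᶠ[nhds x] σ') :
    (jet IE σ x : OneJet n M IE E) = jet IE σ' x :=
  jet_congr h.self_of_nhds h.mfderiv_eq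

theorem LocalTriv.mfderiv_act_sec (τ : LocalTriv n N IE P.proj P.act) {x : M} (hx : x ∈ τ.U)
    {g : M → G} (hg : MDifferentiableAt (𝓡 (n + 1)) (𝓡 N) g x) :
    (mfderiv (𝓡 (n + 1)) IE (fun m => P.act (τ.sec m) (g m)) x :
        EuclideanSpace ℝ (Fin (n + 1)) →L[ℝ] FE) =
      (mfderiv (IE.prod (𝓡 N)) IE (fun q : E × G => P.act q.1 q.2) (τ.sec x, g x) :
        FE × EuclideanSpace ℝ (Fin N) →L[ℝ] FE).comp
      (ContinuousLinearMap.prod (mfderiv (𝓡 (n + 1)) IE τ.sec x :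
        EuclideanSpace ℝ (Fin (n + 1)) →L[ℝ] FE) (mfderiv (𝓡 (n + 1)) (𝓡 N) g x :
          EuclideanSpace ℝ (Fin (n + 1)) →L[ℝ] EuclideanSpace ℝ (Fin N))) := by
  have hsec : MDifferentiableAt (𝓡 (n + 1)) IE τ.sec x :=
    (τ.contMDiffOn_sec.contMDiffAt (τ.isOpen_U.mem_nhds hx)).mdifferentiableAt (by simp)
  have h := mfderiv_comp x (g := fun q : E × G => P.act q.1 q.2) (f := fun m => (τ.sec m, g m))
    (P.contMDiff_act.contMDiffAt.mdifferentiableAt (by simp)) (hsec.prodMk hg)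
  rw [mfderiv_prodMk hsec hg] at h
  exact h

/-- By the chain rule for the action, the jet of `sec · g` sees only the value and the first
derivative of `g`. -/
theorem LocalTriv.jet_act_sec_congr (τ : LocalTriv n N IE P.proj P.act) {x : M} (hx : x ∈ τ.U)
    {g g' : M → G} (hg : MDifferentiableAt (𝓡 (n + 1)) (𝓡 N) g x)
    (hg' : MDifferentiableAt (𝓡 (n + 1)) (𝓡 N) g' x) (h : g x = g' x)
    (h' : (mfderiv (𝓡 (n + 1)) (𝓡 N) g x :
        EuclideanSpace ℝ (Fin (n + 1)) →L[ℝ] EuclideanSpace ℝ (Fin N)) =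
      mfderiv (𝓡 (n + 1)) (𝓡 N) g' x) :
    (jet IE (fun m => P.act (τ.sec m) (g m)) x : OneJet n M IE E) =
      jet IE (fun m => P.act (τ.sec m) (g' m)) x := by
  refine jet_congr (by simp only [h]) ?_
  rw [τ.mfderiv_act_sec hx hg, τ.mfderiv_act_sec hx hg', h, h']

/-- Equivariance of the trivialisation: acting on a section multiplies its group-valued expression
on the right, which commutes with left translations. -/
theorem LocalTriv.fib_act (τ : LocalTriv n N IE P.proj P.act) {p : E} (hp : P.proj p ∈ τ.U)
    (g : G) : τ.fib (P.act p g) = τ.fib p * g := by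
  conv_lhs => rw [← τ.act_sec_fib p hp, ← P.act_mul]
  exact τ.fib_act_sec _ hp _

/-- A smooth one-parameter family of sections over `U`. -/
structure IsSectionFamily (P : PrincipalBundle n N M G IE E) (U : Set M) (σε : ℝ → M → E) :
    Prop where
  smooth : ContMDiffOn (𝓘(ℝ, ℝ).prod (𝓡 (n + 1))) IE ∞ (fun q : ℝ × M => σε q.1 q.2) (univ ×ˢ U)
  proj_eq : ∀ ε, ∀ x ∈ U, P.proj (σε ε x) = x

theorem IsVariation.isSectionFamily {U K : Set M} {σ : M → E} {σε : ℝ → M → E}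
    (h : IsVariation P U K σ σε) : IsSectionFamily P U σε := ⟨h.smooth, h.proj_eq⟩

theorem PrincipalBundle.IsSectionOn.isSectionFamily {U : Set M} {σ : M → E}
    (h : P.IsSectionOn U σ) : IsSectionFamily P U fun _ => σ :=
  ⟨h.smooth.comp contMDiffOn_snd fun _ hq => hq.2, fun _ => h.proj_eq⟩

theorem IsSectionFamily.isSectionOn {U : Set M} {σε : ℝ → M → E} (h : IsSectionFamily P U σε)
    (ε : ℝ) : P.IsSectionOn U (σε ε) :=
  ⟨h.smooth.comp (contMDiffOn_const.prodMk contMDiffOn_id) fun _ hx => ⟨mem_univ _, hx⟩,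
    h.proj_eq ε⟩

namespace LocalSystem

variable (κ : LocalSystem P vol)

/-- The coordinate expression `(ε, x) ↦ y(ε, x)` of a family of sections. -/
def coordFamily (σε : ℝ → M → E) (q : ℝ × EuclideanSpace ℝ (Fin (n + 1))) :
    EuclideanSpace ℝ (Fin N) :=
  κ.ψ (κ.fibre (σε q.1) q.2)

/-- The coordinates `(ε, x)` of the points where a family is described by the local system. -/
def familyDomain (U : Set M) (σε : ℝ → M → E) : Set (ℝ × EuclideanSpace ℝ (Fin (n + 1))) :=
  {q | q.2 ∈ κ.sectionDomain U (σε q.1)}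

variable {U : Set M} {σε : ℝ → M → E}

theorem contMDiffOn_fibre (hσ : IsSectionFamily P U σε) :
    ContMDiffOn 𝓘(ℝ, ℝ × EuclideanSpace ℝ (Fin (n + 1))) (𝓡 N) ∞
      (fun q : ℝ × EuclideanSpace ℝ (Fin (n + 1)) => κ.fibre (σε q.1) q.2)
      {q | q.2 ∈ κ.φ.target ∧ κ.φ.symm q.2 ∈ U} := by
  have h1 : ContMDiffOn 𝓘(ℝ, ℝ × EuclideanSpace ℝ (Fin (n + 1))) (𝓘(ℝ, ℝ).prod (𝓡 (n + 1))) ∞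
      (fun q : ℝ × EuclideanSpace ℝ (Fin (n + 1)) => (q.1, κ.φ.symm q.2))
      {q | q.2 ∈ κ.φ.target ∧ κ.φ.symm q.2 ∈ U} :=
    (contDiff_fst.contMDiff.contMDiffOn).prodMk
      ((contMDiffOn_symm_of_mem_maximalAtlas κ.unimodular.mem_maximalAtlas).comp
        (contDiff_snd.contMDiff.contMDiffOn) fun q hq => hq.1)
  have h2 := hσ.smooth.comp h1 fun q hq => ⟨mem_univ _, hq.2⟩
  refine κ.triv.contMDiffOn_fib.comp h2 fun q hq => ?_
  change P.proj (σε q.1 (κ.φ.symm q.2)) ∈ κ.triv.U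
  rw [hσ.proj_eq _ _ hq.2]
  exact κ.source_subset (κ.φ.map_target hq.1)

theorem isOpen_preDomain (hU : IsOpen U) :
    IsOpen {x | x ∈ κ.φ.target ∧ κ.φ.symm x ∈ U} :=
  κ.φ.symm.isOpen_inter_preimage hU

theorem isOpen_familyDomain (hU : IsOpen U) (hσ : IsSectionFamily P U σε) :
    IsOpen (κ.familyDomain U σε) := by
  have h := (κ.contMDiffOn_fibre hσ).continuousOn.isOpen_inter_preimage
    ((κ.isOpen_preDomain hU).preimage continuous_snd) κ.ψ.open_source
  convert h using 1
  ext q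
  simp only [familyDomain, sectionDomain, mem_ofPred_eq, mem_inter_iff, mem_preimage, and_assoc]

theorem contDiffAt_coordFamily (hU : IsOpen U) (hσ : IsSectionFamily P U σε)
    {q : ℝ × EuclideanSpace ℝ (Fin (n + 1))} (hq : q ∈ κ.familyDomain U σε) :
    ContDiffAt ℝ ∞ (κ.coordFamily σε) q := by
  have h1 := (κ.contMDiffOn_fibre hσ).contMDiffAt
    (((κ.isOpen_preDomain hU).preimage continuous_snd).mem_nhds ⟨hq.1, hq.2.1⟩)
  exact ((contMDiffAt_chart κ.mem_maximalAtlas hq.2.2).comp q h1).contDiffAt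

theorem isOpen_sectionDomain (hU : IsOpen U) {σ : M → E} (hσ : P.IsSectionOn U σ) :
    IsOpen (κ.sectionDomain U σ) :=
  (κ.isOpen_familyDomain hU hσ.isSectionFamily).preimage (Continuous.prodMk_right (0 : ℝ))

/-- The coordinate expression `x ↦ y(x)` of a section. -/
def coordSection (σ : M → E) (x : EuclideanSpace ℝ (Fin (n + 1))) : EuclideanSpace ℝ (Fin N) :=
  κ.ψ (κ.fibre σ x)

theorem contDiffAt_coordSection (hU : IsOpen U) {σ : M → E} (hσ : P.IsSectionOn U σ)
    {x : EuclideanSpace ℝ (Fin (n + 1))} (hx : x ∈ κ.sectionDomain U σ) :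
    ContDiffAt ℝ ∞ (κ.coordSection σ) x :=
  ContDiffAt.comp (g := κ.coordFamily fun _ => σ) x
    (κ.contDiffAt_coordFamily (q := (0, x)) hU hσ.isSectionFamily hx)
    (contDiffAt_const.prodMk contDiffAt_id)

variable (b : Module.Basis (Fin N) ℝ (GroupLieAlgebra (𝓡 N) G))

/-- Near `x` one has `g = ψ⁻¹ ∘ y`, so `∂g/∂x^μ` is the image of `∂_μ y` and `λ(∂g/∂x^μ)` becomes
`coframe` of `∂_μ y`. -/
theorem jetSection_eq_coordJet (hU : IsOpen U) {σ : M → E} (hσ : P.IsSectionOn U σ)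
    {x : EuclideanSpace ℝ (Fin (n + 1))} (hx : x ∈ κ.sectionDomain U σ) :
    κ.jetSection b σ x = coordJet b κ.ψ (κ.coordSection σ) x := by
  have hy := κ.contDiffAt_coordSection hU hσ hx
  have hyt : κ.coordSection σ x ∈ κ.ψ.target := κ.ψ.map_source hx.2.2
  have hev : κ.fibre σ =ᶠ[nhds x] κ.ψ.symm ∘ κ.coordSection σ := by
    filter_upwards [(κ.isOpen_sectionDomain hU hσ).mem_nhds hx] with x' hx'
    exact (κ.ψ.left_inv hx'.2.2).symm
  have hd : (mfderiv (𝓡 (n + 1)) (𝓡 N) (κ.fibre σ) x :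
      EuclideanSpace ℝ (Fin (n + 1)) →L[ℝ] EuclideanSpace ℝ (Fin N)) =
      (mfderiv (𝓡 N) (𝓡 N) κ.ψ.symm (κ.coordSection σ x) :
        EuclideanSpace ℝ (Fin N) →L[ℝ] EuclideanSpace ℝ (Fin N)).comp
        (fderiv ℝ (κ.coordSection σ) x) := by
    refine hev.mfderiv_eq.trans ?_
    rw [mfderiv_comp x ((contMDiffAt_chart_symm κ.mem_maximalAtlas hyt).mdifferentiableAt (by simp))
      (hy.differentiableAt (by simp)).mdifferentiableAt, mfderiv_eq_fderiv]
    rfl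
  have hpt : κ.fibre σ x = κ.ψ.symm (κ.coordSection σ x) := hev.self_of_nhds
  refine Prod.ext rfl (Prod.ext rfl (funext fun μ => funext fun A => ?_))
  have key : ∀ (g g' : G) (v v' : EuclideanSpace ℝ (Fin N)), g = g' → v = v' →
      maurerCartan b A g v = maurerCartan b A g' v' := by
    rintro g _ v _ rfl rfl
    rfl
  refine (key _ _ _ _ hpt (congrArg (fun f : EuclideanSpace ℝ (Fin (n + 1)) →L[ℝ]
    EuclideanSpace ℝ (Fin N) => f (EuclideanSpace.single μ (1 : ℝ))) hd)).trans ?_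
  exact (coframe_apply b κ.ψ (κ.coordSection σ x) _ A).symm

variable [LieGroup (𝓡 N) ∞ G]

/-- The representative used by `toJet` is the first-order Taylor polynomial of the section in
coordinates, so it has the same `1`-jet. This connects the abstract Lagrangian with its coordinate
expression. -/
theorem jet_eq_toJet (hU : IsOpen U) {σ : M → E} (hσ : P.IsSectionOn U σ)
    {x : EuclideanSpace ℝ (Fin (n + 1))} (hx : x ∈ κ.sectionDomain U σ) :
    jet IE σ (κ.φ.symm x) = κ.toJet b (κ.jetSection b σ x) := by
  have hy := κ.contDiffAt_coordSection hU hσ hx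
  have hyt : κ.coordSection σ x ∈ κ.ψ.target := κ.ψ.map_source hx.2.2
  have hms : κ.φ.symm x ∈ κ.φ.source := κ.φ.map_target hx.1
  have hmx : κ.φ (κ.φ.symm x) = x := κ.φ.right_inv hx.1
  let f : EuclideanSpace ℝ (Fin (n + 1)) → EuclideanSpace ℝ (Fin N) := fun x' =>
    κ.coordSection σ x + fderiv ℝ (κ.coordSection σ) x (x' - x)
  have hf : HasFDerivAt f (fderiv ℝ (κ.coordSection σ) x) x := by
    have h1 : HasFDerivAt (fun x' => x' - x) (ContinuousLinearMap.id ℝ _) x :=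
      (hasFDerivAt_id x).sub_const x
    exact ((fderiv ℝ (κ.coordSection σ) x).hasFDerivAt.comp x h1).const_add _
  have hfx : f x = κ.coordSection σ x := by simp [f]
  have hto : κ.toJet b (κ.jetSection b σ x) =
      jet IE (fun m => P.act (κ.triv.sec m) (κ.ψ.symm (f (κ.φ m)))) (κ.φ.symm x) := by
    -- The frame undoes the coframe: `T^B_A ξ^A_μ = ∂_μ y^B`.
    have h : ∀ m, (WithLp.toLp 2 fun B => ∑ A, ∑ μ, frameMatrix b κ.ψ (κ.coordSection σ x) B A *
        coframe b κ.ψ (κ.coordSection σ x)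
          (fderiv ℝ (κ.coordSection σ) x (EuclideanSpace.single μ 1)) A * (κ.φ m μ - x μ)) =
        fderiv ℝ (κ.coordSection σ) x (κ.φ m - x) := by
      intro m
      rw [clm_apply_euclideanSpace (fderiv ℝ (κ.coordSection σ) x)]
      ext B
      simp only [frameMatrix_eq]
      rw [Finset.sum_comm]
      simp only [WithLp.ofLp_sum, Finset.sum_apply, PiLp.smul_apply, smul_eq_mul, PiLp.sub_apply]
      refine Finset.sum_congr rfl fun μ _ => ?_
      conv_rhs => rw [← frameMap_coframe b κ.mem_maximalAtlas hyt
        (fderiv ℝ (κ.coordSection σ) x (EuclideanSpace.single μ 1)), frameMap_apply]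
      simp only [WithLp.ofLp_sum, Finset.sum_apply, PiLp.smul_apply, smul_eq_mul, Finset.mul_sum]
      exact Finset.sum_congr rfl fun A _ => by ring
    rw [κ.jetSection_eq_coordJet b hU hσ hx]
    simp only [toJet, coordJet, h, f]
  have hσev : σ =ᶠ[nhds (κ.φ.symm x)]
      fun m => P.act (κ.triv.sec m) (κ.ψ.symm (κ.coordSection σ (κ.φ m))) := by
    have h1 : κ.φ.source ∩ κ.φ ⁻¹' κ.sectionDomain U σ ∈ nhds (κ.φ.symm x) :=
      (κ.φ.isOpen_inter_preimage (κ.isOpen_sectionDomain hU hσ)).mem_nhds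
        ⟨hms, by rw [mem_preimage, hmx]; exact hx⟩
    filter_upwards [h1] with m hm
    have hm2 : m ∈ U := by simpa [κ.φ.left_inv hm.1] using hm.2.2.1
    have hm3 := hm.2.2.2
    simp only [fibre, κ.φ.left_inv hm.1] at hm3
    simp only [coordSection, fibre, κ.φ.left_inv hm.1, κ.ψ.left_inv hm3]
    have h2 := κ.triv.act_sec_fib (σ m) (by rw [hσ.proj_eq m hm2]; exact κ.source_subset hm.1)
    rw [hσ.proj_eq m hm2] at h2
    exact h2.symm
  have hφd : MDifferentiableAt (𝓡 (n + 1)) (𝓡 (n + 1)) κ.φ (κ.φ.symm x) :=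
    (contMDiffAt_chart κ.unimodular.mem_maximalAtlas hms).mdifferentiableAt (by simp)
  -- Stated for a general `h` so that it serves both the section itself and its Taylor polynomial
  -- `f`.
  have key : ∀ h : EuclideanSpace ℝ (Fin (n + 1)) → EuclideanSpace ℝ (Fin N),
      DifferentiableAt ℝ h x → h x = κ.coordSection σ x →
      MDifferentiableAt (𝓡 (n + 1)) (𝓡 N) (fun m => κ.ψ.symm (h (κ.φ m))) (κ.φ.symm x) ∧
      (mfderiv (𝓡 (n + 1)) (𝓡 N) (fun m => κ.ψ.symm (h (κ.φ m))) (κ.φ.symm x) :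
        EuclideanSpace ℝ (Fin (n + 1)) →L[ℝ] EuclideanSpace ℝ (Fin N)) =
      (mfderiv (𝓡 N) (𝓡 N) κ.ψ.symm (κ.coordSection σ x) :
        EuclideanSpace ℝ (Fin N) →L[ℝ] EuclideanSpace ℝ (Fin N)).comp
        ((fderiv ℝ h x).comp (mfderiv (𝓡 (n + 1)) (𝓡 (n + 1)) κ.φ (κ.φ.symm x) :
          EuclideanSpace ℝ (Fin (n + 1)) →L[ℝ] EuclideanSpace ℝ (Fin (n + 1)))) := by
    intro h hh hhx
    have hψd : MDifferentiableAt (𝓡 N) (𝓡 N) κ.ψ.symm (h x) := by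
      rw [hhx]
      exact (contMDiffAt_chart_symm κ.mem_maximalAtlas hyt).mdifferentiableAt (by simp)
    have hhφ : HasMFDerivAt (𝓡 (n + 1)) (𝓡 N) (h ∘ κ.φ) (κ.φ.symm x)
        ((fderiv ℝ h x).comp (mfderiv (𝓡 (n + 1)) (𝓡 (n + 1)) κ.φ (κ.φ.symm x))) := by
      have h1 : HasMFDerivAt (𝓡 (n + 1)) (𝓡 N) h (κ.φ (κ.φ.symm x)) (fderiv ℝ h x) := by
        rw [hmx]
        exact hh.hasFDerivAt.hasMFDerivAt
      exact h1.comp _ hφd.hasMFDerivAt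
    have h2 : HasMFDerivAt (𝓡 N) (𝓡 N) κ.ψ.symm ((h ∘ κ.φ) (κ.φ.symm x))
        (mfderiv (𝓡 N) (𝓡 N) κ.ψ.symm (κ.coordSection σ x) :
          EuclideanSpace ℝ (Fin N) →L[ℝ] EuclideanSpace ℝ (Fin N)) := by
      rw [Function.comp_apply, hmx, hhx]
      rw [hhx] at hψd
      exact hψd.hasMFDerivAt
    have h3 := h2.comp _ hhφ
    exact ⟨h3.mdifferentiableAt, h3.mfderiv⟩
  obtain ⟨k1, k2⟩ := key _ (hy.differentiableAt (by simp)) rfl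
  obtain ⟨k3, k4⟩ := key f hf.differentiableAt hfx
  rw [hto, jet_eq_of_eventuallyEq hσev]
  refine κ.triv.jet_act_sec_congr (κ.source_subset hms) k1 k3 ?_ ?_
  · rw [hmx, hfx]
  · rw [k2, k4, hf.fderiv]

theorem eval_jet (hU : IsOpen U) {σ : M → E} (hσ : P.IsSectionOn U σ) (l : P.jetBundle → ℝ)
    {x : EuclideanSpace ℝ (Fin (n + 1))} (hx : x ∈ κ.sectionDomain U σ) :
    P.eval l (jet IE σ (κ.φ.symm x)) = κ.expr b l (coordJet b κ.ψ (κ.coordSection σ) x) := by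
  rw [κ.jet_eq_toJet b hU hσ hx, κ.jetSection_eq_coordJet b hU hσ hx]
  rfl

end LocalSystem

end Jets

end

end ReducedFieldTheory

namespace ReducedFieldTheory

noncomputable section

/-! ### Euler-Poincaré equations and the pull-back condition -/

section PullbackEquivalence

variable {n N : ℕ}
  {M : Type*} [TopologicalSpace M] [ChartedSpace (EuclideanSpace ℝ (Fin (n + 1))) M]
  {G : Type*} [TopologicalSpace G] [ChartedSpace (EuclideanSpace ℝ (Fin N)) G] [Group G]
  {FE : Type*} [NormedAddCommGroup FE] [NormedSpace ℝ FE] {HE : Type*} [TopologicalSpace HE]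
  {IE : ModelWithCorners ℝ FE HE} {E : Type*} [TopologicalSpace E] [ChartedSpace HE E]
  {P : PrincipalBundle n N M G IE E}
  {vol : ∀ x : M, TangentSpace (𝓡 (n + 1)) x [⋀^Fin (n + 1)]→L[ℝ] ℝ}
  {b : Module.Basis (Fin N) ℝ (GroupLieAlgebra (𝓡 N) G)} {l : P.jetBundle → ℝ}

theorem LocalSystem.isOpen_domain (κ : LocalSystem P vol) : IsOpen κ.domain :=
  κ.φ.open_target.prod (κ.ψ.open_target.prod isOpen_univ)

theorem IsSmoothLagrangian.contDiffAt (hl : IsSmoothLagrangian P vol b l)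
    (κ : LocalSystem P vol) {z : JetCoord n N} (hz : z ∈ κ.domain) :
    ContDiffAt ℝ 2 (κ.expr b l) z :=
  ((hl κ).contDiffAt (κ.isOpen_domain.mem_nhds hz)).of_le ENat.LEInfty.out

theorem LocalSystem.coordJet_mem_domain (κ : LocalSystem P vol) {U : Set M} {σ : M → E}
    {x : EuclideanSpace ℝ (Fin (n + 1))} (hx : x ∈ κ.sectionDomain U σ) :
    coordJet b κ.ψ (κ.coordSection σ) x ∈ κ.domain :=
  ⟨hx.1, κ.ψ.map_source hx.2.2, mem_univ _⟩

variable {U : Set M} {σ : M → E}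

theorem LocalSystem.eventually_jetSection_eq (κ : LocalSystem P vol) (hU : IsOpen U)
    (hσ : P.IsSectionOn U σ) {x : EuclideanSpace ℝ (Fin (n + 1))}
    (hx : x ∈ κ.sectionDomain U σ) :
    κ.jetSection b σ =ᶠ[nhds x] coordJet b κ.ψ (κ.coordSection σ) := by
  filter_upwards [(κ.isOpen_sectionDomain hU hσ).mem_nhds hx] with x' hx'
  exact κ.jetSection_eq_coordJet b hU hσ hx'

theorem eulerPoincare_eq (κ : LocalSystem P vol) (hU : IsOpen U) (hσ : P.IsSectionOn U σ)
    {x : EuclideanSpace ℝ (Fin (n + 1))} (hx : x ∈ κ.sectionDomain U σ) (A : Fin N) :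
    eulerPoincare κ b l σ x A =
      coordEulerPoincare b κ.ψ (κ.expr b l) (κ.coordSection σ) x A := by
  have hev := κ.eventually_jetSection_eq (b := b) hU hσ hx
  unfold eulerPoincare coordEulerPoincare force
  rw [sub_sub, hev.self_of_nhds]
  congr 1
  refine Finset.sum_congr rfl fun μ _ => ?_
  have h : (fun x' => fderiv ℝ (κ.expr b l) (κ.jetSection b σ x') (vecXi μ A)) =ᶠ[nhds x]
      fun x' => fderiv ℝ (κ.expr b l) (coordJet b κ.ψ (κ.coordSection σ) x') (vecXi μ A) :=
    hev.mono fun x' hx' => congrArg (fun z => fderiv ℝ (κ.expr b l) z (vecXi μ A)) hx'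
  rw [h.fderiv_eq]

theorem PullbackVanishes.compact (h : PullbackVanishes P vol b l U σ) :
    PullbackVanishesCompact P vol b l U σ :=
  fun κ W hW _ _ => h κ W hW.contDiffOn

variable [LieGroup (𝓡 N) ∞ G]

theorem pullbackContraction_apply_single (hl : IsSmoothLagrangian P vol b l)
    (κ : LocalSystem P vol) (hU : IsOpen U) (hσ : P.IsSectionOn U σ)
    (W : JetCoord n N → JetCoord n N) {x : EuclideanSpace ℝ (Fin (n + 1))}
    (hx : x ∈ κ.sectionDomain U σ) :
    pullbackContraction κ b l σ W x (fun μ => EuclideanSpace.single μ 1) =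
      ∑ A, coframe b κ.ψ (κ.coordSection σ x)
        ((W (κ.jetSection b σ x)).2.1 -
          fderiv ℝ (κ.coordSection σ) x (W (κ.jetSection b σ x)).1) A *
        eulerPoincare κ b l σ x A := by
  have hev := κ.eventually_jetSection_eq (b := b) hU hσ hx
  simp only [eulerPoincare_eq κ hU hσ hx]
  rw [← curryLeft_neg_extDeriv_apply b κ.mem_maximalAtlas
    ((κ.contDiffAt_coordSection hU hσ hx).of_le ENat.LEInfty.out) (κ.ψ.map_source hx.2.2)
    (hl.contDiffAt κ (κ.coordJet_mem_domain hx)) (W (κ.jetSection b σ x)), ← hev.fderiv_eq,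
    ← hev.self_of_nhds]
  rfl

/-- Forms of degree `m` on `ℝ^m` are multiples of the determinant. -/
theorem alternating_eq_zero_of_apply_single {m : ℕ}
    {f : EuclideanSpace ℝ (Fin m) [⋀^Fin m]→L[ℝ] ℝ}
    (h : f (fun μ => EuclideanSpace.single μ 1) = 0) : f = 0 := by
  have h1 := f.toAlternatingMap.eq_smul_basis_det (EuclideanSpace.basisFun (Fin m) ℝ).toBasis
  have h2 : (⇑(EuclideanSpace.basisFun (Fin m) ℝ).toBasis) =
      fun i => EuclideanSpace.single i (1 : ℝ) := by
    ext i
    simp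
  have h3 : f.toAlternatingMap (EuclideanSpace.basisFun (Fin m) ℝ).toBasis = 0 := by
    rw [h2]
    exact h
  rw [h3, zero_smul] at h1
  exact ContinuousAlternatingMap.toAlternatingMap_injective h1

theorem SatisfiesEulerPoincare.pullbackVanishes (hl : IsSmoothLagrangian P vol b l)
    (hU : IsOpen U) (hσ : P.IsSectionOn U σ) (h : SatisfiesEulerPoincare P vol b l U σ) :
    PullbackVanishes P vol b l U σ := by
  intro κ W _ x hx
  refine alternating_eq_zero_of_apply_single ?_
  rw [pullbackContraction_apply_single hl κ hU hσ W hx]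
  exact Finset.sum_eq_zero fun A _ => by rw [h κ x hx A, mul_zero]

theorem PullbackVanishesCompact.satisfiesEulerPoincare (hl : IsSmoothLagrangian P vol b l)
    (hU : IsOpen U) (hσ : P.IsSectionOn U σ) (h : PullbackVanishesCompact P vol b l U σ) :
    SatisfiesEulerPoincare P vol b l U σ := by
  intro κ x hx A
  have hmem : κ.jetSection b σ x ∈ κ.domain := by
    rw [κ.jetSection_eq_coordJet b hU hσ hx]
    exact κ.coordJet_mem_domain hx
  obtain ⟨f, hf1, hf2, hf3, _, hf5⟩ :=
    exists_contDiff_tsupport_subset (n := ⊤) (κ.isOpen_domain.mem_nhds hmem)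
  -- The test field is the constant vector `e_A(y(x))`, cut off by a bump function equal to `1` at
  -- the jet; its pairing with the equations is exactly component `A`.
  let w : JetCoord n N := (0, frame κ.ψ (b A) (κ.coordSection σ x), 0)
  have h1 := h κ (fun z => f z • w) (hf3.smul contDiff_const) hf2.smul_right
    ((tsupport_smul_subset_left f _).trans hf1) x hx
  have h2 := pullbackContraction_apply_single hl κ hU hσ (fun z => f z • w) hx
  rw [h1, hf5, one_smul] at h2
  have hc : coframe b κ.ψ (κ.coordSection σ x) (frame κ.ψ (b A) (κ.coordSection σ x)) =
      b.repr (b A) := coframe_frame b κ.mem_maximalAtlas (κ.ψ.map_source hx.2.2) (b A)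
  simp only [w, map_zero, sub_zero, hc, Module.Basis.repr_self] at h2
  simpa [Finsupp.single_apply] using h2.symm

end PullbackEquivalence

end

end ReducedFieldTheory

namespace ReducedFieldTheory

noncomputable section

/-! ### The derivative of the action along a family of sections -/

section ActionDerivative

variable {n N : ℕ}
  {M : Type*} [TopologicalSpace M] [ChartedSpace (EuclideanSpace ℝ (Fin (n + 1))) M]
  {G : Type*} [TopologicalSpace G] [ChartedSpace (EuclideanSpace ℝ (Fin N)) G] [Group G]
  {FE : Type*} [NormedAddCommGroup FE] [NormedSpace ℝ FE] {HE : Type*} [TopologicalSpace HE]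
  {IE : ModelWithCorners ℝ FE HE} {E : Type*} [TopologicalSpace E] [ChartedSpace HE E]
  {P : PrincipalBundle n N M G IE E}
  {vol : ∀ x : M, TangentSpace (𝓡 (n + 1)) x [⋀^Fin (n + 1)]→L[ℝ] ℝ}
  {b : Module.Basis (Fin N) ℝ (GroupLieAlgebra (𝓡 N) G)} {l : P.jetBundle → ℝ}

theorem IsUnimodularChart.restr {φ : OpenPartialHomeomorph M (EuclideanSpace ℝ (Fin (n + 1)))}
    (hφ : IsUnimodularChart vol φ) {s : Set M} (hs : IsOpen s) :
    IsUnimodularChart vol (φ.restr s) :=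
  ⟨restr_mem_maximalAtlas _ hφ.mem_maximalAtlas hs,
    fun x hx => hφ.form_eq x (by rw [φ.restr_source' s hs] at hx; exact hx.1)⟩

/-- The domain in `M` on which a local system describes the section `σ` over `U`. -/
def LocalSystem.sectionSource (κ : LocalSystem P vol) (U : Set M) (σ : M → E) : Set M :=
  κ.φ.source ∩ κ.φ ⁻¹' κ.sectionDomain U σ

theorem LocalSystem.mem_sectionSource (κ : LocalSystem P vol) {U : Set M} {σ : M → E} {m : M} :
    m ∈ κ.sectionSource U σ ↔ m ∈ κ.φ.source ∧ m ∈ U ∧ κ.triv.fib (σ m) ∈ κ.ψ.source := by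
  refine and_congr_right fun hm => ?_
  simp only [mem_preimage, sectionDomain, fibre, mem_ofPred_eq, κ.φ.left_inv hm, κ.φ.map_source hm,
    true_and]

theorem LocalSystem.isOpen_sectionSource (κ : LocalSystem P vol) {U : Set M} (hU : IsOpen U)
    {σ : M → E} (hσ : P.IsSectionOn U σ) : IsOpen (κ.sectionSource U σ) :=
  κ.φ.isOpen_inter_preimage (κ.isOpen_sectionDomain hU hσ)

variable {U : Set M} {σε : ℝ → M → E}

theorem LocalSystem.familyJet_mem_domain (κ : LocalSystem P vol)
    {q : ℝ × EuclideanSpace ℝ (Fin (n + 1))}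
    (hq : q ∈ κ.familyDomain U σε) : familyJet b κ.ψ (κ.coordFamily σε) q ∈ κ.domain :=
  ⟨hq.1, κ.ψ.map_source hq.2.2, mem_univ _⟩

theorem LocalSystem.continuousAt_prodMap (κ : LocalSystem P vol) {q : ℝ × M}
    (hq : q.2 ∈ κ.φ.source) : ContinuousAt (fun q' : ℝ × M => (q'.1, κ.φ q'.2)) q :=
  continuousAt_fst.prodMk (ContinuousAt.comp (κ.φ.continuousAt hq) continuousAt_snd)

theorem LocalSystem.eventually_mem_sectionSource (κ : LocalSystem P vol) (hU : IsOpen U)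
    (hσ : IsSectionFamily P U σε) {q : ℝ × M}
    (hq : q.2 ∈ κ.sectionSource U (σε q.1)) :
    ∀ᶠ q' in nhds q, q'.2 ∈ κ.sectionSource U (σε q'.1) := by
  filter_upwards [κ.continuousAt_prodMap hq.1 ((κ.isOpen_familyDomain hU hσ).mem_nhds hq.2),
    continuousAt_snd (κ.φ.open_source.mem_nhds hq.1)] with q' h2 h3
  exact ⟨h3, h2⟩

/-- The derivative of the Lagrangian along a family of sections. -/
def firstVariation (P : PrincipalBundle n N M G IE E) (l : P.jetBundle → ℝ) (σε : ℝ → M → E)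
    (q : ℝ × M) : ℝ :=
  deriv (fun ε => P.eval l (jet IE (σε ε) q.2)) q.1

/-- Jets require agreement near the point, not just at it; `U \ K` is open because `K` is closed. -/
theorem firstVariation_eq_zero {K : Set M} (hU : IsOpen U) (hK : IsClosed K)
    (h : ∀ ε, ∀ m ∈ U \ K, σε ε m = σε 0 m) {ε : ℝ} {m : M} (hm : m ∈ U \ K) :
    firstVariation P l σε (ε, m) = 0 := by
  have h1 : (fun ε => P.eval l (jet IE (σε ε) m)) = fun _ => P.eval l (jet IE (σε 0) m) := by
    funext ε'
    refine congrArg _ (jet_eq_of_eventuallyEq ?_)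
    filter_upwards [(hU.sdiff hK).mem_nhds hm] with m' hm'
    exact h ε' m' hm'
  simp only [firstVariation, h1, deriv_const]

variable [LieGroup (𝓡 N) ∞ G]

/-- A unimodular chart is shrunk to the trivialising open set, which keeps it unimodular, and the
chart of `G` is taken at the value of the section. -/
theorem exists_localSystem (hvol : IsVolumeForm vol) (P : PrincipalBundle n N M G IE E) {m : M}
    (hm : m ∈ U) (σ : M → E) : ∃ κ : LocalSystem P vol, m ∈ κ.sectionSource U σ := by
  obtain ⟨φ, hφ, hmφ⟩ := hvol m
  obtain ⟨τ, hτ⟩ := P.locally_trivial m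
  have : IsManifold (𝓡 N) ∞ G := inferInstance
  refine ⟨⟨φ.restr τ.U, chartAt _ (τ.fib (σ m)), τ, hφ.restr τ.isOpen_U,
    IsManifold.chart_mem_maximalAtlas _, ?_⟩, ?_⟩
  · rw [φ.restr_source' _ τ.isOpen_U]
    exact inter_subset_right
  · rw [LocalSystem.mem_sectionSource]
    refine ⟨?_, hm, mem_chart_source _ _⟩
    change m ∈ (φ.restr τ.U).source
    rw [φ.restr_source' _ τ.isOpen_U]
    exact ⟨hmφ, hτ⟩

/-- The Lagrangian along a family of sections, in coordinates. -/
def LocalSystem.familyExpr (κ : LocalSystem P vol)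
    (b : Module.Basis (Fin N) ℝ (GroupLieAlgebra (𝓡 N) G)) (l : P.jetBundle → ℝ)
    (σε : ℝ → M → E) (q : ℝ × EuclideanSpace ℝ (Fin (n + 1))) : ℝ :=
  κ.expr b l (familyJet b κ.ψ (κ.coordFamily σε) q)

namespace LocalSystem

variable (κ : LocalSystem P vol)

theorem contDiffAt_familyExpr (hl : IsSmoothLagrangian P vol b l) (hU : IsOpen U)
    (hσ : IsSectionFamily P U σε) {q : ℝ × EuclideanSpace ℝ (Fin (n + 1))}
    (hq : q ∈ κ.familyDomain U σε) : ContDiffAt ℝ 2 (κ.familyExpr b l σε) q :=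
  (hl.contDiffAt κ (κ.familyJet_mem_domain hq)).comp q
    (contDiffAt_familyJet b κ.mem_maximalAtlas
      ((κ.contDiffAt_coordFamily hU hσ hq).of_le ENat.LEInfty.out) (κ.ψ.map_source hq.2.2))

theorem eval_jet_family (hU : IsOpen U) (hσ : IsSectionFamily P U σε) {ε : ℝ} {m : M}
    (hm : m ∈ κ.sectionSource U (σε ε)) :
    P.eval l (jet IE (σε ε) m) = κ.familyExpr b l σε (ε, κ.φ m) := by
  have h := κ.eval_jet b hU (hσ.isSectionOn ε) l hm.2
  rw [κ.φ.left_inv hm.1] at h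
  rw [h, familyExpr, ← coordJet_slice b κ.ψ
    ((κ.contDiffAt_coordFamily (q := (ε, κ.φ m)) hU hσ hm.2).differentiableAt (by simp))]
  rfl

theorem hasDerivAt_eval_jet (hl : IsSmoothLagrangian P vol b l) (hU : IsOpen U)
    (hσ : IsSectionFamily P U σε) {ε : ℝ} {m : M} (hm : m ∈ κ.sectionSource U (σε ε)) :
    HasDerivAt (fun ε => P.eval l (jet IE (σε ε) m))
      (fderiv ℝ (κ.familyExpr b l σε) (ε, κ.φ m) (1, 0)) ε := by
  have hline : HasDerivAt (fun ε : ℝ => (ε, κ.φ m))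
      ((1 : ℝ), (0 : EuclideanSpace ℝ (Fin (n + 1)))) ε :=
    (hasDerivAt_id ε).prodMk (hasDerivAt_const ε _)
  have h := HasFDerivAt.comp_hasDerivAt (l := κ.familyExpr b l σε) ε
    ((κ.contDiffAt_familyExpr hl hU hσ hm.2).differentiableAt (by simp)).hasFDerivAt hline
  refine h.congr_of_eventuallyEq ?_
  filter_upwards [(Continuous.prodMk_left m).continuousAt.eventually
    (κ.eventually_mem_sectionSource (q := (ε, m)) hU hσ hm)] with ε' hε'
  exact κ.eval_jet_family hU hσ hε'

end LocalSystem

theorem firstVariation_eq (hl : IsSmoothLagrangian P vol b l) (hU : IsOpen U)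
    (hσ : IsSectionFamily P U σε) (κ : LocalSystem P vol) {ε : ℝ} {m : M}
    (hm : m ∈ κ.sectionSource U (σε ε)) :
    firstVariation P l σε (ε, m) = fderiv ℝ (κ.familyExpr b l σε) (ε, κ.φ m) (1, 0) :=
  (κ.hasDerivAt_eval_jet hl hU hσ hm).deriv

theorem hasDerivAt_firstVariation (hvol : IsVolumeForm vol) (hl : IsSmoothLagrangian P vol b l)
    (hU : IsOpen U) (hσ : IsSectionFamily P U σε) {ε : ℝ} {m : M} (hm : m ∈ U) :
    HasDerivAt (fun ε => P.eval l (jet IE (σε ε) m)) (firstVariation P l σε (ε, m)) ε := by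
  obtain ⟨κ, hκ⟩ := exists_localSystem hvol P hm (σε ε)
  rw [firstVariation_eq hl hU hσ κ hκ]
  exact κ.hasDerivAt_eval_jet hl hU hσ hκ

theorem continuousOn_eval_jet (hvol : IsVolumeForm vol) (hl : IsSmoothLagrangian P vol b l)
    (hU : IsOpen U) (hσ : IsSectionFamily P U σε) (ε : ℝ) :
    ContinuousOn (fun m => P.eval l (jet IE (σε ε) m)) U := by
  intro m hm
  obtain ⟨κ, hκ⟩ := exists_localSystem hvol P hm (σε ε)
  have h1 : ContinuousAt (fun m' => κ.familyExpr b l σε (ε, κ.φ m')) m :=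
    ContinuousAt.comp (f := fun m' => (ε, κ.φ m'))
      (κ.contDiffAt_familyExpr hl hU hσ hκ.2).continuousAt
      (continuousAt_const.prodMk (κ.φ.continuousAt hκ.1))
  refine (h1.congr ?_).continuousWithinAt
  filter_upwards [(κ.isOpen_sectionSource hU (hσ.isSectionOn ε)).mem_nhds hκ] with m' hm'
  exact (κ.eval_jet_family hU hσ hm').symm

theorem continuousOn_firstVariation (hvol : IsVolumeForm vol)
    (hl : IsSmoothLagrangian P vol b l) (hU : IsOpen U) (hσ : IsSectionFamily P U σε) :
    ContinuousOn (firstVariation P l σε) (univ ×ˢ U) := by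
  intro q hq
  obtain ⟨κ, hκ⟩ := exists_localSystem hvol P hq.2 (σε q.1)
  have h1 : ContinuousAt (fun q' : ℝ × M =>
      fderiv ℝ (κ.familyExpr b l σε) (q'.1, κ.φ q'.2) (1, 0)) q :=
    ContinuousAt.comp (f := fun q' : ℝ × M => (q'.1, κ.φ q'.2))
      (((κ.contDiffAt_familyExpr hl hU hσ hκ.2).fderiv_right (m := 1)
        (by norm_num)).clm_apply contDiffAt_const).continuousAt
      (κ.continuousAt_prodMap hκ.1)
  refine (h1.congr ?_).continuousWithinAt
  filter_upwards [κ.eventually_mem_sectionSource hU hσ hκ] with q' hq'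
  exact (firstVariation_eq hl hU hσ κ hq').symm

/-- Differentiation under the integral: the first variation is continuous, hence bounded on the
compact set `[-1, 1] × K`, and `K` has finite measure. -/
theorem hasDerivAt_action [T2Space M] [MeasurableSpace M] [BorelSpace M]
    (hvol : IsVolumeForm vol) (hl : IsSmoothLagrangian P vol b l) (hU : IsOpen U)
    (hσ : IsSectionFamily P U σε) {K : Set M} (hK : IsCompact K) (hKU : K ⊆ U) :
    HasDerivAt (fun ε => ∫ m in K, P.eval l (jet IE (σε ε) m) ∂volumeMeasure vol)
      (∫ m in K, firstVariation P l σε (0, m) ∂volumeMeasure vol) 0 := by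
  have := isFiniteMeasureOnCompacts_volumeMeasure hvol
  have hKm := hK.measurableSet
  have hfv := continuousOn_firstVariation hvol hl hU hσ
  have hfv0 : ContinuousOn (fun m => firstVariation P l σε (0, m)) K :=
    hfv.comp (by fun_prop) fun m hm => ⟨mem_univ _, hKU hm⟩
  obtain ⟨C, hC⟩ := ((isCompact_Icc (a := (-1 : ℝ)) (b := 1)).prod hK).exists_bound_of_continuousOn
    (hfv.mono (prod_mono (subset_univ _) hKU))
  have hIcc : Icc (-1 : ℝ) 1 ∈ nhds (0 : ℝ) := Icc_mem_nhds (by norm_num) (by norm_num)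
  refine (hasDerivAt_integral_of_dominated_loc_of_deriv_le (bound := fun _ => C)
    (F' := fun ε m => firstVariation P l σε (ε, m)) hIcc ?_ ?_ ?_ ?_ ?_ ?_).2
  · exact Filter.Eventually.of_forall fun ε =>
      ((continuousOn_eval_jet hvol hl hU hσ ε).mono hKU).aestronglyMeasurable hKm
  · exact ((continuousOn_eval_jet hvol hl hU hσ 0).mono hKU).integrableOn_compact hK
  · exact hfv0.aestronglyMeasurable hKm
  · refine (ae_restrict_iff' hKm).2 (Filter.Eventually.of_forall fun m hm ε hε => ?_)
    exact hC (ε, m) ⟨hε, hm⟩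
  · exact integrableOn_const hK.measure_lt_top.ne
  · refine (ae_restrict_iff' hKm).2 (Filter.Eventually.of_forall fun m hm ε _ => ?_)
    exact hasDerivAt_firstVariation hvol hl hU hσ (hKU hm)

/-- The derivative of the action always exists, so stationarity only requires its value to vanish.
-/
theorem isStationary_iff [T2Space M] [MeasurableSpace M] [BorelSpace M]
    (hvol : IsVolumeForm vol) (hl : IsSmoothLagrangian P vol b l) (hU : IsOpen U) {σ : M → E} :
    IsStationary P vol l U σ ↔ ∀ K : Set M, IsCompact K → K ⊆ U → ∀ σε : ℝ → M → E,
      IsVariation P U K σ σε → ∫ m in K, firstVariation P l σε (0, m) ∂volumeMeasure vol = 0 := by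
  refine forall₅_congr fun K hK hKU σε hσ => ?_
  have h := hasDerivAt_action hvol hl hU hσ.isSectionFamily hK hKU
  exact ⟨fun h0 => h.unique h0, fun h0 => by rwa [h0] at h⟩

end ActionDerivative

end

end ReducedFieldTheory

namespace ReducedFieldTheory

noncomputable section

/-! ### The first variation of the action in a local system -/

/-- `J` is controlled only on `D`, but it vanishes there off `K`, so its extension by zero is `C¹`
with compact support and its derivative integrates to zero. No regularity of the boundary of `K` is
needed. -/
theorem setIntegral_fderiv_eq_zero {k : ℕ} {D K : Set (EuclideanSpace ℝ (Fin k))} (hD : IsOpen D)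
    (hK : IsCompact K) (hKD : K ⊆ D) {J : EuclideanSpace ℝ (Fin k) → ℝ}
    (hJ : ∀ x ∈ D, ContDiffAt ℝ 1 J x) (hJ0 : ∀ x ∈ D \ K, J x = 0)
    (v : EuclideanSpace ℝ (Fin k)) :
    IntegrableOn (fun x => fderiv ℝ J x v) K ∧ ∫ x in K, fderiv ℝ J x v = 0 := by
  have hev : ∀ x ∈ D, D.indicator J =ᶠ[nhds x] J := fun x hx => by
    filter_upwards [hD.mem_nhds hx] with x' hx'
    exact indicator_of_mem hx' J
  have hzero : ∀ x ∉ K, D.indicator J x = 0 := fun x hx => by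
    by_cases hxD : x ∈ D
    · rw [indicator_of_mem hxD, hJ0 x ⟨hxD, hx⟩]
    · exact indicator_of_notMem hxD J
  have hsmooth : ContDiff ℝ 1 (D.indicator J) := contDiff_iff_contDiffAt.2 fun x => by
    by_cases hx : x ∈ D
    · exact (hJ x hx).congr_of_eventuallyEq (hev x hx)
    · refine (contDiffAt_const (c := (0 : ℝ))).congr_of_eventuallyEq ?_
      filter_upwards [hK.isClosed.isOpen_compl.mem_nhds fun h => hx (hKD h)] with x' hx'
      exact hzero x' hx'
  have hsupp : HasCompactSupport (D.indicator J) := HasCompactSupport.intro hK hzero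
  have hcont : Continuous fun x => fderiv ℝ (D.indicator J) x v :=
    (hsmooth.continuous_fderiv one_ne_zero).clm_apply continuous_const
  have hint : Integrable fun x => fderiv ℝ (D.indicator J) x v :=
    hcont.integrable_of_hasCompactSupport (hsupp.fderiv_apply ℝ v)
  have h0 : ∫ x, fderiv ℝ (D.indicator J) x v = 0 := by
    -- Integration by parts against the constant function `1`.
    have h := integral_mul_fderiv_eq_neg_fderiv_mul_of_integrable (μ := volume) (v := v)
      (f := fun _ : EuclideanSpace ℝ (Fin k) => (1 : ℝ)) (g := D.indicator J) (by simp)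
      (by simpa using hint)
      (by simpa using hsmooth.continuous.integrable_of_hasCompactSupport hsupp)
      (by simp) fun x _ => hsmooth.differentiable one_ne_zero x
    simpa using h
  have hcongr : EqOn (fun x => fderiv ℝ (D.indicator J) x v) (fun x => fderiv ℝ J x v) K :=
    fun x hx => by simp only [(hev x (hKD hx)).fderiv_eq]
  refine ⟨(integrableOn_congr_fun hcongr hK.measurableSet).1 hint.integrableOn, ?_⟩
  rw [← setIntegral_congr_fun hK.measurableSet hcongr,
    setIntegral_eq_integral_of_forall_compl_eq_zero, h0]
  intro x hx
  have h1 : D.indicator J =ᶠ[nhds x] fun _ => 0 := by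
    filter_upwards [hK.isClosed.isOpen_compl.mem_nhds hx] with x' hx'
    exact hzero x' hx'
  simp [h1.fderiv_eq]

section LocalIntegral

variable {n N : ℕ}
  {M : Type*} [TopologicalSpace M] [ChartedSpace (EuclideanSpace ℝ (Fin (n + 1))) M]
  {G : Type*} [TopologicalSpace G] [ChartedSpace (EuclideanSpace ℝ (Fin N)) G] [Group G]
  {FE : Type*} [NormedAddCommGroup FE] [NormedSpace ℝ FE] {HE : Type*} [TopologicalSpace HE]
  {IE : ModelWithCorners ℝ FE HE} {E : Type*} [TopologicalSpace E] [ChartedSpace HE E]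
  {P : PrincipalBundle n N M G IE E}
  {vol : ∀ x : M, TangentSpace (𝓡 (n + 1)) x [⋀^Fin (n + 1)]→L[ℝ] ℝ}
  {b : Module.Basis (Fin N) ℝ (GroupLieAlgebra (𝓡 N) G)} {l : P.jetBundle → ℝ}

/-- Integrals over compact subsets of the domain of a unimodular chart. -/
theorem setIntegral_compact_eq [T2Space M] [MeasurableSpace M] [BorelSpace M]
    {φ : OpenPartialHomeomorph M (EuclideanSpace ℝ (Fin (n + 1)))}
    (hφ : IsUnimodularChart vol φ) {K : Set M} (hK : IsCompact K) (hKs : K ⊆ φ.source)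
    {F : M → ℝ} (hF : ContinuousOn F K) :
    ∫ m in K, F m ∂volumeMeasure vol = ∫ x in φ '' K, F (φ.symm x) := by
  have haem : AEMeasurable φ.symm (volume.restrict φ.target) :=
    φ.continuousOn_symm.aemeasurable φ.open_target.measurableSet
  have hKm := hK.measurableSet
  have himg : MeasurableSet (φ '' K) :=
    (hK.image_of_continuousOn (φ.continuousOn.mono hKs)).measurableSet
  have hm : AEStronglyMeasurable (K.indicator F) ((volumeMeasure vol).restrict φ.source) := by
    rw [aestronglyMeasurable_indicator_iff hKm, Measure.restrict_restrict hKm,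
      inter_eq_self_of_subset_left hKs]
    exact hF.aestronglyMeasurable hKm
  have h1 : ∫ m in K, F m ∂volumeMeasure vol =
      ∫ m in φ.source, K.indicator F m ∂volumeMeasure vol := by
    rw [setIntegral_indicator hKm, inter_eq_self_of_subset_right hKs]
  rw [volumeMeasure_restrict_source hφ] at hm h1
  rw [h1, integral_map haem hm]
  have h2 : ∀ x ∈ φ.target, K.indicator F (φ.symm x) =
      (φ '' K).indicator (fun x => F (φ.symm x)) x := by
    intro x hx
    have h3 : x ∈ φ '' K ↔ φ.symm x ∈ K := by
      rw [φ.image_eq_target_inter_inv_preimage hKs]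
      exact ⟨fun h => h.2, fun h => ⟨hx, h⟩⟩
    by_cases h : φ.symm x ∈ K
    · rw [indicator_of_mem h, indicator_of_mem (h3.2 h)]
    · rw [indicator_of_notMem h, indicator_of_notMem (mt h3.1 h)]
  rw [setIntegral_congr_fun φ.open_target.measurableSet h2, setIntegral_indicator himg,
    inter_eq_self_of_subset_right]
  rintro _ ⟨m, hm, rfl⟩
  exact φ.map_source (hKs hm)

theorem fderiv_apply_time {F : Type*} [NormedAddCommGroup F] [NormedSpace ℝ F]
    {y : ℝ × EuclideanSpace ℝ (Fin (n + 1)) → F} {ε : ℝ} {x : EuclideanSpace ℝ (Fin (n + 1))}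
    (hy : DifferentiableAt ℝ y (ε, x)) :
    HasDerivAt (fun ε => y (ε, x)) (fderiv ℝ y (ε, x) (1, 0)) ε :=
  HasFDerivAt.comp_hasDerivAt (l := y) ε hy.hasFDerivAt
    ((hasDerivAt_id ε).prodMk (hasDerivAt_const ε x))

namespace LocalSystem

variable (κ : LocalSystem P vol) {U : Set M} {σε : ℝ → M → E}

theorem variationField_eq_zero (hU : IsOpen U) (hσ : IsSectionFamily P U σε)
    {x : EuclideanSpace ℝ (Fin (n + 1))} (hx : x ∈ κ.sectionDomain U (σε 0))
    (h : ∀ ε, σε ε (κ.φ.symm x) = σε 0 (κ.φ.symm x)) :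
    variationField b κ.ψ (κ.coordFamily σε) x = 0 := by
  have h1 := fderiv_apply_time
    ((κ.contDiffAt_coordFamily (q := (0, x)) hU hσ hx).differentiableAt (by simp))
  have h2 : (fun ε => κ.coordFamily σε (ε, x)) = fun _ => κ.coordFamily σε (0, x) := by
    funext ε
    simp only [coordFamily, fibre, h ε]
  rw [h2] at h1
  rw [variationField, h1.unique (hasDerivAt_const 0 _), map_zero]

/-- The components `J^μ = ∂l/∂ξ^A_μ η^A` of the boundary term of the first variation. -/
def boundaryTerm (b : Module.Basis (Fin N) ℝ (GroupLieAlgebra (𝓡 N) G)) (l : P.jetBundle → ℝ)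
    (σ : M → E) (η : EuclideanSpace ℝ (Fin (n + 1)) → Fin N → ℝ) (μ : Fin (n + 1))
    (x : EuclideanSpace ℝ (Fin (n + 1))) : ℝ :=
  ∑ A, fderiv ℝ (κ.expr b l) (coordJet b κ.ψ (κ.coordSection σ) x) (vecXi μ A) * η x A

variable [LieGroup (𝓡 N) ∞ G]

theorem contDiffAt_boundaryTerm (hl : IsSmoothLagrangian P vol b l) (hU : IsOpen U) {σ : M → E}
    (hσ : P.IsSectionOn U σ) {x : EuclideanSpace ℝ (Fin (n + 1))}
    (hx : x ∈ κ.sectionDomain U σ) {η : EuclideanSpace ℝ (Fin (n + 1)) → Fin N → ℝ}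
    (hη : ContDiffAt ℝ 1 η x) (μ : Fin (n + 1)) :
    ContDiffAt ℝ 1 (κ.boundaryTerm b l σ η μ) x := by
  have hy : ContDiffAt ℝ 3 (κ.coordFamily fun _ => σ) (0, x) :=
    (κ.contDiffAt_coordFamily hU hσ.isSectionFamily hx).of_le ENat.LEInfty.out
  have hp := fun A => contDiffAt_momentum_slice b κ.mem_maximalAtlas hy (κ.ψ.map_source hx.2.2)
    (hl.contDiffAt κ (κ.familyJet_mem_domain hx)) (vecXi μ A)
  exact ContDiffAt.sum fun A _ => (hp A).mul (contDiffAt_pi.1 hη A)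

theorem contDiffAt_variationField_coordFamily (hU : IsOpen U) (hσ : IsSectionFamily P U σε)
    {x : EuclideanSpace ℝ (Fin (n + 1))} (hx : x ∈ κ.sectionDomain U (σε 0)) :
    ContDiffAt ℝ 1 (variationField b κ.ψ (κ.coordFamily σε)) x :=
  (contDiffAt_variationField b κ.mem_maximalAtlas
    ((κ.contDiffAt_coordFamily (q := (0, x)) hU hσ hx).of_le ENat.LEInfty.out)
    (κ.ψ.map_source hx.2.2)).of_le (by norm_num)

/-- The first variation is a divergence minus the pairing of the variation with the
Euler-Poincaré expression. -/
theorem firstVariation_eq_divergence (hl : IsSmoothLagrangian P vol b l) (hU : IsOpen U)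
    (hσ : IsSectionFamily P U σε) {m : M} (hm : m ∈ κ.sectionSource U (σε 0)) :
    firstVariation P l σε (0, m) =
      (∑ μ, fderiv ℝ (κ.boundaryTerm b l (σε 0)
        (variationField b κ.ψ (κ.coordFamily σε)) μ) (κ.φ m) (EuclideanSpace.single μ 1)) -
      ∑ A, variationField b κ.ψ (κ.coordFamily σε) (κ.φ m) A *
        eulerPoincare κ b l (σε 0) (κ.φ m) A := by
  have hy : ContDiffAt ℝ 3 (κ.coordFamily σε) (0, κ.φ m) :=
    (κ.contDiffAt_coordFamily hU hσ hm.2).of_le ENat.LEInfty.out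
  have hyt : κ.coordFamily σε (0, κ.φ m) ∈ κ.ψ.target := κ.ψ.map_source hm.2.2.2
  have hL := hl.contDiffAt κ (κ.familyJet_mem_domain (b := b) (q := (0, κ.φ m)) hm.2)
  have h1 := fderiv_apply_time
    ((κ.contDiffAt_familyExpr (q := (0, κ.φ m)) hl hU hσ hm.2).differentiableAt (by simp))
  rw [firstVariation_eq hl hU hσ κ hm,
    h1.unique (hasDerivAt_familyJet b κ.mem_maximalAtlas hy hyt hL),
    fderiv_lagrangian b κ.mem_maximalAtlas hy hyt hL]
  simp only [eulerPoincare_eq κ hU (hσ.isSectionOn 0) hm.2]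
  rfl

/-- The first variation of the action, for a variation supported in a local system. -/
theorem integral_firstVariation_eq [T2Space M] [MeasurableSpace M] [BorelSpace M]
    (hvol : IsVolumeForm vol) (hl : IsSmoothLagrangian P vol b l) (hU : IsOpen U)
    (hσ : IsSectionFamily P U σε) {K : Set M} (hK : IsCompact K)
    (hKs : K ⊆ κ.sectionSource U (σε 0)) (hoff : ∀ ε, ∀ m ∈ U \ K, σε ε m = σε 0 m) :
    ∫ m in K, firstVariation P l σε (0, m) ∂volumeMeasure vol =
      -∫ x in κ.φ '' K, ∑ A, variationField b κ.ψ (κ.coordFamily σε) x A *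
        eulerPoincare κ b l (σε 0) x A := by
  have hKsrc : K ⊆ κ.φ.source := fun m hm => (hKs hm).1
  have hfv : ContinuousOn (fun m => firstVariation P l σε (0, m)) K :=
    (continuousOn_firstVariation hvol hl hU hσ).comp (by fun_prop)
      fun m hm => ⟨mem_univ _, (κ.mem_sectionSource.1 (hKs hm)).2.1⟩
  have hK' : IsCompact (κ.φ '' K) := hK.image_of_continuousOn (κ.φ.continuousOn.mono hKsrc)
  have hK'D : κ.φ '' K ⊆ κ.sectionDomain U (σε 0) := by
    rintro _ ⟨m, hm, rfl⟩
    exact (hKs hm).2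
  have hint : IntegrableOn (fun x => firstVariation P l σε (0, κ.φ.symm x)) (κ.φ '' K) := by
    refine ContinuousOn.integrableOn_compact hK' ?_
    refine hfv.comp (κ.φ.continuousOn_symm.mono fun x hx => (hK'D hx).1) ?_
    rintro _ ⟨m, hm, rfl⟩
    rwa [κ.φ.left_inv (hKsrc hm)]
  have hdiv := fun μ => setIntegral_fderiv_eq_zero
    (κ.isOpen_sectionDomain hU (hσ.isSectionOn 0)) hK' hK'D
    (J := κ.boundaryTerm b l (σε 0) (variationField b κ.ψ (κ.coordFamily σε)) μ)
    (fun x hx => κ.contDiffAt_boundaryTerm hl hU (hσ.isSectionOn 0) hx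
      (κ.contDiffAt_variationField_coordFamily hU hσ hx) μ)
    (fun x hx => by
      have h := κ.variationField_eq_zero (b := b) hU hσ hx.1 fun ε => hoff ε _
        ⟨hx.1.2.1, fun h => hx.2 ⟨_, h, κ.φ.right_inv hx.1.1⟩⟩
      simp [boundaryTerm, h]) (EuclideanSpace.single μ 1)
  -- Solving the pointwise identity for the Euler-Poincaré pairing expresses it through terms
  -- already known to be integrable.
  have hpt : EqOn (fun x => ∑ A, variationField b κ.ψ (κ.coordFamily σε) x A *
      eulerPoincare κ b l (σε 0) x A)
      (fun x => (∑ μ, fderiv ℝ (κ.boundaryTerm b l (σε 0)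
        (variationField b κ.ψ (κ.coordFamily σε)) μ) x (EuclideanSpace.single μ 1)) -
          firstVariation P l σε (0, κ.φ.symm x)) (κ.φ '' K) := by
    rintro _ ⟨m, hm, rfl⟩
    simp only [κ.φ.left_inv (hKsrc hm)]
    rw [κ.firstVariation_eq_divergence (b := b) hl hU hσ (hKs hm), sub_sub_cancel]
  rw [setIntegral_compact_eq κ.unimodular hK hKsrc hfv,
    setIntegral_congr_fun hK'.measurableSet hpt,
    integral_sub (integrable_finsetSum _ fun μ _ => (hdiv μ).1) hint,
    integral_finsetSum _ fun μ _ => (hdiv μ).1]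
  simp [fun μ => (hdiv μ).2]

end LocalSystem

end LocalIntegral

end

end ReducedFieldTheory

namespace ReducedFieldTheory

noncomputable section

/-! ### Solutions of the Euler-Poincaré equations are stationary -/

/-- The family `σ_{ε ρ(m)}(m)`. -/
def reparametrize {M E : Type*} (ρ : M → ℝ) (σε : ℝ → M → E) (ε : ℝ) (m : M) : E := σε (ε * ρ m) m

theorem reparametrize_zero {M E : Type*} (ρ : M → ℝ) (σε : ℝ → M → E) :
    reparametrize ρ σε 0 = σε 0 := by
  funext m
  simp [reparametrize]

section Stationary

variable {n N : ℕ}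
  {M : Type*} [TopologicalSpace M] [ChartedSpace (EuclideanSpace ℝ (Fin (n + 1))) M]
  {G : Type*} [TopologicalSpace G] [ChartedSpace (EuclideanSpace ℝ (Fin N)) G] [Group G]
  {FE : Type*} [NormedAddCommGroup FE] [NormedSpace ℝ FE] {HE : Type*} [TopologicalSpace HE]
  {IE : ModelWithCorners ℝ FE HE} {E : Type*} [TopologicalSpace E] [ChartedSpace HE E]
  {P : PrincipalBundle n N M G IE E}
  {vol : ∀ x : M, TangentSpace (𝓡 (n + 1)) x [⋀^Fin (n + 1)]→L[ℝ] ℝ}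
  {b : Module.Basis (Fin N) ℝ (GroupLieAlgebra (𝓡 N) G)} {l : P.jetBundle → ℝ}
  {U : Set M} {σε : ℝ → M → E}

theorem IsSectionFamily.reparametrize (hσ : IsSectionFamily P U σε) {ρ : M → ℝ}
    (hρ : ContMDiff (𝓡 (n + 1)) 𝓘(ℝ, ℝ) ∞ ρ) :
    IsSectionFamily P U (reparametrize ρ σε) := by
  refine ⟨?_, fun ε m hm => hσ.proj_eq _ m hm⟩
  have h1 : ContMDiff (𝓘(ℝ, ℝ).prod (𝓡 (n + 1))) (𝓘(ℝ, ℝ).prod (𝓡 (n + 1))) ∞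
      (fun q : ℝ × M => (q.1 * ρ q.2, q.2)) :=
    (contMDiff_fst.mul (hρ.comp contMDiff_snd)).prodMk contMDiff_snd
  exact hσ.smooth.comp h1.contMDiffOn fun q hq => ⟨mem_univ _, hq.2⟩

/-- The `ε`-derivative of `y(ε ρ, x)` at `0` is `ρ ∂_ε y`. Rescaling time thus multiplies the
variation by a cut-off, although sections cannot be added. -/
theorem LocalSystem.variationField_reparametrize (κ : LocalSystem P vol) (hU : IsOpen U)
    (hσ : IsSectionFamily P U σε) {ρ : M → ℝ} (hρ : ContMDiff (𝓡 (n + 1)) 𝓘(ℝ, ℝ) ∞ ρ)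
    {x : EuclideanSpace ℝ (Fin (n + 1))} (hx : x ∈ κ.sectionDomain U (σε 0)) :
    variationField b κ.ψ (κ.coordFamily (reparametrize ρ σε)) x =
      ρ (κ.φ.symm x) • variationField b κ.ψ (κ.coordFamily σε) x := by
  have h1 := fderiv_apply_time
    ((κ.contDiffAt_coordFamily (q := (0, x)) hU hσ hx).differentiableAt (by simp))
  have h2 := fderiv_apply_time ((κ.contDiffAt_coordFamily (q := (0, x)) hU
    (hσ.reparametrize hρ) (by rwa [← reparametrize_zero ρ σε] at hx)).differentiableAt (by simp))
  have h3 : HasDerivAt (fun ε : ℝ => ε * ρ (κ.φ.symm x)) (ρ (κ.φ.symm x)) 0 := by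
    simpa using (hasDerivAt_id (0 : ℝ)).mul_const (ρ (κ.φ.symm x))
  have h4 := HasDerivAt.scomp_of_eq (0 : ℝ) h1 h3 (by simp)
  have h5 : κ.coordFamily (reparametrize ρ σε) (0, x) = κ.coordFamily σε (0, x) := by
    simp only [coordFamily, reparametrize_zero]
  rw [variationField, variationField, h2.unique h4, h5, map_smul]

theorem LocalSystem.boundaryTerm_sum (κ : LocalSystem P vol) {ι : Type*} [Fintype ι] {σ : M → E}
    (η : ι → EuclideanSpace ℝ (Fin (n + 1)) → Fin N → ℝ) (μ : Fin (n + 1))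
    (x : EuclideanSpace ℝ (Fin (n + 1))) :
    κ.boundaryTerm b l σ (fun x' => ∑ i, η i x') μ x = ∑ i, κ.boundaryTerm b l σ (η i) μ x := by
  simp only [boundaryTerm, Finset.sum_apply, Finset.mul_sum]
  exact Finset.sum_comm

theorem coordEulerPoincare_congr {ψ : OpenPartialHomeomorph G (EuclideanSpace ℝ (Fin N))}
    {L : JetCoord n N → ℝ} {y y' : EuclideanSpace ℝ (Fin (n + 1)) → EuclideanSpace ℝ (Fin N)}
    {x : EuclideanSpace ℝ (Fin (n + 1))} (h : y =ᶠ[nhds x] y') (A : Fin N) :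
    coordEulerPoincare b ψ L y x A = coordEulerPoincare b ψ L y' x A := by
  have hev : coordJet b ψ y =ᶠ[nhds x] coordJet b ψ y' := h.eventuallyEq_nhds.mono fun x' hx' => by
    simp only [coordJet, hx'.fderiv_eq, hx'.self_of_nhds]
  have hmom := fun μ => (hev.fun_comp fun z => fderiv ℝ L z (vecXi μ A)).fderiv_eq (𝕜 := ℝ)
  simp only [Function.comp_def] at hmom
  simp only [coordEulerPoincare, hmom, hev.self_of_nhds]

/-- Needed because a variation satisfies `σ₀ = σ` only on `U`; as functions on `M` the two may
differ. -/
theorem SatisfiesEulerPoincare.congr (hU : IsOpen U) {σ σ' : M → E} (hσ : P.IsSectionOn U σ)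
    (hσ' : P.IsSectionOn U σ') (h : EqOn σ σ' U) (hEP : SatisfiesEulerPoincare P vol b l U σ) :
    SatisfiesEulerPoincare P vol b l U σ' := by
  intro κ x hx A
  have hfib : ∀ x, κ.φ.symm x ∈ U → κ.fibre σ x = κ.fibre σ' x := fun x hx =>
    congrArg κ.triv.fib (h hx)
  have hxσ : x ∈ κ.sectionDomain U σ := ⟨hx.1, hx.2.1, by rw [hfib x hx.2.1]; exact hx.2.2⟩
  have hev : κ.coordSection σ' =ᶠ[nhds x] κ.coordSection σ := by
    filter_upwards [(κ.isOpen_preDomain hU).mem_nhds ⟨hx.1, hx.2.1⟩] with x' hx'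
    exact congrArg κ.ψ (hfib x' hx'.2).symm
  rw [eulerPoincare_eq κ hU hσ' hx, coordEulerPoincare_congr hev, ← eulerPoincare_eq κ hU hσ hxσ]
  exact hEP κ x hxσ A

variable [LieGroup (𝓡 N) ∞ G]

/-- The first variation along a solution is additive under partitions of unity. -/
theorem firstVariation_eq_sum_reparametrize (hl : IsSmoothLagrangian P vol b l) (hU : IsOpen U)
    (hσ : IsSectionFamily P U σε) (hEP : SatisfiesEulerPoincare P vol b l U (σε 0))
    {K : Set M} (hoff : ∀ ε, ∀ m ∈ U \ K, σε ε m = σε 0 m) {ι : Type*} [Fintype ι]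
    {ρ : ι → M → ℝ} (hρ : ∀ i, ContMDiff (𝓡 (n + 1)) 𝓘(ℝ, ℝ) ∞ (ρ i))
    (hsum : ∀ m ∈ K, ∑ i, ρ i m = 1) (κ : LocalSystem P vol) {m : M}
    (hm : m ∈ κ.sectionSource U (σε 0)) :
    firstVariation P l σε (0, m) = ∑ i, firstVariation P l (reparametrize (ρ i) σε) (0, m) := by
  have hη : ∀ x ∈ κ.sectionDomain U (σε 0), variationField b κ.ψ (κ.coordFamily σε) x =
      ∑ i, variationField b κ.ψ (κ.coordFamily (reparametrize (ρ i) σε)) x := by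
    intro x hx
    simp only [fun i => κ.variationField_reparametrize (b := b) hU hσ (hρ i) hx,
      ← Finset.sum_smul]
    -- The `ρ i` sum to `1` only on `K`, but off `K` the variation itself vanishes.
    by_cases hK : κ.φ.symm x ∈ K
    · rw [hsum _ hK, one_smul]
    · rw [κ.variationField_eq_zero hU hσ hx fun ε => hoff ε _ ⟨hx.2.1, hK⟩, smul_zero]
  have hm' : ∀ i, m ∈ κ.sectionSource U (reparametrize (ρ i) σε 0) := fun i => by
    rwa [reparametrize_zero]
  rw [κ.firstVariation_eq_divergence hl hU hσ hm]
  simp only [fun i => κ.firstVariation_eq_divergence hl hU (hσ.reparametrize (hρ i)) (hm' i),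
    reparametrize_zero, hEP κ _ hm.2, mul_zero, Finset.sum_const_zero, sub_zero]
  rw [Finset.sum_comm]
  refine Finset.sum_congr rfl fun μ _ => ?_
  -- After the equations of motion only divergences remain. They contain derivatives, so additivity
  -- of the boundary term is needed on a neighbourhood.
  have hev : κ.boundaryTerm b l (σε 0) (variationField b κ.ψ (κ.coordFamily σε)) μ =ᶠ[nhds (κ.φ m)]
      fun x => ∑ i, κ.boundaryTerm b l (σε 0)
        (variationField b κ.ψ (κ.coordFamily (reparametrize (ρ i) σε))) μ x := by
    filter_upwards [(κ.isOpen_sectionDomain hU (hσ.isSectionOn 0)).mem_nhds hm.2] with x hx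
    rw [← κ.boundaryTerm_sum]
    simp only [LocalSystem.boundaryTerm, hη x hx]
  rw [hev.fderiv_eq, fderiv_fun_sum fun i _ => ?_, sum_apply]
  exact (κ.contDiffAt_boundaryTerm hl hU (hσ.isSectionOn 0) hm.2
    (κ.contDiffAt_variationField_coordFamily hU (hσ.reparametrize (hρ i)) (hm' i).2)
      μ).differentiableAt one_ne_zero

/-- Finitely many local systems cover `K`. A partition of unity subordinate to them splits the first
variation into pieces, each supported in one local system, where
`LocalSystem.integral_firstVariation_eq` applies. -/
theorem SatisfiesEulerPoincare.isStationary [T2Space M] [SecondCountableTopology M]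
    [MeasurableSpace M] [BorelSpace M] [IsManifold (𝓡 (n + 1)) ∞ M] (hvol : IsVolumeForm vol)
    (hl : IsSmoothLagrangian P vol b l) (hU : IsOpen U) {σ : M → E} (hσ : P.IsSectionOn U σ)
    (hEP : SatisfiesEulerPoincare P vol b l U σ) : IsStationary P vol l U σ := by
  have : LocallyCompactSpace M :=
    ChartedSpace.locallyCompactSpace (EuclideanSpace ℝ (Fin (n + 1))) M
  rw [isStationary_iff hvol hl hU]
  intro K hK hKU σε hvar
  have hfam := hvar.isSectionFamily
  have hEP0 : SatisfiesEulerPoincare P vol b l U (σε 0) :=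
    hEP.congr hU hσ (hfam.isSectionOn 0) fun m hm => (hvar.eq_zero m hm).symm
  have hoff : ∀ ε, ∀ m ∈ U \ K, σε ε m = σε 0 m := fun ε m hm => by
    rw [hvar.eq_off ε m hm, hvar.eq_zero m hm.1]
  have hcover : K ⊆ ⋃ κ : LocalSystem P vol, κ.sectionSource U (σε 0) := fun m hm =>
    mem_iUnion.2 (exists_localSystem hvol P (hKU hm) (σε 0))
  obtain ⟨t, ht⟩ := hK.elim_finite_subcover _
    (fun κ => κ.isOpen_sectionSource hU (hfam.isSectionOn 0)) hcover
  obtain ⟨f, hf⟩ := SmoothPartitionOfUnity.exists_isSubordinate (𝓡 (n + 1)) hK.isClosed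
    (fun κ : t => κ.1.sectionSource U (σε 0))
    (fun κ => κ.1.isOpen_sectionSource hU (hfam.isSectionOn 0))
    (fun m hm => by simpa [mem_iUnion] using ht hm)
  have hρ : ∀ i, ContMDiff (𝓡 (n + 1)) 𝓘(ℝ, ℝ) ∞ (f i) := fun i => (f i).contMDiff
  have hsum : ∀ m ∈ K, ∑ i, f i m = 1 := fun m hm => by
    rw [← finsum_eq_sum_of_fintype]
    exact f.sum_eq_one hm
  have hpt : EqOn (fun m => firstVariation P l σε (0, m))
      (fun m => ∑ i, firstVariation P l (reparametrize (f i) σε) (0, m)) K := fun m hm => by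
    obtain ⟨κ, hκ⟩ := exists_localSystem hvol P (hKU hm) (σε 0)
    exact firstVariation_eq_sum_reparametrize hl hU hfam hEP0 hoff hρ hsum κ hκ
  have := isFiniteMeasureOnCompacts_volumeMeasure hvol
  rw [setIntegral_congr_fun hK.measurableSet hpt, integral_finsetSum]
  · refine Finset.sum_eq_zero fun i _ => ?_
    have hi := hfam.reparametrize (hρ i)
    -- The reparametrised family moves only on this compact set, which lies in the `i`-th local
    -- system.
    have hKi : IsCompact (K ∩ tsupport (f i)) := hK.inter_right (isClosed_tsupport _)
    have hoffi : ∀ ε, ∀ m ∈ U \ (K ∩ tsupport (f i)),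
        reparametrize (f i) σε ε m = reparametrize (f i) σε 0 m := by
      intro ε m hm
      by_cases hmK : m ∈ K
      · have : f i m = 0 := image_eq_zero_of_notMem_tsupport fun h => hm.2 ⟨hmK, h⟩
        simp [reparametrize, this]
      · simp only [reparametrize]
        rw [hoff _ m ⟨hm.1, hmK⟩, zero_mul]
    have hz : ∀ m ∈ K \ (K ∩ tsupport (f i)),
        firstVariation P l (reparametrize (f i) σε) (0, m) = 0 := fun m hm =>
      firstVariation_eq_zero hU hKi.isClosed hoffi ⟨hKU hm.1, hm.2⟩
    rw [setIntegral_eq_of_subset_of_forall_sdiff_eq_zero hK.measurableSet inter_subset_left hz,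
      i.1.integral_firstVariation_eq hvol hl hU hi hKi ?_ hoffi]
    · rw [neg_eq_zero]
      refine setIntegral_eq_zero_of_forall_eq_zero fun x hx => ?_
      obtain ⟨m, hm, rfl⟩ := hx
      refine Finset.sum_eq_zero fun A _ => ?_
      rw [reparametrize_zero, hEP0 i.1 _ (hf i hm.2).2, mul_zero]
    · rw [reparametrize_zero]
      exact fun m hm => hf i hm.2
  · intro i _
    refine ContinuousOn.integrableOn_compact hK ?_
    exact (continuousOn_firstVariation hvol hl hU (hfam.reparametrize (hρ i))).comp (by fun_prop)
      fun m hm => ⟨mem_univ _, hKU hm⟩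

end Stationary

end

end ReducedFieldTheory

namespace ReducedFieldTheory

noncomputable section

/-! ### Stationary sections satisfy the Euler-Poincaré equations -/

section Necessity

variable {n N : ℕ}
  {M : Type*} [TopologicalSpace M] [ChartedSpace (EuclideanSpace ℝ (Fin (n + 1))) M]
  {G : Type*} [TopologicalSpace G] [ChartedSpace (EuclideanSpace ℝ (Fin N)) G] [Group G]
  {FE : Type*} [NormedAddCommGroup FE] [NormedSpace ℝ FE] {HE : Type*} [TopologicalSpace HE]
  {IE : ModelWithCorners ℝ FE HE} {E : Type*} [TopologicalSpace E] [ChartedSpace HE E]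
  {P : PrincipalBundle n N M G IE E}
  {vol : ∀ x : M, TangentSpace (𝓡 (n + 1)) x [⋀^Fin (n + 1)]→L[ℝ] ℝ}
  {b : Module.Basis (Fin N) ℝ (GroupLieAlgebra (𝓡 N) G)} {l : P.jetBundle → ℝ}
  {U : Set M} {σ : M → E}

/-- The variation `m ↦ σ(m) · c(ε f(m))`. -/
def translate (P : PrincipalBundle n N M G IE E) (c : ℝ → G) (f : M → ℝ) (σ : M → E)
    (ε : ℝ) (m : M) : E := P.act (σ m) (c (ε * f m))

/-- The right action is global and preserves fibres, so this variation is defined on all of `U`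
without gluing. -/
theorem isVariation_translate (hσ : P.IsSectionOn U σ) {c : ℝ → G}
    (hc : ContMDiff 𝓘(ℝ, ℝ) (𝓡 N) ∞ c) (hc1 : c 0 = 1) {f : M → ℝ}
    (hf : ContMDiff (𝓡 (n + 1)) 𝓘(ℝ, ℝ) ∞ f) {K : Set M} (hfK : ∀ m ∉ K, f m = 0) :
    IsVariation P U K σ (translate P c f σ) := by
  refine ⟨?_, fun ε m hm => ?_, fun m _ => ?_, fun ε m hm => ?_⟩
  · have h1 : ContMDiff (𝓘(ℝ, ℝ).prod (𝓡 (n + 1))) (𝓡 N) ∞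
        (fun q : ℝ × M => c (q.1 * f q.2)) :=
      hc.comp (contMDiff_fst.mul (hf.comp contMDiff_snd))
    have h2 : ContMDiffOn (𝓘(ℝ, ℝ).prod (𝓡 (n + 1))) IE ∞ (fun q : ℝ × M => σ q.2)
        (univ ×ˢ U) := hσ.isSectionFamily.smooth
    exact P.contMDiff_act.comp_contMDiffOn (h2.prodMk h1.contMDiffOn)
  · rw [translate, P.proj_act, hσ.proj_eq m hm]
  · simp [translate, hc1, P.act_one]
  · simp [translate, hfK m hm.2, hc1, P.act_one]

/-- The support corresponds to a compact subset of `M`, closed because `M` is Hausdorff; this makes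
the extension by zero smooth at points outside the chart. -/
theorem contMDiff_indicator_comp_chart [T2Space M]
    {φ : OpenPartialHomeomorph M (EuclideanSpace ℝ (Fin (n + 1)))}
    (hφ : φ ∈ IsManifold.maximalAtlas (𝓡 (n + 1)) ∞ M) {g : EuclideanSpace ℝ (Fin (n + 1)) → ℝ}
    (hg : ContDiff ℝ ∞ g) (hgc : HasCompactSupport g) (hgs : tsupport g ⊆ φ.target) :
    ContMDiff (𝓡 (n + 1)) 𝓘(ℝ, ℝ) ∞ (φ.source.indicator fun m => g (φ m)) := by
  have hK : IsCompact (φ.symm '' tsupport g) :=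
    hgc.isCompact.image_of_continuousOn (φ.continuousOn_symm.mono hgs)
  intro m
  by_cases hm : m ∈ φ.source
  · refine (hg.contMDiff.contMDiffAt.comp m (contMDiffAt_chart hφ hm)).congr_of_eventuallyEq ?_
    filter_upwards [φ.open_source.mem_nhds hm] with m' hm'
    exact indicator_of_mem hm' _
  · have hmK : m ∉ φ.symm '' tsupport g := by
      rintro ⟨x, hx, rfl⟩
      exact hm (φ.map_target (hgs hx))
    refine (contMDiffAt_const (c := (0 : ℝ))).congr_of_eventuallyEq ?_
    filter_upwards [hK.isClosed.isOpen_compl.mem_nhds hmK] with m' hm'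
    by_cases hm's : m' ∈ φ.source
    · rw [indicator_of_mem hm's]
      exact image_eq_zero_of_notMem_tsupport fun h => hm' ⟨_, h, φ.left_inv hm's⟩
    · exact indicator_of_notMem hm's _

variable [LieGroup (𝓡 N) ∞ G]

/-- Every element of the Lie algebra is the velocity of a smooth curve. -/
theorem exists_curve (v : GroupLieAlgebra (𝓡 N) G) : ∃ c : ℝ → G,
    ContMDiff 𝓘(ℝ, ℝ) (𝓡 N) ∞ c ∧ c 0 = 1 ∧
      ∃ c' : ℝ →L[ℝ] EuclideanSpace ℝ (Fin N), c' 1 = v ∧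
        HasMFDerivAt 𝓘(ℝ, ℝ) (𝓡 N) c 0 c' := by
  have : IsManifold (𝓡 N) ∞ G := inferInstance
  let χ := chartAt (EuclideanSpace ℝ (Fin N)) (1 : G)
  have hχ : χ ∈ IsManifold.maximalAtlas (𝓡 N) ∞ G := IsManifold.chart_mem_maximalAtlas _
  have h1 : (1 : G) ∈ χ.source := mem_chart_source _ _
  let w : EuclideanSpace ℝ (Fin N) := 
    (mfderiv (𝓡 N) (𝓡 N) χ (χ.symm (χ 1)) : EuclideanSpace ℝ (Fin N) →L[ℝ] _) v
  obtain ⟨r, hr, hball⟩ := Metric.isOpen_iff.1 χ.open_target (χ 1) (χ.map_source h1)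
  -- This gives `δ ‖w‖ < r`, also when `w = 0`. The curve `χ 1 + δ sin(t / δ) w` then stays in the
  -- ball for all `t` and has velocity `w` at `0`, so it is globally defined without the exponential
  -- map.
  let δ : ℝ := r / (2 * (‖w‖ + 1))
  have hδ : 0 < δ := by positivity
  let γ : ℝ → EuclideanSpace ℝ (Fin N) := fun t => χ 1 + (δ * Real.sin (t / δ)) • w
  have hγ : ContDiff ℝ ∞ γ := by
    have : ContDiff ℝ ∞ Real.sin := Real.contDiff_sin
    fun_prop
  have hγ0 : γ 0 = χ 1 := by simp [γ]
  have hγt : ∀ t, γ t ∈ χ.target := fun t => hball <| by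
    have h2 : |δ * Real.sin (t / δ)| * ‖w‖ ≤ δ * ‖w‖ := by
      rw [abs_mul, abs_of_pos hδ]
      exact mul_le_mul_of_nonneg_right
        (mul_le_of_le_one_right hδ.le (Real.abs_sin_le_one _)) (norm_nonneg _)
    have h3 : δ * ‖w‖ < r := by
      have : δ * (2 * (‖w‖ + 1)) = r := div_mul_cancel₀ _ (by positivity)
      nlinarith [norm_nonneg w]
    simpa [γ, norm_smul] using h2.trans_lt h3
  have hγ' : HasDerivAt γ w 0 := by
    have h2 : HasDerivAt (fun t : ℝ => δ * Real.sin (t / δ)) 1 0 := by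
      have h3 : HasDerivAt (fun t : ℝ => t / δ) (1 / δ) 0 := (hasDerivAt_id 0).div_const δ
      have h4 := (h3.sin).const_mul δ
      simpa [hδ.ne'] using h4
    have h3 := (h2.smul_const w).const_add (χ 1)
    rwa [one_smul] at h3
  have hsymm : HasMFDerivAt (𝓡 N) (𝓡 N) χ.symm (γ 0) (mfderiv (𝓡 N) (𝓡 N) χ.symm (χ 1) :
      EuclideanSpace ℝ (Fin N) →L[ℝ] EuclideanSpace ℝ (Fin N)) := by
    rw [hγ0]
    exact ((contMDiffAt_chart_symm hχ (χ.map_source h1)).mdifferentiableAt (by simp)).hasMFDerivAt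
  refine ⟨fun t => χ.symm (γ t), fun t => (contMDiffAt_chart_symm hχ (hγt t)).comp t
    hγ.contMDiff.contMDiffAt, ?_, _, ?_, hsymm.comp 0 hγ'.hasFDerivAt.hasMFDerivAt⟩
  · simp only [hγ0, χ.left_inv h1]
  · refine Eq.trans ?_ (mfderiv_symm_chart_apply hχ (χ.map_source h1) v)
    exact congrArg (mfderiv (𝓡 N) (𝓡 N) χ.symm (χ 1) :
      EuclideanSpace ℝ (Fin N) →L[ℝ] EuclideanSpace ℝ (Fin N)) (one_smul ℝ w)

theorem continuousAt_force {ψ : OpenPartialHomeomorph G (EuclideanSpace ℝ (Fin N))}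
    (hψ : ψ ∈ IsManifold.maximalAtlas (𝓡 N) ∞ G) {L : JetCoord n N → ℝ} {z : JetCoord n N}
    (hz : z.2.1 ∈ ψ.target) (hL : ContDiffAt ℝ 2 L z) (A : Fin N) :
    ContinuousAt (fun z => force b ψ L z A) z := by
  have h1 : ∀ v, ContinuousAt (fun z' => fderiv ℝ L z' v) z := fun v =>
    (contDiffAt_momentum hL v).continuousAt
  have h2 : ∀ μ C, ContinuousAt (fun z' : JetCoord n N =>
      b.repr ⁅∑ B, z'.2.2 μ B • b B, b A⁆ C) z := fun μ C => by
    -- Antisymmetry moves `ξ_μ` to the second slot, where `repr_bracket_sum` expands the bracket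
    -- linearly.
    simp only [repr_bracket_swap b _ (b A), Finsupp.neg_apply, repr_bracket_sum]
    fun_prop
  have h3 : ∀ B, ContinuousAt (fun z' : JetCoord n N => frameMatrix b ψ z'.2.1 B A) z := fun B => by
    have h4 : ContinuousAt (fun z' : JetCoord n N => frame ψ (b A) z'.2.1) z :=
      ContinuousAt.comp (f := fun z' : JetCoord n N => z'.2.1)
        (contDiffAt_frame hψ hz (b A)).continuousAt (by fun_prop)
    exact (EuclideanSpace.proj (𝕜 := ℝ) B).continuous.continuousAt.comp h4
  unfold force
  fun_prop (disch := assumption)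

theorem LocalSystem.continuousOn_eulerPoincare (κ : LocalSystem P vol)
    (hl : IsSmoothLagrangian P vol b l) (hU : IsOpen U) (hσ : P.IsSectionOn U σ) (A : Fin N) :
    ContinuousOn (fun x => eulerPoincare κ b l σ x A) (κ.sectionDomain U σ) := by
  refine ContinuousOn.congr (f := fun x => coordEulerPoincare b κ.ψ (κ.expr b l)
    (κ.coordSection σ) x A) (fun x hx => ContinuousAt.continuousWithinAt ?_)
    fun x hx => eulerPoincare_eq κ hU hσ hx A
  have hy : ContDiffAt ℝ 3 (κ.coordFamily fun _ => σ) (0, x) :=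
    (κ.contDiffAt_coordFamily hU hσ.isSectionFamily hx).of_le ENat.LEInfty.out
  have hp := fun μ => contDiffAt_momentum_slice b κ.mem_maximalAtlas hy (κ.ψ.map_source hx.2.2)
    (hl.contDiffAt κ (κ.familyJet_mem_domain hx)) (vecXi μ A)
  have hjet := (contDiffAt_coordJet_slice b κ.mem_maximalAtlas hy
    (κ.ψ.map_source hx.2.2)).continuousAt
  have h1 : ContinuousAt (fun x => ∑ μ, fderiv ℝ (fun x' => fderiv ℝ (κ.expr b l)
      (coordJet b κ.ψ (κ.coordSection σ) x') (vecXi μ A)) x (EuclideanSpace.single μ 1)) x :=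
    tendsto_finsetSum _ fun μ _ =>
      (((hp μ).fderiv_right (m := 0) (by simp)).clm_apply contDiffAt_const).continuousAt
  exact h1.sub (ContinuousAt.comp (g := fun z => force b κ.ψ (κ.expr b l) z A)
    (continuousAt_force κ.mem_maximalAtlas (κ.ψ.map_source hx.2.2)
      (hl.contDiffAt κ (κ.coordJet_mem_domain hx)) A) hjet)

/-- By `LocalTriv.fib_act` the family reads `g · c(ε f)`, whose velocity at `ε = 0` is `f` times the
left-invariant field of `v` at `g`; the Maurer-Cartan form returns `f v`. -/
theorem LocalSystem.variationField_translate (κ : LocalSystem P vol) (hU : IsOpen U)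
    (hσ : P.IsSectionOn U σ) {c : ℝ → G} (hc : ContMDiff 𝓘(ℝ, ℝ) (𝓡 N) ∞ c) (hc1 : c 0 = 1)
    {v : GroupLieAlgebra (𝓡 N) G} {c' : ℝ →L[ℝ] EuclideanSpace ℝ (Fin N)} (hc'v : c' 1 = v)
    (hc' : HasMFDerivAt 𝓘(ℝ, ℝ) (𝓡 N) c 0 c') {f : M → ℝ}
    (hf : ContMDiff (𝓡 (n + 1)) 𝓘(ℝ, ℝ) ∞ f) {x : EuclideanSpace ℝ (Fin (n + 1))}
    (hx : x ∈ κ.sectionDomain U σ) (A : Fin N) :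
    variationField b κ.ψ (κ.coordFamily (translate P c f σ)) x A =
      f (κ.φ.symm x) * b.repr v A := by
  set m := κ.φ.symm x with hm_def
  set g := κ.triv.fib (σ m) with hg_def
  have hg : g ∈ κ.ψ.source := hx.2.2
  have hproj : P.proj (σ m) ∈ κ.triv.U := by
    rw [hσ.proj_eq m hx.2.1]
    exact κ.source_subset (κ.φ.map_target hx.1)
  have hσ0 : translate P c f σ 0 = σ := by
    funext m
    simp [translate, hc1, P.act_one]
  have hfam := (isVariation_translate hσ hc hc1 hf (K := univ) (by simp)).isSectionFamily
  have h1 := fderiv_apply_time ((κ.contDiffAt_coordFamily (q := (0, x)) hU hfam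
    (by rwa [← hσ0] at hx)).differentiableAt (by simp))
  have hline : (fun ε => κ.coordFamily (translate P c f σ) (ε, x)) =
      fun ε => κ.ψ (g * c (ε * f m)) := by
    funext ε
    simp only [coordFamily, fibre, translate, ← hm_def, κ.triv.fib_act hproj, hg_def]
  have hmul : HasMFDerivAt (𝓡 N) (𝓡 N) (fun h => g * h) (c 0)
      (mfderiv (𝓡 N) (𝓡 N) (fun h => g * h) (1 : G) :
        EuclideanSpace ℝ (Fin N) →L[ℝ] EuclideanSpace ℝ (Fin N)) := by
    rw [hc1]
    exact ((contMDiff_mul_left (I := 𝓡 N) (n := ∞) (a := g)).contMDiffAt.mdifferentiableAt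
      (by simp)).hasMFDerivAt
  have hchart : HasMFDerivAt (𝓡 N) (𝓡 N) κ.ψ (g * c 0) (mfderiv (𝓡 N) (𝓡 N) κ.ψ g :
      EuclideanSpace ℝ (Fin N) →L[ℝ] EuclideanSpace ℝ (Fin N)) := by
    rw [hc1, mul_one]
    exact ((contMDiffAt_chart κ.mem_maximalAtlas hg).mdifferentiableAt (by simp)).hasMFDerivAt
  have h2 : HasDerivAt (fun s => κ.ψ (g * c s)) (frame κ.ψ v (κ.ψ g)) 0 := by
    let F : ℝ →L[ℝ] EuclideanSpace ℝ (Fin N) :=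
      (mfderiv (𝓡 N) (𝓡 N) κ.ψ g : EuclideanSpace ℝ (Fin N) →L[ℝ] EuclideanSpace ℝ (Fin N)).comp
        ((mfderiv (𝓡 N) (𝓡 N) (fun h => g * h) (1 : G) :
          EuclideanSpace ℝ (Fin N) →L[ℝ] EuclideanSpace ℝ (Fin N)).comp c')
    have h3 : HasFDerivAt (fun s => κ.ψ (g * c s)) F 0 :=
      hasMFDerivAt_iff_hasFDerivAt.1 (hchart.comp 0 (hmul.comp 0 hc'))
    convert h3.hasDerivAt using 1
    have h4 : frame κ.ψ v (κ.ψ g) = mfderiv (𝓡 N) (𝓡 N) κ.ψ g (mulInvariantVectorField v g) := by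
      unfold frame
      rw [κ.ψ.left_inv hg]
    rw [h4, ← hc'v]
    rfl
  have h3 : HasDerivAt (fun ε : ℝ => ε * f m) (f m) 0 := by
    simpa using (hasDerivAt_id (0 : ℝ)).mul_const (f m)
  have h4 := HasDerivAt.scomp_of_eq (0 : ℝ) h2 h3 (by simp)
  rw [hline] at h1
  have h5 : κ.coordFamily (translate P c f σ) (0, x) = κ.ψ g := by
    simp only [coordFamily, hσ0]
    rfl
  rw [variationField, h1.unique h4, h5, map_smul, Pi.smul_apply, smul_eq_mul,
    coframe_frame b κ.mem_maximalAtlas (κ.ψ.map_source hg)]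

/-- Any test function `g` in coordinates becomes a cut-off `f` on `M`, and translation by `c(ε f)`
tests component `A` alone against `g`. -/
theorem IsStationary.satisfiesEulerPoincare [T2Space M] [MeasurableSpace M] [BorelSpace M]
    (hvol : IsVolumeForm vol) (hl : IsSmoothLagrangian P vol b l) (hU : IsOpen U)
    (hσ : P.IsSectionOn U σ) (h : IsStationary P vol l U σ) :
    SatisfiesEulerPoincare P vol b l U σ := by
  rw [isStationary_iff hvol hl hU] at h
  intro κ x hx A
  have hD := κ.isOpen_sectionDomain hU hσ
  have hcont := κ.continuousOn_eulerPoincare hl hU hσ A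
  have key : ∀ᵐ x, x ∈ κ.sectionDomain U σ → eulerPoincare κ b l σ x A = 0 := by
    refine hD.ae_eq_zero_of_integral_contDiff_smul_eq_zero
      (hcont.locallyIntegrableOn hD.measurableSet) fun g hg hgc hgs => ?_
    obtain ⟨c, hc, hc1, c', hc'v, hc'⟩ := exists_curve (b A)
    have hgt : tsupport g ⊆ κ.φ.target := fun x hx => (hgs hx).1
    set f : M → ℝ := κ.φ.source.indicator fun m => g (κ.φ m) with hf_def
    have hf : ContMDiff (𝓡 (n + 1)) 𝓘(ℝ, ℝ) ∞ f :=
      contMDiff_indicator_comp_chart κ.unimodular.mem_maximalAtlas hg hgc hgt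
    have hK : IsCompact (κ.φ.symm '' tsupport g) :=
      hgc.isCompact.image_of_continuousOn (κ.φ.continuousOn_symm.mono hgt)
    have hKU : κ.φ.symm '' tsupport g ⊆ U := by
      rintro _ ⟨x, hx, rfl⟩
      exact (hgs hx).2.1
    have hfK : ∀ m ∉ κ.φ.symm '' tsupport g, f m = 0 := by
      intro m hm
      by_cases hms : m ∈ κ.φ.source
      · rw [hf_def, indicator_of_mem hms]
        exact image_eq_zero_of_notMem_tsupport fun h => hm ⟨_, h, κ.φ.left_inv hms⟩
      · exact indicator_of_notMem hms _
    have hvar := isVariation_translate hσ hc hc1 hf hfK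
    have hσ0 : translate P c f σ 0 = σ := by
      funext m
      simp [translate, hc1, P.act_one]
    have h1 := h _ hK hKU _ hvar
    have himg : κ.φ '' (κ.φ.symm '' tsupport g) = tsupport g := by
      rw [image_image]
      exact (image_congr fun x hx => κ.φ.right_inv (hgt hx)).trans (image_id _)
    rw [κ.integral_firstVariation_eq hvol hl hU hvar.isSectionFamily hK ?_ ?_, neg_eq_zero, himg,
      hσ0] at h1
    · have h2 : EqOn (fun x => ∑ B, variationField b κ.ψ (κ.coordFamily (translate P c f σ)) x B *
          eulerPoincare κ b l σ x B) (fun x => g x • eulerPoincare κ b l σ x A) (tsupport g) := by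
        intro x hx
        have h3 : f (κ.φ.symm x) = g x := by
          rw [hf_def, indicator_of_mem (κ.φ.map_target (hgt hx)), κ.φ.right_inv (hgt hx)]
        simp [κ.variationField_translate hU hσ hc hc1 hc'v hc' hf (hgs hx), h3,
          Finsupp.single_apply]
      rw [setIntegral_congr_fun hgc.isCompact.measurableSet h2,
        setIntegral_eq_integral_of_forall_compl_eq_zero] at h1
      · exact h1
      · intro x hx
        rw [image_eq_zero_of_notMem_tsupport hx, zero_smul]
    · rw [hσ0]
      rintro _ ⟨x, hx, rfl⟩
      refine ⟨κ.φ.map_target (hgt hx), ?_⟩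
      rw [mem_preimage, κ.φ.right_inv (hgt hx)]
      exact hgs hx
    · intro ε m hm
      rw [hvar.eq_off ε m hm, hvar.eq_zero m hm.1]
  -- The fundamental lemma yields vanishing almost everywhere; continuity on the open domain
  -- upgrades it to every point.
  exact Measure.eqOn_open_of_ae_eq ((ae_restrict_iff' hD.measurableSet).2 key) hD hcont
    continuousOn_const hx

end Necessity

end

end ReducedFieldTheory

/-! ### The variation theorem. -/

open ReducedFieldTheory in
theorem mainTheorem2 {n N : ℕ}
    {M : Type*} [TopologicalSpace M] [T2Space M] [SecondCountableTopology M]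
    [MeasurableSpace M] [BorelSpace M]
    [ChartedSpace (EuclideanSpace ℝ (Fin (n + 1))) M] [IsManifold (𝓡 (n + 1)) ∞ M]
    (vol : ∀ x : M, TangentSpace (𝓡 (n + 1)) x [⋀^Fin (n + 1)]→L[ℝ] ℝ) (hvol : IsVolumeForm vol)
    {G : Type*} [TopologicalSpace G] [ChartedSpace (EuclideanSpace ℝ (Fin N)) G] [Group G]
    [LieGroup (𝓡 N) ∞ G]
    {FE : Type*} [NormedAddCommGroup FE] [NormedSpace ℝ FE] {HE : Type*} [TopologicalSpace HE]
    {IE : ModelWithCorners ℝ FE HE} {E : Type*} [TopologicalSpace E] [ChartedSpace HE E]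
    [IsManifold IE ∞ E]
    (P : PrincipalBundle n N M G IE E)
    (b : Module.Basis (Fin N) ℝ (GroupLieAlgebra (𝓡 N) G))
    (l : P.jetBundle → ℝ) (hl : IsSmoothLagrangian P vol b l)
    (U : Set M) (hU : IsOpen U) (σ : M → E) (hσ : P.IsSectionOn U σ) :
    List.TFAE [
      IsStationary P vol l U σ,
      SatisfiesEulerPoincare P vol b l U σ,
      PullbackVanishes P vol b l U σ,
      PullbackVanishesCompact P vol b l U σ] := by
  tfae_have 1 → 2 := IsStationary.satisfiesEulerPoincare hvol hl hU hσ
  tfae_have 2 → 1 := SatisfiesEulerPoincare.isStationary hvol hl hU hσ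
  tfae_have 2 → 3 := SatisfiesEulerPoincare.pullbackVanishes hl hU hσ
  tfae_have 3 → 4 := PullbackVanishes.compact
  tfae_have 4 → 2 := PullbackVanishesCompact.satisfiesEulerPoincare hl hU hσ
  tfae_finish
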